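/- Theorem (score approximation). Notation. For $t>0$ let $\alpha(t)=e^{-t/2}$ and $h(t)=1-e^{-t}$. For a distribution $P$ on $\mathbb R^n$, let $P_t$ be the law at time $t$ of the process $dX_t=-\tfrac12X_t\,dt+dW_t$ started from $P$. It has the density $p_t(x)=\int\phi_t(x\,|\,x_0)\,P(dx_0)$, where $\phi_t(\cdot\,|\,x_0)$ is the density of $\mathsf N(\alpha(t)x_0,h(t)I_n)$. Data. Let $1\le d\le D$, let $A\in\mathbb R^{D\times d}$ have orthonormal columns, let $z\sim P_z$ on $\mathbb R^d$ with density $p_z$, and let $P_{\rm data}$ be the law of $x=Az$. From now on $P_t$ and $p_t$ are the law and density at time $t$ of the process on $\mathbb R^D$ started from $P_{\rm data}$, and $p_t^{\sf LD}$ is the density at time $t$ of the process on $\mathbb R^d$ started from $P_z$. Put $s_\parallel(z,t)=A\nabla\log p_t^{\sf LD}(z)$. Assume: (i) $p_z>0$ is twice continuously differentiable, and $p_z(z)\le(2\pi)^{-d/2}C_1e^{-C_2\|z\|_2^2/2}$ whenever $\|z\|_2\ge B$, where $B,C_1,C_2>0$; (ii) $z\mapsto s_\parallel(z,t)$ is $\beta$-Lipschitz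 on $\mathbb R^d$ for every $t\in(0,T]$. Networks. ${\rm NN}(L,M,J,K,\kappa,\gamma,\gamma_t)$ is the set of functions $f(z,t)$, with values in $\mathbb R^d$, of the form $f(z,t)=W_L\sigma(\cdots\sigma(W_1[z^\top,t]^\top+b_1)\cdots)+b_L$, where $\sigma(a)=\max(a,0)$ acts entrywise, all dimensions of the $W_i$ are at most $M$, the total number of nonzero entries of the $W_i,b_i$ is at most $J$, all these entries are at most $\kappa$ in absolute value, and, for all $z,z_1,z_2\in\mathbb R^d$ and $t,t_1,t_2\in[0,T]$, $\|f(z,t)\|_2\le K$, $\|f(z_1,t)-f(z_2,t)\|_2\le\gamma\|z_1-z_2\|_2$ and $\|f(z,t_1)-f(z,t_2)\|_2\le\gamma_t|t_1-t_2|$. $\mathcal S_{\rm NN}$ is the set of functions $s_{V,f}(x,t)=\frac1{h(t)}Vf(V^\top x,t)-\frac1{h(t)}x$, where $V\in\mathbb R^{D\times d}$ has orthonormal columns and $f\in{\rm NN}(L,M,J,K,\kappa,\gamma,\gamma_t)$. Claim. For all $B,C_1,C_2>0$ there are constants $c_R,c_L,c_M,c_J,c_K,c_\kappa>0$, depending only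 on $B,C_1,C_2$, such that the following holds for all $1\le d\le D$, $0<t_0\le1\le T$, $0<\epsilon\le\frac12$, $\beta$, $A$ and $p_z$ as above. Put $\ell=\log\frac{d}{t_0\epsilon}$, $$\tau=\sup_{t\in[t_0,T]}\ \sup_{\|z\|_\infty\le c_R\sqrt{d\ell}}\Big\|\frac{\partial}{\partial t}\big[h(t)s_\parallel(z,t)\big]\Big\|_2,\qquad L=\Big\lceil c_L\Big(\log\frac1\epsilon+d\Big)\Big\rceil,\qquad K=c_K\cdot 2d^2\ell,$$ $$M=c_M(1+\beta)^d\max\{T\tau,\epsilon\}\,d^{d/2+1}\epsilon^{-(d+1)}\ell^{d/2},\qquad J=c_J(1+\beta)^d\max\{T\tau,\epsilon\}\,d^{d/2+1}\epsilon^{-(d+1)}\ell^{d/2}\Big(\log\frac1\epsilon+d\Big),$$ $$\kappa=c_\kappa\max\big\{2(1+\beta)\sqrt{d\ell},\,T\tau\big\},\qquad\gamma=10d(1+\beta),\qquad\gamma_t=10\tau.$$ Then there is an $f\in{\rm NN}(L,M,J,K,\kappa,\gamma,\gamma_t)$ such that the score network $s_{A,f}\in\mathcal S_{\rm NN}$ (with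 $V=A$) satisfies, for every $t\in[t_0,T]$, $$\|s_{A,f}(\cdot,t)-\nabla\log p_t(\cdot)\|_{L^2(P_t)}=\Big(\int\|s_{A,f}(x,t)-\nabla\log p_t(x)\|_2^2\,P_t(dx)\Big)^{1/2}\le\frac{\sqrt d+1}{h(t)}\,\epsilon.$$ -/

import Mathlib

open MeasureTheory Matrix

noncomputable section

namespace ScoreApprox

/-- `ℝⁿ` with the Euclidean norm. -/
abbrev E (n : ℕ) := EuclideanSpace ℝ (Fin n)

/-! ### The forward Ornstein-Uhlenbeck process -/

/-- Signal coefficient `α(t) = e^{-t/2}`. -/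
def alpha (t : ℝ) : ℝ := Real.exp (-t / 2)

/-- Noise variance `h(t) = 1 - α(t)² = 1 - e^{-t}`. -/
def noiseVar (t : ℝ) : ℝ := 1 - Real.exp (-t)

/-- Transition density `φ_t(x | x₀)` of the process: the density at `x` of `N(α(t) x₀, h(t) I)`. -/
def transDensity {n : ℕ} (t : ℝ) (x x₀ : E n) : ℝ :=
  (2 * Real.pi * noiseVar t) ^ (-(n : ℝ) / 2) *
    Real.exp (-‖x - alpha t • x₀‖ ^ 2 / (2 * noiseVar t))

/-- Density at time `t > 0` of the process started from the law `P`. -/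
def marginalDensity {n : ℕ} (P : Measure (E n)) (t : ℝ) (x : E n) : ℝ :=
  ∫ x₀, transDensity t x x₀ ∂P

/-- Law `P_t` at time `t > 0` of the process started from the law `P`. -/
def marginalLaw {n : ℕ} (P : Measure (E n)) (t : ℝ) : Measure (E n) :=
  volume.withDensity fun x => ENNReal.ofReal (marginalDensity P t x)

/-- Score `∇ log p_t` of the process started from the law `P`. -/
def score {n : ℕ} (P : Measure (E n)) (t : ℝ) (x : E n) : E n :=
  gradient (fun y => Real.log (marginalDensity P t y)) x

/-! ### Data on a linear subspace -/

/-- The latent law `P_z` with density `p`. -/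
def latentLaw {d : ℕ} (p : E d → ℝ) : Measure (E d) :=
  volume.withDensity fun z => ENNReal.ofReal (p z)

/-- The law of `x = A z` with `z ∼ P_z`. -/
def dataLaw {d D : ℕ} (A : Matrix (Fin D) (Fin d) ℝ) (p : E d → ℝ) : Measure (E D) :=
  (latentLaw p).map (toEuclideanLin A)

/-- On-support score `s_∥(z, t) = A ∇ log p_t^{LD}(z)`, where `p_t^{LD}` is the density at time `t`
of the process in the latent space started from `P_z`. -/
def onSupportScore {d D : ℕ} (A : Matrix (Fin D) (Fin d) ℝ) (p : E d → ℝ) (z : E d) (t : ℝ) :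
    E D :=
  toEuclideanLin A (score (latentLaw p) t z)

/-- `τ(R) = sup_{t ∈ [t₀, T]} sup_{‖z‖_∞ ≤ R} ‖∂/∂t [h(t) s_∥(z, t)]‖₂`. -/
def timeLip {d D : ℕ} (A : Matrix (Fin D) (Fin d) ℝ) (p : E d → ℝ) (t₀ T R : ℝ) : ℝ :=
  sSup {r : ℝ | ∃ t ∈ Set.Icc t₀ T, ∃ z : E d, (∀ i, |z i| ≤ R) ∧
    r = ‖deriv (fun s => noiseVar s • onSupportScore A p z s) t‖}

/-! ### ReLU networks -/

/-- Parameters `(W₁, b₁), …, (W_L, b_L)`, `L ≥ 1`, of a feedforward network with `n` inputs and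
`m` outputs; the constructor `layer` prepends a first layer. -/
inductive ReLUNet : ℕ → ℕ → Type
  | last {n m : ℕ} (W : Matrix (Fin m) (Fin n) ℝ) (b : Fin m → ℝ) : ReLUNet n m
  | layer {n k m : ℕ} (W : Matrix (Fin k) (Fin n) ℝ) (b : Fin k → ℝ) (N : ReLUNet k m) :
      ReLUNet n m

namespace ReLUNet

/-- The function `x ↦ W_L σ(⋯ σ(W₁ x + b₁) ⋯) + b_L`, with `σ(a) = max(a, 0)` entrywise. -/
def eval : {n m : ℕ} → ReLUNet n m → (Fin n → ℝ) → (Fin m → ℝ)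
  | _, _, .last W b, x => W *ᵥ x + b
  | _, _, .layer W b N, x => N.eval fun i => max ((W *ᵥ x + b) i) 0

/-- The number `L` of layers. -/
def depth : {n m : ℕ} → ReLUNet n m → ℕ
  | _, _, .last _ _ => 1
  | _, _, .layer _ _ N => N.depth + 1

/-- The largest dimension of a weight matrix. -/
def width : {n m : ℕ} → ReLUNet n m → ℕ
  | n, m, .last _ _ => max n m
  | n, _, .layer (k := k) _ _ N => max (max n k) N.width

/-- The number of nonzero entries of a matrix. -/
def nnzMatrix {m n : ℕ} (W : Matrix (Fin m) (Fin n) ℝ) : ℕ :=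
  (Finset.univ.filter fun q : Fin m × Fin n => W q.1 q.2 ≠ 0).card

/-- The number of nonzero entries of a vector. -/
def nnzVec {m : ℕ} (b : Fin m → ℝ) : ℕ :=
  (Finset.univ.filter fun i => b i ≠ 0).card

/-- The number `∑ᵢ (‖Wᵢ‖₀ + ‖bᵢ‖₀)` of nonzero parameters. -/
def nnz : {n m : ℕ} → ReLUNet n m → ℕ
  | _, _, .last W b => nnzMatrix W + nnzVec b
  | _, _, .layer W b N => nnzMatrix W + nnzVec b + N.nnz

/-- All entries of all `Wᵢ` and `bᵢ` are at most `κ` in absolute value. -/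
def WeightsLE (κ : ℝ) : {n m : ℕ} → ReLUNet n m → Prop
  | _, _, .last W b => (∀ i j, |W i j| ≤ κ) ∧ ∀ i, |b i| ≤ κ
  | _, _, .layer W b N => (∀ i j, |W i j| ≤ κ) ∧ (∀ i, |b i| ≤ κ) ∧ N.WeightsLE κ

end ReLUNet

/-- The class `NN(L, M, J, K, κ, γ, γ_t)` of functions `f(z, t)`, `z ∈ ℝᵈ`, with values in `ℝᵈ`. -/
def reluClass (d : ℕ) (T : ℝ) (L : ℕ) (M J K κ γ γt : ℝ) : Set (E d → ℝ → E d) :=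
  {f | (∃ N : ReLUNet (d + 1) d,
          (∀ z t, f z t = WithLp.toLp 2 (N.eval (Fin.snoc (α := fun _ => ℝ) (fun i => z i) t))) ∧
          N.depth = L ∧ (N.width : ℝ) ≤ M ∧ (N.nnz : ℝ) ≤ J ∧ N.WeightsLE κ) ∧
       (∀ z, ∀ t ∈ Set.Icc 0 T, ‖f z t‖ ≤ K) ∧
       (∀ z₁ z₂, ∀ t ∈ Set.Icc 0 T, ‖f z₁ t - f z₂ t‖ ≤ γ * ‖z₁ - z₂‖) ∧
       (∀ z, ∀ t₁ ∈ Set.Icc 0 T, ∀ t₂ ∈ Set.Icc 0 T, ‖f z t₁ - f z t₂‖ ≤ γt * |t₁ - t₂|)}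

/-- The score network `s_{V,θ}(x, t) = h(t)⁻¹ V f(Vᵀ x, t) - h(t)⁻¹ x`. -/
def scoreNet {d D : ℕ} (V : Matrix (Fin D) (Fin d) ℝ) (f : E d → ℝ → E d) (x : E D) (t : ℝ) :
    E D :=
  (1 / noiseVar t) • toEuclideanLin V (f (toEuclideanLin Vᵀ x) t) - (1 / noiseVar t) • x

/-- The class `S_NN(L, M, J, K, κ, γ, γ_t)` of score networks on `ℝᴰ` with latent dimension `d`. -/
def scoreNetClass (d D : ℕ) (T : ℝ) (L : ℕ) (M J K κ γ γt : ℝ) : Set (E D → ℝ → E D) :=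
  {s | ∃ V : Matrix (Fin D) (Fin d) ℝ, Vᵀ * V = 1 ∧
    ∃ f ∈ reluClass d T L M J K κ γ γt, s = scoreNet V f}

/-! ### The hyperparameters -/

/-- `log(d / (t₀ ε))`. -/
def logFactor (d : ℕ) (t₀ ε : ℝ) : ℝ := Real.log (d / (t₀ * ε))

/-- `log(1/ε) + d`. -/
def depthRate (d : ℕ) (ε : ℝ) : ℝ := Real.log (1 / ε) + d

/-- `(1+β)^d max{Tτ, ε} d^{d/2+1} ε^{-(d+1)} log^{d/2}(d/(t₀ε))`. -/
def widthRate (d : ℕ) (β T t₀ τ ε : ℝ) : ℝ :=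
  (1 + β) ^ d * max (T * τ) ε * (d : ℝ) ^ ((d : ℝ) / 2 + 1) * (ε ^ (d + 1))⁻¹ *
    logFactor d t₀ ε ^ ((d : ℝ) / 2)

/-- `2 d² log(d/(t₀ε))`. -/
def rangeRate (d : ℕ) (t₀ ε : ℝ) : ℝ := 2 * (d : ℝ) ^ 2 * logFactor d t₀ ε

/-- `max{2(1+β) √(d log(d/(t₀ε))), Tτ}`. -/
def weightRate (d : ℕ) (β T t₀ τ ε : ℝ) : ℝ :=
  max (2 * (1 + β) * √(d * logFactor d t₀ ε)) (T * τ)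

end ScoreApprox

end

/-! By Tweedie's formula (`score_eq`) a score equals `h(t)⁻¹ (g - x)`, where `g` (`posterior`) is
`α(t)` times the conditional mean of the starting point given the noised point. When the data are `A
z` with orthonormal columns, the Gaussian kernel splits orthogonally, so the ambient `g` is `A`
applied to the latent `g` at `Aᵀ x` (`posterior_map`). The terms `-x / h(t)` cancel, and the error
of a score network is exactly `h(t)⁻¹ ‖f(Aᵀ x, t) - g(Aᵀ x, t)‖` (`scoreNet_sub_score`). It remains
to approximate the latent `g` in `L²` of the law of `Aᵀ x_t`, a problem in which `D` plays no role.

Regularity. Since `g(z, t) = z + h(t) Aᵀ s_∥(z, t)` and `h ≤ 1`, `g` is `(1+β)`-Lipschitz in `z`; by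
the definition of `τ` it is `τ`-Lipschitz in `t` on a cube. It grows at most linearly
(`norm_posterior_le`), uniformly in `t`.

Approximation. On a grid of mesh `1/(Λ(1+β))` in space and `1/(Λτ)` in time, with `Λ = 2/ε`, `g` is
replaced by its piecewise linear interpolant on the Freudenthal triangulation
(`exists_mem_reluClass`). This interpolant has two forms. As the average over `θ ∈ [0,1]` of the
nodal values at `⌊x + θ⌋` it inherits sup bounds and `ℓ¹` Lipschitz constants from the nodal values
without loss. As a combination of translates of the tent `hat` it is computed exactly by a ReLU
network (`exists_tent_network`). The network thus equals the interpolant for `t ∈ [0,T]`, and the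
constraints of the class are read off from the averages. The factor `Λ` is spread over many layers
to keep the weights bounded.

Tails. `Aᵀ x_t` has an exponential square moment at most `e^{(k₀+1)d}`
(`lintegral_exp_marginalLaw_le`), so outside a ball with `r₀² ≍ d + log(1/ε)` linear growth suffices
(`eLpNorm_scoreNet_sub_score_le`).

Counting. The grid has a factor of order `(C r₀ (1+β)/ε)^d`, and `C^d` is not allowed in a constant
independent of `d`. But `r₀² ≤ S² d ℓ / log(2d)` (from `add_log_le`), and the gain `(log 2d)^{-d/2}`
beats `C^d` together with a spare factor `d` (`exists_forall_mul_pow_le`, `card_lattice_mul_sq_le`).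
-/

noncomputable section
namespace ScoreApprox

/-! ### Building networks layer by layer -/

/-- The function `G`, whose inputs are indexed by `k`, is computed by a network of depth `L`, width
at most `w`, at most `L * Q` nonzero parameters and parameters bounded by `κ`, however the inputs
are numbered. -/
def Computes {k : Type} [Fintype k] {m : ℕ} (G : (k → ℝ) → Fin m → ℝ) (L w Q : ℕ) (κ : ℝ) : Prop :=
  ∀ (n : ℕ) (e : k ≃ Fin n), ∃ N : ReLUNet n m, (∀ y : k → ℝ, N.eval (y ∘ e.symm) = G y) ∧
    N.depth = L ∧ N.width ≤ w ∧ N.nnz ≤ L * Q ∧ N.WeightsLE κ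

lemma nnzMatrix_submatrix {k l : Type} [Fintype k] [Fintype l] {a b : ℕ} (W : Matrix k l ℝ)
    (e : k ≃ Fin a) (f : l ≃ Fin b) :
    ReLUNet.nnzMatrix (W.submatrix e.symm f.symm) =
      (Finset.univ.filter fun q : k × l => W q.1 q.2 ≠ 0).card := by
  unfold ReLUNet.nnzMatrix
  refine Finset.card_equiv (e.prodCongr f).symm fun q => ?_
  rw [Finset.mem_filter, Finset.mem_filter]
  simp

lemma nnzVec_le {m : ℕ} (b : Fin m → ℝ) : ReLUNet.nnzVec b ≤ m :=
  (Finset.card_filter_le _ _).trans (by simp)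

lemma mulVec_submatrix_apply {k l : Type} [Fintype k] [Fintype l] {a b : ℕ} (W : Matrix k l ℝ)
    (e : k ≃ Fin a) (f : l ≃ Fin b) (y : l → ℝ) (i : Fin a) :
    (W.submatrix e.symm f.symm *ᵥ (y ∘ f.symm)) i = (W *ᵥ y) (e.symm i) := by
  simp only [Matrix.mulVec, dotProduct, Matrix.submatrix_apply, Function.comp_apply]
  exact Equiv.sum_comp f.symm fun j => W (e.symm i) j * y j

lemma Computes.linear {k : Type} [Fintype k] {m w Q : ℕ} {κ : ℝ} (W : Matrix (Fin m) k ℝ)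
    (hκ : 0 ≤ κ) (hW : ∀ i j, |W i j| ≤ κ) (hw : Fintype.card k ≤ w) (hm : m ≤ w)
    (hQ : m * Fintype.card k ≤ Q) : Computes (fun y => W *ᵥ y) 1 w Q κ := by
  intro n e
  have hn : n = Fintype.card k := by rw [Fintype.card_congr e, Fintype.card_fin]
  refine ⟨.last (W.submatrix (Equiv.refl _).symm e.symm) 0, fun y => ?_, rfl, ?_, ?_, ?_⟩
  · ext i
    simp only [ReLUNet.eval, add_zero]
    exact mulVec_submatrix_apply W (Equiv.refl _) e y i
  · simp only [ReLUNet.width]; omega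
  · simp only [ReLUNet.nnz, nnzMatrix_submatrix, one_mul]
    have h0 : ReLUNet.nnzVec (0 : Fin m → ℝ) = 0 := by simp [ReLUNet.nnzVec]
    rw [h0, add_zero]
    exact (Finset.card_filter_le _ _).trans (by simpa using hQ)
  · exact ⟨fun i j => hW _ _, fun i => by simpa using hκ⟩

lemma Computes.layer {l k : Type} [Fintype l] [Fintype k] {m L w Q : ℕ} {κ : ℝ}
    {G : (k → ℝ) → Fin m → ℝ} (hG : Computes G L w Q κ) (W : Matrix k l ℝ) (b : k → ℝ)
    (hW : ∀ i j, |W i j| ≤ κ) (hb : ∀ i, |b i| ≤ κ) (hk : Fintype.card k ≤ w)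
    (hl : Fintype.card l ≤ w)
    (hQ : (Finset.univ.filter fun q : k × l => W q.1 q.2 ≠ 0).card + Fintype.card k ≤ Q) :
    Computes (fun y => G fun i => max ((W *ᵥ y + b) i) 0) (L + 1) w Q κ := by
  intro n e
  have hn : n = Fintype.card l := by rw [Fintype.card_congr e, Fintype.card_fin]
  obtain ⟨N, hN, hd, hw, hs, hWN⟩ := hG _ (Fintype.equivFin k)
  refine ⟨.layer (W.submatrix (Fintype.equivFin k).symm e.symm) (b ∘ (Fintype.equivFin k).symm) N,
    fun y => ?_, ?_, ?_, ?_, ?_⟩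
  · simp only [ReLUNet.eval, ← hN]
    congr 1
    ext i
    simp only [Pi.add_apply, mulVec_submatrix_apply, Function.comp_apply]
  · simp only [ReLUNet.depth, hd]
  · simp only [ReLUNet.width]; omega
  · simp only [ReLUNet.nnz, nnzMatrix_submatrix]
    have := nnzVec_le (b ∘ (Fintype.equivFin k).symm)
    have h2 : (L + 1) * Q = L * Q + Q := by ring
    omega
  · exact ⟨fun i j => hW _ _, fun i => hb _, hWN⟩

/-- A layer acting separately on every block `v : V`. -/
lemma Computes.blockLayer {V I I' : Type} [Fintype V] [DecidableEq V] [Fintype I] [Fintype I']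
    {m L w Q : ℕ} {κ : ℝ} {G : (V × I' → ℝ) → Fin m → ℝ} (hG : Computes G L w Q κ)
    (W : V → Matrix I' I ℝ) (b : V → I' → ℝ) (F : (V × I → ℝ) → V × I' → ℝ)
    (hF : ∀ x v i', F x (v, i') = max (∑ i, W v i' i * x (v, i) + b v i') 0) (hκ : 0 ≤ κ)
    (hW : ∀ v i j, |W v i j| ≤ κ) (hb : ∀ v i, |b v i| ≤ κ)
    (hI : Fintype.card V * Fintype.card I ≤ w) (hI' : Fintype.card V * Fintype.card I' ≤ w)
    (hQ : Fintype.card V * (Fintype.card I' * Fintype.card I + Fintype.card I') ≤ Q) :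
    Computes (fun y => G (F y)) (L + 1) w Q κ := by
  classical
  let W' : Matrix (V × I') (V × I) ℝ := fun r c => if r.1 = c.1 then W r.1 r.2 c.2 else 0
  have key := hG.layer W' (fun r => b r.1 r.2) ?_ (fun r => hb _ _) (by simpa using hI')
    (by simpa using hI) ?_
  · convert key using 3 with y
    ext ⟨v, i'⟩
    rw [hF]
    congr 2
    simp only [Matrix.mulVec, dotProduct, W', Fintype.sum_prod_type, ite_mul, zero_mul]
    rw [Finset.sum_eq_single v (fun w _ hw => by simp [hw.symm]) (by simp)]
    simp
  · intro r c
    simp only [W']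
    split_ifs
    · exact hW _ _ _
    · simpa using hκ
  · have hle : (Finset.univ.filter fun q : (V × I') × (V × I) => W' q.1 q.2 ≠ 0).card ≤
        Fintype.card (V × (I' × I)) := by
      rw [← Finset.card_univ]
      refine Finset.card_le_card_of_injOn (fun q => (q.1.1, (q.1.2, q.2.2))) (by simp) ?_
      rintro ⟨⟨v, i'⟩, w, i⟩ h ⟨⟨v', j'⟩, w', j⟩ h' heq
      simp only [ne_eq, Finset.coe_filter, Finset.mem_univ, true_and, Set.mem_ofPred_eq, W',
        ite_eq_right_iff, Classical.not_imp] at h h'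
      simp only [Prod.mk.injEq] at heq ⊢
      obtain ⟨rfl, rfl, rfl⟩ := heq
      exact ⟨⟨rfl, rfl⟩, h.1.symm.trans h'.1, rfl⟩
    simp only [Fintype.card_prod] at hle ⊢
    nlinarith

/-! ### Maximum of a vector by a chain of layers -/

/-- The maximum of `0` and all entries of `y`. -/
def posMax {ι : Type} [Fintype ι] (y : ι → ℝ) : ℝ := Finset.univ.fold max 0 y

lemma posMax_le_iff {ι : Type} [Fintype ι] {y : ι → ℝ} {c : ℝ} :
    posMax y ≤ c ↔ 0 ≤ c ∧ ∀ i, y i ≤ c := by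
  simp [posMax, Finset.fold_max_le]

lemma posMax_lt_iff {ι : Type} [Fintype ι] {y : ι → ℝ} {c : ℝ} :
    posMax y < c ↔ 0 < c ∧ ∀ i, y i < c := by
  simp [posMax, Finset.fold_max_lt]

lemma posMax_max_zero {ι : Type} [Fintype ι] (y : ι → ℝ) :
    posMax (fun i => max (y i) 0) = posMax y := by
  refine eq_of_forall_ge_iff fun c => ?_
  simp only [posMax_le_iff, max_le_iff]
  exact ⟨fun h => ⟨h.1, fun i => (h.2 i).1⟩, fun h => ⟨h.1, fun i => ⟨h.2 i, h.1⟩⟩⟩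

lemma foldl_max_le_iff {ι : Type} (y : ι → ℝ) (l : List ι) (a c : ℝ) :
    l.foldl (fun b j => max b (y j)) a ≤ c ↔ a ≤ c ∧ ∀ j ∈ l, y j ≤ c := by
  induction l generalizing a with
  | nil => simp
  | cons j l ih => simp [ih, and_assoc]

lemma foldl_max_univ {ι : Type} [Fintype ι] (y : ι → ℝ) :
    (Finset.univ : Finset ι).toList.foldl (fun b j => max b (y j)) 0 = posMax y := by
  refine eq_of_forall_ge_iff fun c => ?_
  simp [foldl_max_le_iff, posMax_le_iff]

/-- One layer of the maximum: the running maximum is the sum of the two entries `inr _`. -/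
def maxStep {V ι : Type} (j : ι) (x : V × (Bool × (ι ⊕ Bool)) → ℝ) :
    V × (Bool × (ι ⊕ Bool)) → ℝ
  | (v, σ, .inl i) => max (x (v, σ, .inl i)) 0
  | (v, σ, .inr false) => max (x (v, σ, .inr false) + x (v, σ, .inr true)) 0
  | (v, σ, .inr true) =>
      max (x (v, σ, .inl j) - x (v, σ, .inr false) - x (v, σ, .inr true)) 0

/-- Each layer uses `max b y = b + (y - b)₊`. The running maximum `b` is nonnegative, so it survives
the activation in one slot while the increment enters the other; their sum is the new maximum. The
entries `inl i` are nonnegative and are carried along unchanged. -/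
lemma foldl_maxStep {V ι : Type} (l : List ι) (v : V) (σ : Bool)
    (x : V × (Bool × (ι ⊕ Bool)) → ℝ) (hx : ∀ i, 0 ≤ x (v, σ, .inl i))
    (h0 : 0 ≤ x (v, σ, .inr false) + x (v, σ, .inr true)) :
    (l.foldl (fun x j => maxStep j x) x) (v, σ, .inr false) +
      (l.foldl (fun x j => maxStep j x) x) (v, σ, .inr true) =
      l.foldl (fun b j => max b (x (v, σ, .inl j)))
        (x (v, σ, .inr false) + x (v, σ, .inr true)) := by
  induction l generalizing x with
  | nil => rfl
  | cons j l ih =>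
    have e1 : ∀ i, maxStep j x (v, σ, .inl i) = x (v, σ, .inl i) := fun i => by
      simp [maxStep, hx i]
    have e2 : maxStep j x (v, σ, .inr false) + maxStep j x (v, σ, .inr true) =
        max (x (v, σ, .inr false) + x (v, σ, .inr true)) (x (v, σ, .inl j)) := by
      simp only [maxStep, max_eq_left h0]
      rcases le_total (x (v, σ, .inl j)) (x (v, σ, .inr false) + x (v, σ, .inr true)) with h | h
      · rw [max_eq_left h, max_eq_right (by linarith)]; ring
      · rw [max_eq_right h, max_eq_left (by linarith)]; ring
    rw [List.foldl_cons, List.foldl_cons, ih (maxStep j x) (fun i => by rw [e1]; exact hx i)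
      (by rw [e2]; exact h0.trans (le_max_left _ _)), e2]
    simp only [e1]

/-- A chain with one layer per coordinate is affordable because the depth budget is of order
`log(1/ε) + d`; the width per block stays linear in the number of coordinates. The index in `Bool`
runs two maxima in parallel. -/
lemma Computes.maxSteps {V ι : Type} [Fintype V] [DecidableEq V] [Fintype ι] [DecidableEq ι]
    {m L w Q : ℕ} {κ : ℝ} {G : (V × (Bool × (ι ⊕ Bool)) → ℝ) → Fin m → ℝ}
    (hG : Computes G L w Q κ) (hκ : 1 ≤ κ)
    (hI : Fintype.card V * (2 * (Fintype.card ι + 2)) ≤ w)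
    (hQ : Fintype.card V * ((2 * (Fintype.card ι + 2)) * (2 * (Fintype.card ι + 2)) +
      2 * (Fintype.card ι + 2)) ≤ Q) (l : List ι) :
    Computes (fun x => G (l.foldl (fun x j => maxStep j x) x)) (L + l.length) w Q κ := by
  induction l with
  | nil => simpa using hG
  | cons j l ih =>
    let W : Matrix (Bool × (ι ⊕ Bool)) (Bool × (ι ⊕ Bool)) ℝ := fun r c =>
      if r.1 = c.1 then
        match r.2, c.2 with
        | .inl i, .inl i' => if i = i' then 1 else 0
        | .inl _, .inr _ => 0
        | .inr false, .inl _ => 0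
        | .inr false, .inr _ => 1
        | .inr true, .inl i => if i = j then 1 else 0
        | .inr true, .inr _ => -1
      else 0
    have key := ih.blockLayer (fun _ => W) (fun _ _ => 0) (maxStep j) ?_ (by linarith) ?_
      (by intro v i; simp; linarith) (by simpa using hI) (by simpa using hI) (by simpa using hQ)
    · simpa [add_assoc] using key
    · rintro x v ⟨σ, i | _ | _⟩ <;> cases σ <;>
        simp [maxStep, W, Fintype.sum_prod_type, add_comm, sub_eq_add_neg, add_assoc]
    · rintro v ⟨σ, i⟩ ⟨σ', i'⟩
      simp only [W]
      split_ifs with hσ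
      · rcases i with i | _ | _ <;> rcases i' with i' | _ <;> dsimp only <;> (try split_ifs) <;>
          simp <;> linarith
      · simp; linarith

/-! ### Spreading a large dilation over several layers with bounded weights -/

/-- Entrywise multiplication by `c`, followed by the activation. -/
def scaleStep {k : Type} (c : ℝ) (x : k → ℝ) (q : k) : ℝ := max (c * x q) 0

lemma scaleStep_iterate {k : Type} {c : ℝ} (hc : 0 ≤ c) (r : ℕ) {x : k → ℝ} (hx : ∀ q, 0 ≤ x q) :
    (scaleStep c)^[r] x = fun q => c ^ r * x q := by
  induction r with
  | zero => simp
  | succ r ih =>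
    rw [Function.iterate_succ_apply', ih]
    ext q
    rw [scaleStep, max_eq_left (by have := hx q; positivity)]
    ring

lemma Computes.scaleSteps {V I : Type} [Fintype V] [DecidableEq V] [Fintype I] [DecidableEq I]
    {m L w Q : ℕ} {κ : ℝ} {G : (V × I → ℝ) → Fin m → ℝ} (hG : Computes G L w Q κ) {c : ℝ}
    (hc : |c| ≤ κ) (hI : Fintype.card V * Fintype.card I ≤ w)
    (hQ : Fintype.card V * (Fintype.card I * Fintype.card I + Fintype.card I) ≤ Q) (r : ℕ) :
    Computes (fun x => G ((scaleStep c)^[r] x)) (L + r) w Q κ := by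
  have hκ : 0 ≤ κ := (abs_nonneg c).trans hc
  induction r with
  | zero => simpa using hG
  | succ r ih =>
    refine ih.blockLayer (fun _ i j => if i = j then c else 0) (fun _ _ => 0) (scaleStep c) ?_ hκ ?_
      (by simp [hκ]) hI hI hQ
    · intro x v i
      simp [scaleStep]
    · intro v i j
      split_ifs
      · exact hc
      · simpa using hκ

end ScoreApprox
end

/-! ### Networks computing combinations of tent functions -/

noncomputable section
namespace ScoreApprox

/-- The nodal function of the Freudenthal triangulation: the tent of height one at the origin. -/
def hat {ι : Type} [Fintype ι] (y : ι → ℝ) : ℝ := max (1 - posMax y - posMax (-y)) 0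

/-- The sign `±1` attached to a Boolean. -/
def boolSign (σ : Bool) : ℝ := if σ then 1 else -1

lemma abs_boolSign (σ : Bool) : |boolSign σ| = 1 := by cases σ <;> simp [boolSign]

/-- The two signs supply the two maxima in `hat`. Only positive parts pass through the activations,
which is harmless: `posMax` does not see an inner positive part, and a nonnegative dilation commutes
with it. -/
lemma sum_posMax_eq {ι : Type} [Fintype ι] {s : ℝ} (hs : 0 ≤ s) (y : ι → ℝ) :
    (1 : ℝ) + -∑ σ : Bool, posMax (fun i => s * max (boolSign σ * y i) 0) =
      1 - posMax (fun i => s * y i) - posMax (-fun i => s * y i) := by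
  have h : ∀ σ, posMax (fun i => s * max (boolSign σ * y i) 0) =
      posMax (fun i => boolSign σ * (s * y i)) := fun σ => by
    rw [← posMax_max_zero fun i => boolSign σ * (s * y i)]
    congr 1
    ext i
    rw [mul_max_of_nonneg _ _ hs, mul_zero]
    ring_nf
  simp only [h]
  simp only [Fintype.sum_bool, boolSign]
  have h1 : (fun i => -1 * (s * y i)) = -fun i => s * y i := by ext i; simp
  simp only [if_true, Bool.false_eq_true, if_false, one_mul, h1]
  ring

/-- The positive and negative parts of `lat v i - c i * (p i - q i)`, followed by zeros. -/
def latticeStep {V ι : Type} (c : ι → ℝ) (lat : V → ι → ℝ) (x : V × (ι × Bool) → ℝ) :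
    V × (Bool × (ι ⊕ Bool)) → ℝ
  | (v, σ, .inl i) => max (boolSign σ * (lat v i - c i * (x (v, i, true) - x (v, i, false)))) 0
  | (_, _, .inr _) => 0

lemma latticeStep_nonneg {V ι : Type} (c : ι → ℝ) (lat : V → ι → ℝ) (x : V × (ι × Bool) → ℝ)
    (q : V × (Bool × (ι ⊕ Bool))) : 0 ≤ latticeStep c lat x q := by
  rcases q with ⟨v, σ, i | i⟩ <;> simp [latticeStep]

/-- A linear combination of tents, over a family of lattice points, of the coordinates of a
one-layer preprocessing of the input is computed by a network. The dilation `s ^ r` is spread over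
`r` layers. -/
theorem exists_tent_network {V ι : Type} [Fintype V] [DecidableEq V] [Fintype ι] [DecidableEq ι]
    {n₀ m w Q : ℕ} {κ s : ℝ} (hκ : 1 ≤ κ) (e : ι → Fin n₀) (ω b : ι × Bool → ℝ) (c : ι → ℝ)
    (lat : V → ι → ℝ) (r : ℕ) (a : V → Fin m → ℝ) (hω : ∀ q, |ω q| ≤ κ) (hb : ∀ q, |b q| ≤ κ)
    (hc : ∀ i, |c i| ≤ κ) (hlat : ∀ v i, |lat v i| ≤ κ) (hs : 0 ≤ s) (hsκ : s ≤ κ)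
    (ha : ∀ v k, |a v k| ≤ κ)
    (hw : Fintype.card V * (2 * (Fintype.card ι + 2)) + n₀ + m ≤ w)
    (hQ : Fintype.card V * ((2 * (Fintype.card ι + 2)) * (2 * (Fintype.card ι + 2) + n₀ + 1) + m)
      ≤ Q) :
    ∃ N : ReLUNet n₀ m, N.depth = r + Fintype.card ι + 4 ∧ N.width ≤ w ∧
      N.nnz ≤ (r + Fintype.card ι + 4) * Q ∧ N.WeightsLE κ ∧
      ∀ x, N.eval x = fun k => ∑ v, a v k * hat fun i => s ^ r * (lat v i - c i *
        (max (ω (i, true) * x (e i) + b (i, true)) 0 -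
          max (ω (i, false) * x (e i) + b (i, false)) 0)) := by
  have hκ0 : 0 ≤ κ := by linarith
  set p := Fintype.card ι with hp
  have hQ' : ∀ z, z ≤ 2 * (p + 2) * (2 * (p + 2) + n₀ + 1) + m → Fintype.card V * z ≤ Q :=
    fun z hz => (Nat.mul_le_mul_left _ hz).trans hQ
  have hw' : ∀ z, z ≤ 2 * (p + 2) → Fintype.card V * z ≤ w := fun z hz => by
    have := Nat.mul_le_mul_left (Fintype.card V) hz
    omega
  have hqn : 2 * (p + 2) * (2 * (p + 2) + n₀ + 1) =
      2 * (p + 2) * (2 * (p + 2)) + 2 * (p + 2) * n₀ + 2 * (p + 2) := by ring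
  -- The layers are stacked from the output towards the input: linear readout, tent, running maxima,
  -- dilation, differences with the lattice points, and finally the one-layer preprocessing shared
  -- by all blocks.
  have h1 : Computes (fun y : V × Unit → ℝ => (Matrix.of fun (k : Fin m) (q : V × Unit) => a q.1 k) *ᵥ y)
      1 w Q κ := by
    refine Computes.linear (Matrix.of fun (k : Fin m) (q : V × Unit) => a q.1 k) hκ0 (fun _ _ => ha _ _)
      ?_ (by omega) ?_
    · rw [Fintype.card_prod, Fintype.card_unit]; exact hw' _ (by omega)
    · rw [Fintype.card_prod, Fintype.card_unit, mul_one, mul_comm]; exact hQ' _ (by omega)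
  have h2 := h1.blockLayer (I := Bool × (ι ⊕ Bool))
    (fun _ _ q => match q.2 with | .inl _ => 0 | .inr _ => -1) (fun _ _ => 1)
    (fun x q => max (1 + -∑ σ, (x (q.1, σ, .inr false) + x (q.1, σ, .inr true))) 0)
    (by
      intro x v i'
      congr 1
      simp only [Fintype.sum_prod_type, Fintype.sum_sum_type, Fintype.sum_bool]
      simp
      ring) hκ0
    (by rintro v i ⟨σ, j | j⟩ <;> simp <;> linarith) (by intro v i; simpa using hκ)
    (by simp only [Fintype.card_prod, Fintype.card_sum, Fintype.card_bool, ← hp]; exact hw' _ le_rfl)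
    (by simp only [Fintype.card_unit]; exact hw' _ (by omega))
    (by
      simp only [Fintype.card_prod, Fintype.card_sum, Fintype.card_bool, ← hp, Fintype.card_unit]
      exact hQ' _ (by nlinarith))
  have h3 := h2.maxSteps hκ (by rw [← hp]; exact hw' _ le_rfl)
    (by rw [← hp]; exact hQ' _ (by omega)) (Finset.univ : Finset ι).toList
  have h4 := h3.scaleSteps (c := s) (by rwa [abs_of_nonneg hs])
    (by simp only [Fintype.card_prod, Fintype.card_sum, Fintype.card_bool, ← hp]; exact hw' _ le_rfl)
    (by simp only [Fintype.card_prod, Fintype.card_sum, Fintype.card_bool, ← hp]; exact hQ' _ (by omega)) r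
  have h5 := h4.blockLayer (I := ι × Bool)
    (fun v q q' => match q.2 with
      | .inl i => if i = q'.1 then boolSign q.1 * -(boolSign q'.2 * c i) else 0
      | .inr _ => 0)
    (fun v q => match q.2 with | .inl i => boolSign q.1 * lat v i | .inr _ => 0)
    (latticeStep c lat)
    (by
      rintro x v ⟨σ, i | i⟩
      · simp only [latticeStep]
        congr 1
        rw [Fintype.sum_prod_type, Finset.sum_eq_single i]
        · cases σ <;> simp [boolSign] <;> ring
        · intro j _ hj; simp [hj.symm]
        · simp
      · simp [latticeStep]) hκ0
    (by
      rintro v ⟨σ, i | i⟩ j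
      · dsimp only
        split_ifs
        · rw [abs_mul, abs_neg, abs_mul, abs_boolSign, abs_boolSign]; simpa using hc i
        · simpa using hκ0
      · simpa using hκ0)
    (by
      rintro v ⟨σ, i | i⟩
      · dsimp only
        rw [abs_mul, abs_boolSign]; simpa using hlat v i
      · simpa using hκ0)
    (by simp only [Fintype.card_prod, Fintype.card_bool, ← hp]; exact hw' _ (by omega))
    (by simp only [Fintype.card_prod, Fintype.card_sum, Fintype.card_bool, ← hp]; exact hw' _ le_rfl)
    (by simp only [Fintype.card_prod, Fintype.card_sum, Fintype.card_bool, ← hp]; exact hQ' _ (by nlinarith))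
  have h6 := h5.layer (l := Fin n₀)
    (Matrix.of fun q j => if j = e q.2.1 then ω q.2 else 0)
    (fun q => b q.2)
    (by
      intro i j
      rw [Matrix.of_apply]
      split_ifs
      · exact hω _
      · simpa using hκ0) (fun _ => hb _)
    (by simp only [Fintype.card_prod, Fintype.card_bool, ← hp]; exact hw' _ (by omega))
    (by simp only [Fintype.card_fin]; omega)
    (by
      refine (Nat.add_le_add_right (Finset.card_filter_le _ _) _).trans ?_
      simp only [Finset.card_univ, Fintype.card_prod, Fintype.card_bool, ← hp, Fintype.card_fin]
      rw [mul_assoc, ← mul_add]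
      exact hQ' _ (by nlinarith [Nat.zero_le (p * n₀)]))
  obtain ⟨N, hN, hd, hNw, hnnz, hWN⟩ := h6 n₀ (Equiv.refl _)
  rw [Finset.length_toList, Finset.card_univ] at hd hnnz
  have hdep : 1 + 1 + Fintype.card ι + r + 1 + 1 = r + Fintype.card ι + 4 := by ring
  rw [hdep] at hd hnnz
  refine ⟨N, hd, hNw, hnnz, hWN, fun x => ?_⟩
  have hx := hN x
  simp only [Equiv.refl_symm, Equiv.coe_refl, Function.comp_id] at hx
  rw [hx]
  ext k
  simp only [Matrix.mulVec, dotProduct]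
  rw [Fintype.sum_prod_type]
  refine Finset.sum_congr rfl fun v _ => ?_
  simp only [Finset.univ_unique, Finset.sum_singleton]
  congr 1
  rw [hat]
  congr 1
  rw [← sum_posMax_eq (pow_nonneg hs r)]
  congr 2
  refine Finset.sum_congr rfl fun σ _ => ?_
  rw [scaleStep_iterate hs r (latticeStep_nonneg c lat _), foldl_maxStep]
  · simp only [latticeStep, mul_zero, add_zero]
    rw [foldl_max_univ]
    simp [Matrix.mulVec, dotProduct]
  · exact fun i => mul_nonneg (pow_nonneg hs r) (latticeStep_nonneg c lat _ _)
  · simp [latticeStep]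

end ScoreApprox
end

noncomputable section
namespace ScoreApprox

/-! ### Interpolation on the Freudenthal triangulation -/

/-- Write `⌊u⌋ = u - fract u`. By periodicity `fract` has mean `1/2` over every unit interval, which
cancels the mean of `θ`. -/
lemma integral_floor_add (y : ℝ) : ∫ θ in (0 : ℝ)..1, (⌊y + θ⌋ : ℝ) = y := by
  have hm : IntervalIntegrable (fun θ : ℝ => Int.fract (y + θ)) volume 0 1 := by
    rw [intervalIntegrable_iff_integrableOn_Ioc_of_le zero_le_one]
    refine Integrable.of_bound
      (measurable_fract.comp (measurable_const_add y)).aestronglyMeasurable 1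
      (.of_forall fun θ => ?_)
    rw [Real.norm_eq_abs, abs_of_nonneg (Int.fract_nonneg _)]
    exact (Int.fract_lt_one _).le
  have h1 : ∫ θ in (0 : ℝ)..1, Int.fract (y + θ) = 1 / 2 := by
    have h := (Int.fract_periodic ℝ).intervalIntegral_add_eq y 0
    rw [intervalIntegral.integral_comp_add_left (fun u => Int.fract u) y, add_zero, h, zero_add]
    have : ∫ u in (0 : ℝ)..1, Int.fract u = ∫ u in (0 : ℝ)..1, u := by
      refine intervalIntegral.integral_congr_ae ?_
      have : ∀ᵐ u : ℝ, u ≠ 1 := by simp [ae_iff, measure_singleton]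
      filter_upwards [this] with u hu hmem
      rw [Set.uIoc_of_le zero_le_one] at hmem
      exact Int.fract_eq_self.2 ⟨hmem.1.le, lt_of_le_of_ne hmem.2 hu⟩
    rw [this]; norm_num
  have h2 : (fun θ : ℝ => (⌊y + θ⌋ : ℝ)) = fun θ => (y + θ) - Int.fract (y + θ) := by
    ext θ; rw [Int.self_sub_fract]
  rw [h2, intervalIntegral.integral_sub (Continuous.intervalIntegrable (by fun_prop) _ _) hm, h1,
    intervalIntegral.integral_add (by simp) (Continuous.intervalIntegrable (by fun_prop) _ _)]
  norm_num

lemma intervalIntegrable_floor_add (y : ℝ) :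
    IntervalIntegrable (fun θ : ℝ => (⌊y + θ⌋ : ℝ)) volume 0 1 := by
  have : Monotone fun θ : ℝ => (⌊y + θ⌋ : ℝ) := fun a b h => by
    have : ⌊y + a⌋ ≤ ⌊y + b⌋ := Int.floor_le_floor (by linarith)
    exact Int.cast_le.2 this
  exact this.intervalIntegrable

lemma intervalIntegrable_abs_floor_sub (x y : ℝ) :
    IntervalIntegrable (fun θ : ℝ => |(⌊x + θ⌋ : ℝ) - ⌊y + θ⌋|) volume 0 1 :=
  ((intervalIntegrable_floor_add x).sub (intervalIntegrable_floor_add y)).abs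

/-- Since the floor is monotone, the difference has the same sign for all `θ`, so the absolute value
comes out of the integral. This exact identity is why interpolation does not increase `ℓ¹` Lipschitz
constants. -/
lemma integral_abs_floor_sub (x y : ℝ) :
    ∫ θ in (0 : ℝ)..1, |(⌊x + θ⌋ : ℝ) - ⌊y + θ⌋| = |x - y| := by
  wlog h : y ≤ x generalizing x y
  · rw [abs_sub_comm x y, ← this y x (le_of_not_ge h)]
    simp only [abs_sub_comm]
  · have : (fun θ : ℝ => |(⌊x + θ⌋ : ℝ) - ⌊y + θ⌋|) = fun θ => (⌊x + θ⌋ : ℝ) - ⌊y + θ⌋ := by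
      ext θ
      refine abs_of_nonneg (sub_nonneg.2 ?_)
      have : ⌊y + θ⌋ ≤ ⌊x + θ⌋ := Int.floor_le_floor (by linarith)
      exact_mod_cast this
    rw [this, intervalIntegral.integral_sub (intervalIntegrable_floor_add x)
      (intervalIntegrable_floor_add y), integral_floor_add, integral_floor_add,
      abs_of_nonneg (sub_nonneg.2 h)]

variable {ι F : Type} [NormedAddCommGroup F]

lemma intervalIntegrable_comp_floor [Fintype ι] {a : (ι → ℤ) → F} {C : ℝ} (ha : ∀ v, ‖a v‖ ≤ C)
    (x : ι → ℝ) : IntervalIntegrable (fun θ : ℝ => a fun i => ⌊x i + θ⌋) volume 0 1 := by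
  rw [intervalIntegrable_iff_integrableOn_Ioc_of_le zero_le_one]
  refine Integrable.of_bound ?_ C (.of_forall fun θ => ha _)
  have h1 : StronglyMeasurable a := StronglyMeasurable.of_discrete
  have h2 : Measurable fun θ : ℝ => fun i => ⌊x i + θ⌋ := by fun_prop
  exact (h1.comp_measurable h2).aestronglyMeasurable

variable [NormedSpace ℝ F]

/-- The piecewise linear interpolant of `a` on the Freudenthal triangulation. -/
def interp (a : (ι → ℤ) → F) (x : ι → ℝ) : F := ∫ θ in (0 : ℝ)..1, a fun i => ⌊x i + θ⌋

lemma norm_interp_le {a : (ι → ℤ) → F} {C : ℝ} (ha : ∀ v, ‖a v‖ ≤ C) (x : ι → ℝ) :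
    ‖interp a x‖ ≤ C := by
  have := intervalIntegral.norm_integral_le_of_norm_le_const (a := (0 : ℝ)) (b := 1) (C := C)
    (f := fun θ : ℝ => a fun i => ⌊x i + θ⌋) fun θ _ => ha _
  simpa [interp] using this

lemma norm_interp_sub_interp_le [Fintype ι] {a : (ι → ℤ) → F} {C η : ℝ} (ha : ∀ v, ‖a v‖ ≤ C)
    (hL : ∀ v w, ‖a v - a w‖ ≤ η * ∑ i, |(v i : ℝ) - w i|) (x y : ι → ℝ) :
    ‖interp a x - interp a y‖ ≤ η * ∑ i, |x i - y i| := by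
  unfold interp
  rw [← intervalIntegral.integral_sub (intervalIntegrable_comp_floor ha x)
    (intervalIntegrable_comp_floor ha y)]
  have hi : IntervalIntegrable
      (fun θ : ℝ => η * ∑ i, |(⌊x i + θ⌋ : ℝ) - ⌊y i + θ⌋|) volume 0 1 := by
    refine IntervalIntegrable.const_mul ?_ _
    have := IntervalIntegrable.sum Finset.univ (f := fun i θ => |(⌊x i + θ⌋ : ℝ) - ⌊y i + θ⌋|)
      fun i _ => intervalIntegrable_abs_floor_sub (x i) (y i)
    refine this.congr fun θ _ => ?_
    simp
  refine (intervalIntegral.norm_integral_le_of_norm_le zero_le_one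
    (.of_forall fun θ _ => hL _ _) hi).trans (le_of_eq ?_)
  rw [intervalIntegral.integral_const_mul, intervalIntegral.integral_finsetSum
    fun i _ => intervalIntegrable_abs_floor_sub (x i) (y i)]
  simp only [integral_abs_floor_sub]

/-- For `θ ∈ (0,1]` each `⌊x i + θ⌋` is within `1` of `x i`, so only nodes in the unit neighbourhood
of `x` enter the average. -/
lemma norm_interp_sub_le [CompleteSpace F] [Fintype ι] {a : (ι → ℤ) → F} {C η : ℝ}
    (ha : ∀ v, ‖a v‖ ≤ C)
    {x : ι → ℝ} {g : F} (h : ∀ v : ι → ℤ, (∀ i, |(v i : ℝ) - x i| ≤ 1) → ‖a v - g‖ ≤ η) :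
    ‖interp a x - g‖ ≤ η := by
  have hg : g = ∫ θ in (0 : ℝ)..1, g := by simp
  unfold interp
  rw [hg, ← intervalIntegral.integral_sub (intervalIntegrable_comp_floor ha x) (by simp)]
  have := intervalIntegral.norm_integral_le_of_norm_le_const (a := (0 : ℝ)) (b := 1) (C := η)
    (f := fun θ : ℝ => a (fun i => ⌊x i + θ⌋) - g) fun θ hθ => h _ fun i => ?_
  · simpa using this
  · rw [Set.uIoc_of_le zero_le_one] at hθ
    have h1 := Int.floor_le (x i + θ)
    have h2 := Int.lt_floor_add_one (x i + θ)
    rw [abs_le]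
    constructor <;> linarith [hθ.1, hθ.2]

lemma measurableSet_floor_eq [Fintype ι] (x : ι → ℝ) (v : ι → ℤ) :
    MeasurableSet {θ : ℝ | ∀ i, ⌊x i + θ⌋ = v i} := by
  have h : Measurable fun θ : ℝ => fun i => ⌊x i + θ⌋ := by fun_prop
  have : {θ : ℝ | ∀ i, ⌊x i + θ⌋ = v i} = (fun θ : ℝ => fun i => ⌊x i + θ⌋) ⁻¹' {v} := by
    ext θ; simp [funext_iff]
  rw [this]
  exact h (measurableSet_singleton _)

/-- The conditions `v i ≤ x i + θ < v i + 1` together with `0 ≤ θ < 1` cut out a half-open interval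
whose endpoints are `posMax (v - x)` and `1 - posMax (x - v)`. Its length is the tent, the outer
positive part covering the empty case. This identifies the averaging and the nodal descriptions of
the interpolant. -/
lemma setIntegral_indicator_floor_eq [Fintype ι] [CompleteSpace F] (x : ι → ℝ) (v : ι → ℤ)
    (g : F) :
    ∫ θ in Set.Ico (0 : ℝ) 1,
      Set.indicator {θ : ℝ | ∀ i, ⌊x i + θ⌋ = v i} (fun _ => g) θ =
      hat (fun i => (v i : ℝ) - x i) • g := by
  rw [integral_indicator (measurableSet_floor_eq x v),
    Measure.restrict_restrict (measurableSet_floor_eq x v)]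
  have : {θ : ℝ | ∀ i, ⌊x i + θ⌋ = v i} ∩ Set.Ico 0 1 =
      Set.Ico (posMax fun i => (v i : ℝ) - x i) (1 - posMax (-fun i => (v i : ℝ) - x i)) := by
    ext θ
    rw [Set.mem_inter_iff, Set.mem_Ico, Set.mem_Ico, posMax_le_iff, lt_sub_comm, posMax_lt_iff]
    simp only [Set.mem_ofPred_eq, Int.floor_eq_iff, Pi.neg_apply]
    constructor
    · rintro ⟨h, h0, h1⟩
      exact ⟨⟨h0, fun i => by linarith [(h i).1]⟩, by linarith, fun i => by linarith [(h i).2]⟩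
    · rintro ⟨⟨h0, h⟩, h1, h'⟩
      exact ⟨fun i => ⟨by linarith [h i], by linarith [h' i]⟩, h0, by linarith⟩
  rw [this, setIntegral_const, Real.volume_real_Ico, hat, sub_right_comm]

lemma sum_hat_smul_eq_interp [CompleteSpace F] [Fintype ι] [DecidableEq ι] (a : (ι → ℤ) → F)
    (R : ι → ℕ) {x : ι → ℝ} (h0 : ∀ i, 0 ≤ x i) (hR : ∀ i, x i ≤ R i) :
    ∑ v : ∀ i, Fin (R i + 1), hat (fun i => ((v i : ℕ) : ℝ) - x i) • a (fun i => ((v i : ℕ) : ℤ)) =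
      interp a x := by
  -- Integrating over `[0,1)` instead of `(0,1]` excludes `θ = 1`, where `⌊x i + θ⌋` can be `R i +
  -- 1` and leave the finite box of nodes.
  rw [interp, intervalIntegral.integral_of_le zero_le_one, ← integral_Ico_eq_integral_Ioc]
  have hpt : Set.EqOn (fun θ => a fun i => ⌊x i + θ⌋) (fun θ => ∑ v : ∀ i, Fin (R i + 1),
      Set.indicator {θ : ℝ | ∀ i, ⌊x i + θ⌋ = ((v i : ℕ) : ℤ)}
        (fun _ => a fun i => ((v i : ℕ) : ℤ)) θ) (Set.Ico 0 1) := by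
    intro θ hθ
    have hnn : ∀ i, 0 ≤ ⌊x i + θ⌋ := fun i => Int.floor_nonneg.2 (add_nonneg (h0 i) hθ.1)
    have hlt : ∀ i, ⌊x i + θ⌋.toNat < R i + 1 := fun i => by
      have h1 : ⌊x i + θ⌋ < (R i : ℤ) + 1 := Int.floor_lt.2 (by
        push_cast
        linarith [hR i, hθ.2])
      have := hnn i
      omega
    have hfl : ∀ i, ((⌊x i + θ⌋.toNat : ℕ) : ℤ) = ⌊x i + θ⌋ := fun i => Int.toNat_of_nonneg (hnn i)
    dsimp only
    rw [Finset.sum_eq_single fun i => ⟨⌊x i + θ⌋.toNat, hlt i⟩]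
    · rw [Set.indicator_of_mem]
      · simp only [hfl]
      · simp only [Set.mem_ofPred_eq, hfl, implies_true]
    · intro v _ hv
      refine Set.indicator_of_notMem (fun hmem => hv ?_) _
      ext i
      have := hmem i
      simp only [this]
      simp
    · simp
  rw [setIntegral_congr_fun measurableSet_Ico hpt, integral_finsetSum]
  · refine Finset.sum_congr rfl fun v _ => ?_
    rw [setIntegral_indicator_floor_eq]
    simp
  · intro v _
    exact (integrable_const _).indicator (measurableSet_floor_eq x _)

end ScoreApprox
end

noncomputable section
namespace ScoreApprox

/-! ### The score as a posterior mean -/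

lemma noiseVar_pos {t : ℝ} (ht : 0 < t) : 0 < noiseVar t := by
  have : Real.exp (-t) < 1 := by simpa using ht
  unfold noiseVar; linarith

lemma noiseVar_le_one (t : ℝ) : noiseVar t ≤ 1 := by
  have := Real.exp_pos (-t)
  unfold noiseVar; linarith

lemma noiseVar_mono {s t : ℝ} (h : s ≤ t) : noiseVar s ≤ noiseVar t := by
  have : Real.exp (-t) ≤ Real.exp (-s) := by simpa using h
  unfold noiseVar; linarith

lemma alpha_pos (t : ℝ) : 0 < alpha t := Real.exp_pos _

lemma alpha_le_one {t : ℝ} (ht : 0 ≤ t) : alpha t ≤ 1 := by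
  unfold alpha
  exact Real.exp_le_one_iff.2 (by linarith)

variable {n : ℕ}

/-- The transition density without its normalizing constant. -/
def kern (t : ℝ) (x x₀ : E n) : ℝ := Real.exp (-‖x - alpha t • x₀‖ ^ 2 / (2 * noiseVar t))

/-- The density of `P_t` without the normalizing constant of the transition density. -/
def mass (P : Measure (E n)) (t : ℝ) (x : E n) : ℝ := ∫ x₀, kern t x x₀ ∂P

/-- The unnormalized posterior mean. -/
def moment (P : Measure (E n)) (t : ℝ) (x : E n) : E n := ∫ x₀, kern t x x₀ • x₀ ∂P

/-- `α(t)` times the posterior mean of `x₀` given `x_t = x`. -/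
def posterior (P : Measure (E n)) (t : ℝ) (x : E n) : E n :=
  (alpha t / mass P t x) • moment P t x

lemma kern_pos (t : ℝ) (x x₀ : E n) : 0 < kern t x x₀ := Real.exp_pos _

lemma kern_le_one {t : ℝ} (ht : 0 < t) (x x₀ : E n) : kern t x x₀ ≤ 1 := by
  have := noiseVar_pos ht
  refine Real.exp_le_one_iff.2 ?_
  rw [neg_div]
  exact neg_nonpos.2 (by positivity)

lemma norm_kern_le_one {t : ℝ} (ht : 0 < t) (x x₀ : E n) : ‖kern t x x₀‖ ≤ 1 := by
  rw [Real.norm_eq_abs, abs_of_pos (kern_pos _ _ _)]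
  exact kern_le_one ht x x₀

lemma continuous_kern (t : ℝ) (x : E n) : Continuous fun x₀ => kern t x x₀ := by
  unfold kern; fun_prop

lemma integrable_kern (P : Measure (E n)) [IsProbabilityMeasure P] {t : ℝ} (ht : 0 < t) (x : E n) :
    Integrable (fun x₀ => kern t x x₀) P :=
  Integrable.of_bound (continuous_kern t x).aestronglyMeasurable 1
    (.of_forall fun x₀ => norm_kern_le_one ht x x₀)

lemma integrable_kern_smul {P : Measure (E n)} (hP : Integrable (fun x₀ => x₀) P) {t : ℝ}
    (ht : 0 < t) (x : E n) : Integrable (fun x₀ => kern t x x₀ • x₀) P := by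
  refine hP.mono ((continuous_kern t x).smul continuous_id).aestronglyMeasurable
    (.of_forall fun x₀ => ?_)
  rw [norm_smul]
  exact mul_le_of_le_one_left (norm_nonneg _) (norm_kern_le_one ht x x₀)

lemma mass_pos (P : Measure (E n)) [IsProbabilityMeasure P] {t : ℝ} (ht : 0 < t) (x : E n) :
    0 < mass P t x :=
  integral_exp_pos (integrable_kern P ht x)

lemma marginalDensity_eq (P : Measure (E n)) (t : ℝ) (x : E n) :
    marginalDensity P t x = (2 * Real.pi * noiseVar t) ^ (-(n : ℝ) / 2) * mass P t x := by
  simp only [marginalDensity, transDensity, mass, kern, integral_const_mul]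

lemma norm_sub_alpha_smul_le {t : ℝ} (ht : 0 ≤ t) (x x₀ : E n) :
    ‖x - alpha t • x₀‖ ≤ ‖x‖ + ‖x₀‖ := by
  refine (norm_sub_le _ _).trans ?_
  rw [norm_smul, Real.norm_eq_abs, abs_of_pos (alpha_pos t)]
  have := mul_le_of_le_one_left (norm_nonneg x₀) (alpha_le_one ht)
  linarith

lemma hasFDerivAt_kern (t : ℝ) (x x₀ : E n) :
    HasFDerivAt (fun y => kern t y x₀)
      (innerSL ℝ ((-(kern t x x₀ / noiseVar t)) • (x - alpha t • x₀))) x := by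
  have h1 : HasFDerivAt (fun y : E n => y - alpha t • x₀) (ContinuousLinearMap.id ℝ (E n)) x :=
    (hasFDerivAt_id x).sub_const _
  have h2 := ((h1.norm_sq.neg).mul_const (2 * noiseVar t)⁻¹).exp
  simp only [← div_eq_mul_inv] at h2
  refine h2.congr_fderiv ?_
  ext y
  simp only [kern, _root_.smul_apply, _root_.neg_apply,
    ContinuousLinearMap.comp_apply, innerSL_apply_apply, inner_smul_left, smul_eq_mul,
    ContinuousLinearMap.id_apply]
  simp
  ring

lemma hasFDerivAt_mass (P : Measure (E n)) [IsProbabilityMeasure P]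
    (hP : Integrable (fun x₀ => x₀) P) {t : ℝ} (ht : 0 < t) (x : E n) :
    HasFDerivAt (mass P t)
      (innerSL ℝ ((-(1 / noiseVar t)) • (mass P t x • x - alpha t • moment P t x))) x := by
  have hh := noiseVar_pos ht
  have hcont : Continuous fun x₀ => (-(kern t x x₀ / noiseVar t)) • (x - alpha t • x₀) :=
    ((continuous_kern t x).div_const _).neg.smul (by fun_prop)
  have hbound : ∀ y ∈ Metric.ball x 1, ∀ x₀ : E n,
      ‖(-(kern t y x₀ / noiseVar t)) • (y - alpha t • x₀)‖ ≤
        1 / noiseVar t * (‖x‖ + 1 + ‖x₀‖) := by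
    intro y hy x₀
    rw [norm_smul, norm_neg, norm_div, Real.norm_of_nonneg hh.le]
    refine mul_le_mul ?_ ?_ (norm_nonneg _) (by positivity)
    · gcongr
      exact norm_kern_le_one ht y x₀
    · refine (norm_sub_alpha_smul_le ht.le y x₀).trans ?_
      have : ‖y‖ ≤ ‖x‖ + 1 := by
        rw [mem_ball_iff_norm] at hy
        linarith [norm_sub_norm_le y x]
      linarith
  have hbi : Integrable (fun x₀ : E n => 1 / noiseVar t * (‖x‖ + 1 + ‖x₀‖)) P :=
    ((integrable_const _).add hP.norm).const_mul _
  have hint : Integrable (fun x₀ => (-(kern t x x₀ / noiseVar t)) • (x - alpha t • x₀)) P :=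
    hbi.mono' hcont.aestronglyMeasurable
      (.of_forall fun x₀ => hbound x (Metric.mem_ball_self one_pos) x₀)
  have key := hasFDerivAt_integral_of_dominated_of_fderiv_le (𝕜 := ℝ) (μ := P)
    (F := fun y x₀ => kern t y x₀)
    (F' := fun y x₀ => innerSL ℝ ((-(kern t y x₀ / noiseVar t)) • (y - alpha t • x₀)))
    (x₀ := x) (s := Metric.ball x 1) (bound := fun x₀ => 1 / noiseVar t * (‖x‖ + 1 + ‖x₀‖))
    (Metric.ball_mem_nhds x one_pos)
    (.of_forall fun y => (continuous_kern t y).aestronglyMeasurable) (integrable_kern P ht x)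
    (((innerSL ℝ).continuous.comp hcont).aestronglyMeasurable)
    (.of_forall fun x₀ y hy => by
      rw [innerSL_apply_norm]
      exact hbound y hy x₀) hbi
    (.of_forall fun x₀ y _ => hasFDerivAt_kern t y x₀)
  refine key.congr_fderiv ?_
  rw [ContinuousLinearMap.integral_comp_comm (innerSL ℝ) hint]
  congr 1
  have hsplit : (fun x₀ => (-(kern t x x₀ / noiseVar t)) • (x - alpha t • x₀)) =
      fun x₀ => (-(1 / noiseVar t)) • (kern t x x₀ • x - alpha t • kern t x x₀ • x₀) := by
    ext1 x₀
    rw [smul_comm (alpha t), ← smul_sub, smul_smul]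
    congr 1
    ring
  have hi : Integrable (fun x₀ => alpha t • kern t x x₀ • x₀) P :=
    (integrable_kern_smul hP ht x).smul (alpha t)
  rw [hsplit, integral_smul, integral_sub ((integrable_kern P ht x).smul_const x) hi,
    integral_smul, integral_smul_const]
  rfl

/-- Tweedie's formula. -/
theorem score_eq (P : Measure (E n)) [IsProbabilityMeasure P]
    (hP : Integrable (fun x₀ => x₀) P) {t : ℝ} (ht : 0 < t) (x : E n) :
    score P t x = (1 / noiseVar t) • (posterior P t x - x) := by
  have hh := noiseVar_pos ht
  have hm := mass_pos P ht x
  have hc : 0 < (2 * Real.pi * noiseVar t) ^ (-(n : ℝ) / 2) := by positivity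
  have h1 := (((hasFDerivAt_mass P hP ht x).const_mul
    ((2 * Real.pi * noiseVar t) ^ (-(n : ℝ) / 2))).log (by positivity))
  have h2 : HasGradientAt (fun y => Real.log (marginalDensity P t y))
      ((1 / noiseVar t) • (posterior P t x - x)) x := by
    rw [hasGradientAt_iff_hasFDerivAt]
    simp only [marginalDensity_eq]
    refine h1.congr_fderiv ?_
    ext y
    simp only [_root_.smul_apply, innerSL_apply_apply, smul_eq_mul,
      InnerProductSpace.toDual_apply_apply, inner_smul_left, inner_sub_left, posterior]
    simp only [conj_trivial]
    field_simp
    ring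
  exact h2.gradient

/-! ### Data on a subspace -/

variable {d D : ℕ}

lemma inner_toEuclideanLin (A : Matrix (Fin D) (Fin d) ℝ) (x : E D) (z : E d) :
    inner ℝ x (toEuclideanLin A z) = inner ℝ (toEuclideanLin Aᵀ x) z := by
  have h := toEuclideanLin_conjTranspose_eq_adjoint A
  rw [conjTranspose_eq_transpose_of_trivial] at h
  rw [h, LinearMap.adjoint_inner_left]

lemma toEuclideanLin_transpose_apply {A : Matrix (Fin D) (Fin d) ℝ} (hA : Aᵀ * A = 1) (z : E d) :
    toEuclideanLin Aᵀ (toEuclideanLin A z) = z := by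
  ext i
  simp [toEuclideanLin, toLpLin_apply, hA]

lemma norm_toEuclideanLin {A : Matrix (Fin D) (Fin d) ℝ} (hA : Aᵀ * A = 1) (z : E d) :
    ‖toEuclideanLin A z‖ = ‖z‖ := by
  rw [← sq_eq_sq₀ (norm_nonneg _) (norm_nonneg _), ← real_inner_self_eq_norm_sq,
    ← real_inner_self_eq_norm_sq, inner_toEuclideanLin, toEuclideanLin_transpose_apply hA]

/-- Pythagoras: `‖x - αAz‖² = ‖Aᵀx - αz‖² + ‖x‖² - ‖Aᵀx‖²`. The prefactor does not involve `z`, so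
it cancels in the quotient defining the posterior mean. -/
lemma kern_toEuclideanLin {A : Matrix (Fin D) (Fin d) ℝ} (hA : Aᵀ * A = 1) (t : ℝ) (x : E D)
    (z : E d) :
    kern t x (toEuclideanLin A z) =
      Real.exp ((‖toEuclideanLin Aᵀ x‖ ^ 2 - ‖x‖ ^ 2) / (2 * noiseVar t)) *
        kern t (toEuclideanLin Aᵀ x) z := by
  rw [kern, kern, ← Real.exp_add]
  congr 1
  rw [norm_sub_sq_real, norm_sub_sq_real, norm_smul, norm_smul, norm_toEuclideanLin hA,
    inner_smul_right, inner_smul_right, inner_toEuclideanLin]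
  ring

lemma measurable_toEuclideanLin (A : Matrix (Fin D) (Fin d) ℝ) :
    Measurable (toEuclideanLin A) :=
  (LinearMap.continuous_of_finiteDimensional _).measurable

lemma posterior_map {A : Matrix (Fin D) (Fin d) ℝ} (hA : Aᵀ * A = 1) (P : Measure (E d)) (t : ℝ)
    (x : E D) :
    posterior (P.map (toEuclideanLin A)) t x =
      toEuclideanLin A (posterior P t (toEuclideanLin Aᵀ x)) := by
  have hm := (measurable_toEuclideanLin A).aemeasurable (μ := P)
  set c := Real.exp ((‖toEuclideanLin Aᵀ x‖ ^ 2 - ‖x‖ ^ 2) / (2 * noiseVar t)) with hc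
  have hc0 : c ≠ 0 := (Real.exp_pos _).ne'
  have h1 : mass (P.map (toEuclideanLin A)) t x = c * mass P t (toEuclideanLin Aᵀ x) := by
    rw [mass, integral_map hm (continuous_kern t x).aestronglyMeasurable]
    simp only [kern_toEuclideanLin hA, ← hc, integral_const_mul]
    rfl
  have h2 : moment (P.map (toEuclideanLin A)) t x =
      c • toEuclideanLin A (moment P t (toEuclideanLin Aᵀ x)) := by
    have hcont : Continuous fun x₀ => kern t x x₀ • x₀ := (continuous_kern t x).smul continuous_id
    rw [moment, integral_map hm hcont.aestronglyMeasurable]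
    simp only [kern_toEuclideanLin hA, ← hc, mul_smul]
    rw [integral_smul]
    congr 1
    simp only [← map_smul]
    let a : E d →ₗᵢ[ℝ] E D := ⟨toEuclideanLin A, norm_toEuclideanLin hA⟩
    exact a.integral_comp_comm fun z => kern t (toEuclideanLin Aᵀ x) z • z
  rw [posterior, posterior, h1, h2, map_smul, smul_smul]
  congr 1
  field_simp

theorem scoreNet_sub_score {A : Matrix (Fin D) (Fin d) ℝ} (hA : Aᵀ * A = 1) (P : Measure (E d))
    [IsProbabilityMeasure P] (hP : Integrable (fun z => z) P) {t : ℝ} (ht : 0 < t)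
    (f : E d → ℝ → E d) (x : E D) :
    scoreNet A f x t - score (P.map (toEuclideanLin A)) t x =
      (1 / noiseVar t) • toEuclideanLin A
        (f (toEuclideanLin Aᵀ x) t - posterior P t (toEuclideanLin Aᵀ x)) := by
  have hm := measurable_toEuclideanLin A
  have : IsProbabilityMeasure (P.map (toEuclideanLin A)) :=
    Measure.isProbabilityMeasure_map hm.aemeasurable
  have hint : Integrable (fun x => x) (P.map (toEuclideanLin A)) := by
    rw [integrable_map_measure (by fun_prop) hm.aemeasurable]
    exact ((toEuclideanLin A).toContinuousLinearMap).integrable_comp hP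
  rw [score_eq _ hint ht, posterior_map hA, scoreNet, map_sub, smul_sub, smul_sub]
  abel

end ScoreApprox
end

noncomputable section
namespace ScoreApprox

/-! ### Regularity in time -/

variable {n : ℕ}

/-- The logarithmic derivative in time of `kern`. -/
def kernRate (t : ℝ) (x a : E n) : ℝ :=
  -((alpha t * inner ℝ (x - alpha t • a) a * (2 * noiseVar t) -
    ‖x - alpha t • a‖ ^ 2 * (2 * Real.exp (-t))) / (2 * noiseVar t) ^ 2)

lemma hasDerivAt_alpha (t : ℝ) : HasDerivAt alpha (-(alpha t / 2)) t := by
  have := (((hasDerivAt_id t).neg).div_const 2).exp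
  refine this.congr_deriv ?_
  simp only [Pi.neg_apply, id_eq, alpha]
  ring

lemma hasDerivAt_noiseVar (t : ℝ) : HasDerivAt noiseVar (Real.exp (-t)) t := by
  have := ((hasDerivAt_neg t).exp).const_sub 1
  refine this.congr_deriv ?_
  ring

lemma hasDerivAt_kern {t : ℝ} (ht : 0 < t) (x a : E n) :
    HasDerivAt (fun s => kern s x a) (kern t x a * kernRate t x a) t := by
  have hh := noiseVar_pos ht
  have h1 : HasDerivAt (fun s => x - alpha s • a) (-(-(alpha t / 2) • a)) t :=
    ((hasDerivAt_alpha t).smul_const a).const_sub x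
  have h2 := ((h1.norm_sq.neg).fun_div ((hasDerivAt_noiseVar t).const_mul 2)
    (by positivity)).exp
  refine h2.congr_deriv ?_
  simp only [kern, kernRate, inner_neg_right, inner_smul_right, Pi.neg_apply]
  ring

lemma abs_kernRate_le {t₁ t : ℝ} (h₁ : 0 < t₁) (ht : t₁ ≤ t) (x a : E n) :
    |kernRate t x a| ≤ (‖x‖ + ‖a‖) ^ 2 / noiseVar t₁ ^ 2 := by
  have ht0 : 0 < t := h₁.trans_le ht
  have hh1 := noiseVar_pos h₁
  have hmono := noiseVar_mono ht
  have hle := noiseVar_le_one t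
  have hu := norm_sub_alpha_smul_le ht0.le x a
  have hα := alpha_le_one ht0.le
  have hα0 := alpha_pos t
  have he : Real.exp (-t) ≤ 1 := Real.exp_le_one_iff.2 (by linarith)
  have he0 := Real.exp_pos (-t)
  have hi := abs_real_inner_le_norm (x - alpha t • a) a
  set S := ‖x‖ + ‖a‖ with hS
  have ha : ‖a‖ ≤ S := by have := norm_nonneg x; linarith
  have hS0 : 0 ≤ S := by positivity
  have hi2 : |inner ℝ (x - alpha t • a) a| ≤ S ^ 2 := by
    refine hi.trans ?_
    rw [sq]
    exact mul_le_mul hu ha (norm_nonneg _) hS0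
  have hu2 : ‖x - alpha t • a‖ ^ 2 ≤ S ^ 2 := by gcongr
  have hA : |alpha t * inner ℝ (x - alpha t • a) a * (2 * noiseVar t)| ≤ 2 * S ^ 2 := by
    rw [abs_mul, abs_mul, abs_of_pos hα0, abs_of_pos (by linarith : 0 < 2 * noiseVar t)]
    have h1 : alpha t * |inner ℝ (x - alpha t • a) a| ≤ 1 * S ^ 2 :=
      mul_le_mul hα hi2 (abs_nonneg _) zero_le_one
    have h2 := mul_le_mul h1 (by linarith : 2 * noiseVar t ≤ 2) (by linarith) (by positivity)
    linarith
  have hB : |‖x - alpha t • a‖ ^ 2 * (2 * Real.exp (-t))| ≤ 2 * S ^ 2 := by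
    rw [abs_of_nonneg (by positivity)]
    have h2 := mul_le_mul hu2 (by linarith : 2 * Real.exp (-t) ≤ 2) (by positivity) (by positivity)
    linarith
  rw [kernRate, abs_neg, abs_div, abs_of_nonneg (by positivity : 0 ≤ (2 * noiseVar t) ^ 2)]
  calc _ ≤ (4 * S ^ 2) / (2 * noiseVar t₁) ^ 2 := by
        refine div_le_div₀ (by positivity) ((abs_sub _ _).trans (by linarith)) (by positivity) ?_
        gcongr
    _ = _ := by rw [mul_pow]; norm_num; field_simp

lemma continuous_kernRate (t : ℝ) (x : E n) : Continuous fun a => kernRate t x a := by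
  unfold kernRate; fun_prop

/-- Differentiation in time under the integral sign, against a weight `w`. -/
lemma hasDerivAt_integral_kern_smul {F : Type} [NormedAddCommGroup F] [NormedSpace ℝ F]
    (P : Measure (E n)) {w : E n → F} (hw : Continuous w) (x : E n)
    (hint : Integrable w P) (hint2 : Integrable (fun a => (‖x‖ + ‖a‖) ^ 2 * ‖w a‖) P)
    {t : ℝ} (ht : 0 < t) :
    HasDerivAt (fun s => ∫ a, kern s x a • w a ∂P)
      (∫ a, (kern t x a * kernRate t x a) • w a ∂P) t ∧
    ‖∫ a, (kern t x a * kernRate t x a) • w a ∂P‖ ≤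
      (∫ a, (‖x‖ + ‖a‖) ^ 2 * ‖w a‖ ∂P) / noiseVar t ^ 2 := by
  have hbound : ∀ t₁ s : ℝ, 0 < t₁ → t₁ ≤ s → ∀ a, ‖(kern s x a * kernRate s x a) • w a‖ ≤
      ((‖x‖ + ‖a‖) ^ 2 * ‖w a‖) / noiseVar t₁ ^ 2 := by
    intro t₁ s h₁ hs a
    rw [norm_smul, norm_mul]
    have h1 := norm_kern_le_one (h₁.trans_le hs) x a
    have h2 := abs_kernRate_le h₁ hs x a
    calc _ ≤ 1 * ((‖x‖ + ‖a‖) ^ 2 / noiseVar t₁ ^ 2) * ‖w a‖ := by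
          gcongr
          exact h2
      _ = _ := by ring
  constructor
  -- The domination is taken on `s > t/2`, where `h(s)` is bounded below by `h(t/2)`.
  · refine (hasDerivAt_integral_of_dominated_loc_of_deriv_le (𝕜 := ℝ) (μ := P)
      (F := fun s a => kern s x a • w a) (F' := fun s a => (kern s x a * kernRate s x a) • w a)
      (s := Set.Ioi (t / 2)) (bound := fun a => ((‖x‖ + ‖a‖) ^ 2 * ‖w a‖) / noiseVar (t / 2) ^ 2)
      (Ioi_mem_nhds (by linarith))
      (.of_forall fun s => ((continuous_kern s x).smul hw).aestronglyMeasurable) ?_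
      (((continuous_kern t x).mul (continuous_kernRate t x)).smul hw).aestronglyMeasurable
      (.of_forall fun a s hs => hbound (t / 2) s (by linarith) (le_of_lt hs) a)
      (hint2.div_const _) (.of_forall fun a s hs => ?_)).2
    · refine hint.mono ((continuous_kern t x).smul hw).aestronglyMeasurable (.of_forall fun a => ?_)
      rw [norm_smul]
      exact mul_le_of_le_one_left (norm_nonneg _) (norm_kern_le_one ht x a)
    · have hs0 : (0 : ℝ) < s := lt_trans (by linarith : 0 < t / 2) hs
      exact (hasDerivAt_kern hs0 x a).smul_const (w a)
  · rw [← integral_div]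
    exact norm_integral_le_of_norm_le (hint2.div_const _) (.of_forall fun a => hbound t t ht le_rfl a)

lemma integrable_add_norm_sq_mul {P : Measure (E n)} [IsProbabilityMeasure P]
    (hP : ∀ k : ℕ, Integrable (fun a => ‖a‖ ^ k) P) (R : ℝ) (j : ℕ) :
    Integrable (fun a : E n => (R + ‖a‖) ^ 2 * ‖a‖ ^ j) P := by
  have h := ((hP j).const_mul (R ^ 2)).add (((hP (j + 1)).const_mul (2 * R)).add (hP (j + 2)))
  refine h.congr (.of_forall fun a => ?_)
  simp only [Pi.add_apply]
  ring

lemma integrable_id_of_moments {P : Measure (E n)}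
    (hP : ∀ k : ℕ, Integrable (fun a => ‖a‖ ^ k) P) : Integrable (fun a => a) P := by
  have := hP 1
  simp only [pow_one] at this
  exact (integrable_norm_iff (by fun_prop)).1 this

/-- The posterior mean is differentiable in time, with a derivative that is bounded on compact
sets. -/
theorem exists_norm_deriv_posterior_le {P : Measure (E n)} [IsProbabilityMeasure P]
    (hP : ∀ k : ℕ, Integrable (fun a => ‖a‖ ^ k) P) (R : ℝ) {t₀ : ℝ} (h₀ : 0 < t₀) :
    ∃ C, ∀ t, t₀ ≤ t → ∀ x : E n, ‖x‖ ≤ R →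
      DifferentiableAt ℝ (fun s => posterior P s x) t ∧ ‖deriv (fun s => posterior P s x) t‖ ≤ C := by
  have hid := integrable_id_of_moments hP
  have hh0 := noiseVar_pos h₀
  set B₁ := ∫ a, ‖a‖ ∂P with hB₁
  set B₂ := (∫ a, (R + ‖a‖) ^ 2 * ‖a‖ ^ 0 ∂P) / noiseVar t₀ ^ 2 with hB₂
  set B₃ := (∫ a, (R + ‖a‖) ^ 2 * ‖a‖ ^ 1 ∂P) / noiseVar t₀ ^ 2 with hB₃
  -- A positive lower bound for `mass P t x`, uniform over `t ≥ t₀` and `‖x‖ ≤ R`; it controls the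
  -- denominators in the derivative of the quotient.
  set z₀ := ∫ a, Real.exp (-(R + ‖a‖) ^ 2 / (2 * noiseVar t₀)) ∂P with hz₀
  have hzi : Integrable (fun a : E n => Real.exp (-(R + ‖a‖) ^ 2 / (2 * noiseVar t₀))) P := by
    refine Integrable.of_bound (by fun_prop) 1 (.of_forall fun a => ?_)
    rw [Real.norm_eq_abs, abs_of_pos (Real.exp_pos _), Real.exp_le_one_iff, neg_div]
    exact neg_nonpos.2 (by positivity)
  have hz0 : 0 < z₀ := integral_exp_pos hzi
  have hB₁0 : 0 ≤ B₁ := by positivity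
  have hB₂0 : 0 ≤ B₂ := by positivity
  have hB₃0 : 0 ≤ B₃ := by positivity
  refine ⟨(1 + B₂) / z₀ ^ 2 * B₁ + 1 / z₀ * B₃, fun t ht x hx => ?_⟩
  have ht0 : 0 < t := h₀.trans_le ht
  have hht := noiseVar_mono ht
  have hRnn : 0 ≤ R := (norm_nonneg x).trans hx
  have hcomp : ∀ j : ℕ, (∫ a, (‖x‖ + ‖a‖) ^ 2 * ‖a‖ ^ j ∂P) / noiseVar t ^ 2 ≤
      (∫ a, (R + ‖a‖) ^ 2 * ‖a‖ ^ j ∂P) / noiseVar t₀ ^ 2 := by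
    intro j
    have : ∫ a, (‖x‖ + ‖a‖) ^ 2 * ‖a‖ ^ j ∂P ≤ ∫ a, (R + ‖a‖) ^ 2 * ‖a‖ ^ j ∂P := by
      refine integral_mono (integrable_add_norm_sq_mul hP _ j) (integrable_add_norm_sq_mul hP _ j)
        fun a => ?_
      dsimp only
      gcongr
    gcongr
  obtain ⟨hd1, hn1⟩ := hasDerivAt_integral_kern_smul P (w := fun _ => (1 : ℝ)) continuous_const x
    (integrable_const _) (by simpa using integrable_add_norm_sq_mul hP ‖x‖ 0) ht0
  obtain ⟨hd2, hn2⟩ := hasDerivAt_integral_kern_smul P (w := fun a => a) continuous_id x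
    hid (by simpa using integrable_add_norm_sq_mul hP ‖x‖ 1) ht0
  simp only [smul_eq_mul, mul_one] at hd1 hn1
  set Z' := ∫ a, kern t x a * kernRate t x a ∂P
  set m' := ∫ a, (kern t x a * kernRate t x a) • a ∂P
  have hn1' : ‖Z'‖ ≤ B₂ := by
    refine hn1.trans ?_
    have := hcomp 0
    simpa [hB₂] using this
  have hn2' : ‖m'‖ ≤ B₃ := by
    refine hn2.trans ?_
    have := hcomp 1
    simpa [hB₃] using this
  have hmass := mass_pos P ht0 x
  have hmz : z₀ ≤ mass P t x := by
    refine integral_mono hzi (integrable_kern P ht0 x) fun a => ?_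
    refine Real.exp_le_exp.2 ?_
    rw [neg_div, neg_div, neg_le_neg_iff]
    have := norm_sub_alpha_smul_le ht0.le x a
    gcongr
    linarith
  have hm1 : mass P t x ≤ 1 := by
    have := integral_mono (integrable_kern P ht0 x) (integrable_const (1 : ℝ))
      (fun a => kern_le_one ht0 x a)
    simpa [mass] using this
  have hmom : ‖moment P t x‖ ≤ B₁ := by
    refine norm_integral_le_of_norm_le hid.norm (.of_forall fun a => ?_)
    rw [norm_smul]
    exact mul_le_of_le_one_left (norm_nonneg _) (norm_kern_le_one ht0 x a)
  have hd : HasDerivAt (fun s => posterior P s x)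
      ((alpha t / mass P t x) • m' +
        ((-(alpha t / 2) * mass P t x - alpha t * Z') / mass P t x ^ 2) • moment P t x) t :=
    ((hasDerivAt_alpha t).fun_div hd1 hmass.ne').fun_smul hd2
  refine ⟨hd.differentiableAt, ?_⟩
  rw [hd.deriv]
  have hα := alpha_le_one ht0.le
  have hα0 := alpha_pos t
  refine (norm_add_le _ _).trans ?_
  rw [norm_smul, norm_smul, add_comm]
  refine add_le_add ?_ ?_
  · refine mul_le_mul ?_ hmom (norm_nonneg _) (by positivity)
    rw [norm_div, norm_pow, Real.norm_of_nonneg hmass.le]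
    refine div_le_div₀ (by positivity) ?_ (by positivity) (by gcongr)
    refine (norm_sub_le _ _).trans ?_
    rw [norm_mul, norm_mul, norm_neg, Real.norm_of_nonneg (by positivity : 0 ≤ alpha t / 2),
      Real.norm_of_nonneg hα0.le, Real.norm_of_nonneg hmass.le]
    have h1 := mul_le_mul (by linarith : alpha t / 2 ≤ 1) hm1 hmass.le zero_le_one
    have h2 := mul_le_mul hα hn1' (norm_nonneg _) zero_le_one
    linarith
  · refine mul_le_mul ?_ hn2' (norm_nonneg _) (by positivity)
    rw [Real.norm_of_nonneg (by positivity)]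
    exact div_le_div₀ zero_le_one hα hz0 hmz

end ScoreApprox
end

noncomputable section
namespace ScoreApprox

/-! ### Gaussian integrals -/

variable {n d D : ℕ}

lemma integrable_exp_neg_mul_norm_sq {b : ℝ} (hb : 0 < b) :
    Integrable fun x : E n => Real.exp (-b * ‖x‖ ^ 2) := by
  refine Integrable.of_integral_ne_zero ?_
  rw [GaussianFourier.integral_rexp_neg_mul_sq_norm hb]
  positivity

lemma lintegral_exp_neg_mul_norm_sub_sq {b : ℝ} (hb : 0 < b) (c : E n) :
    ∫⁻ x : E n, ENNReal.ofReal (Real.exp (-b * ‖x - c‖ ^ 2)) =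
      ENNReal.ofReal ((Real.pi / b) ^ ((n : ℝ) / 2)) := by
  rw [lintegral_sub_right_eq_self (fun x : E n => ENNReal.ofReal (Real.exp (-b * ‖x‖ ^ 2))) c,
    ← ofReal_integral_eq_lintegral_ofReal (integrable_exp_neg_mul_norm_sq hb)
      (.of_forall fun x => (Real.exp_pos _).le), GaussianFourier.integral_rexp_neg_mul_sq_norm hb]
  simp

lemma continuous_transDensity (t : ℝ) :
    Continuous fun q : E n × E n => transDensity t q.1 q.2 := by
  unfold transDensity; fun_prop

lemma transDensity_nonneg {t : ℝ} (ht : 0 < t) (x y : E n) : 0 ≤ transDensity t x y := by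
  have := noiseVar_pos ht
  unfold transDensity; positivity

/-- The moment generating function of the transition kernel. -/
lemma lintegral_exp_inner_mul_transDensity {t : ℝ} (ht : 0 < t) (v y : E n) :
    ∫⁻ x : E n, ENNReal.ofReal (Real.exp (inner ℝ x v) * transDensity t x y) =
      ENNReal.ofReal (Real.exp (alpha t * inner ℝ y v + noiseVar t * ‖v‖ ^ 2 / 2)) := by
  have hh := noiseVar_pos ht
  set h := noiseVar t with hh'
  set K := (2 * Real.pi * h) ^ (-(n : ℝ) / 2) *
    Real.exp (alpha t * inner ℝ y v + h * ‖v‖ ^ 2 / 2) with hK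
  have hK0 : 0 ≤ K := by positivity
  have hpt : ∀ x : E n, Real.exp (inner ℝ x v) * transDensity t x y =
      K * Real.exp (-(1 / (2 * h)) * ‖x - (alpha t • y + h • v)‖ ^ 2) := by
    intro x
    rw [transDensity, hK, mul_left_comm, mul_assoc ((2 * Real.pi * h) ^ (-(n : ℝ) / 2)),
      ← Real.exp_add, ← Real.exp_add, ← hh']
    congr 2
    rw [← sub_sub, norm_sub_sq_real (x - alpha t • y) (h • v), inner_sub_left, inner_smul_right,
      inner_smul_right, norm_smul, Real.norm_of_nonneg hh.le, inner_smul_left]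
    simp only [conj_trivial]
    field_simp
    ring
  simp only [hpt, ENNReal.ofReal_mul hK0]
  rw [lintegral_const_mul' _ _ ENNReal.ofReal_ne_top,
    lintegral_exp_neg_mul_norm_sub_sq (by positivity), ← ENNReal.ofReal_mul hK0]
  congr 1
  have : Real.pi / (1 / (2 * h)) = 2 * Real.pi * h := by field_simp
  rw [this, hK, mul_right_comm, ← Real.rpow_add (by positivity)]
  simp [neg_div]

lemma lintegral_transDensity {t : ℝ} (ht : 0 < t) (y : E n) :
    ∫⁻ x : E n, ENNReal.ofReal (transDensity t x y) = 1 := by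
  have := lintegral_exp_inner_mul_transDensity ht (0 : E n) y
  simpa using this

lemma lintegral_marginalLaw (P : Measure (E n)) [IsProbabilityMeasure P]
    {t : ℝ} (ht : 0 < t) {G : E n → ENNReal} (hG : Measurable G) :
    ∫⁻ x, G x ∂(marginalLaw P t) =
      ∫⁻ y, (∫⁻ x, G x * ENNReal.ofReal (transDensity t x y)) ∂P := by
  have hden : ∀ x : E n, ENNReal.ofReal (marginalDensity P t x) =
      ∫⁻ y, ENNReal.ofReal (transDensity t x y) ∂P := by
    intro x
    refine ofReal_integral_eq_lintegral_ofReal ?_ (.of_forall fun y => transDensity_nonneg ht x y)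
    exact (integrable_kern P ht x).const_mul _
  have hm2 : Measurable fun q : E n × E n => ENNReal.ofReal (transDensity t q.1 q.2) :=
    (continuous_transDensity t).measurable.ennreal_ofReal
  have hm : Measurable fun x : E n => ENNReal.ofReal (marginalDensity P t x) := by
    simp only [hden]
    exact hm2.lintegral_prod_right'
  rw [marginalLaw, lintegral_withDensity_eq_lintegral_mul _ hm hG]
  simp only [Pi.mul_apply, hden]
  rw [lintegral_lintegral_swap]
  · refine lintegral_congr fun x => ?_
    have hc : Continuous fun y => transDensity t x y := by unfold transDensity; fun_prop
    have hx : Measurable fun y => ENNReal.ofReal (transDensity t x y) := hc.measurable.ennreal_ofReal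
    rw [mul_comm, lintegral_const_mul _ hx]
  · exact ((hG.comp measurable_snd).mul (hm2.comp measurable_swap)).aemeasurable

lemma marginalLaw_univ (P : Measure (E n)) [IsProbabilityMeasure P] {t : ℝ} (ht : 0 < t) :
    marginalLaw P t Set.univ = 1 := by
  have := lintegral_marginalLaw P ht (G := fun _ => 1) measurable_const
  simpa [lintegral_transDensity ht] using this

/-- Completing the square writes the exponential of a quadratic as a Gaussian mixture of
exponentials of linear forms. It reduces square-exponential moments of `Aᵀ x` to the moment
generating function at `A (2√l u)`, whose norm is `2√l ‖u‖`; hence the bounds do not depend on `D`.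
-/
lemma ofReal_exp_mul_norm_sq {l : ℝ} (hl : 0 ≤ l) (w : E d) :
    ENNReal.ofReal (Real.exp (l * ‖w‖ ^ 2)) = ∫⁻ u : E d, ENNReal.ofReal
      (Real.pi ^ (-(d : ℝ) / 2) * Real.exp (-‖u‖ ^ 2 + inner ℝ w ((2 * √l) • u))) := by
  have hpt : ∀ u : E d,
      Real.pi ^ (-(d : ℝ) / 2) * Real.exp (-‖u‖ ^ 2 + inner ℝ w ((2 * √l) • u)) =
      Real.pi ^ (-(d : ℝ) / 2) * Real.exp (l * ‖w‖ ^ 2) *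
        Real.exp (-1 * ‖u - √l • w‖ ^ 2) := by
    intro u
    rw [mul_assoc, ← Real.exp_add]
    congr 2
    rw [norm_sub_sq_real, norm_smul, Real.norm_of_nonneg (Real.sqrt_nonneg l), mul_pow,
      Real.sq_sqrt hl, inner_smul_right, inner_smul_right, real_inner_comm]
    ring
  simp only [hpt, ENNReal.ofReal_mul
    (by positivity : 0 ≤ Real.pi ^ (-(d : ℝ) / 2) * Real.exp (l * ‖w‖ ^ 2))]
  rw [lintegral_const_mul' _ _ ENNReal.ofReal_ne_top, lintegral_exp_neg_mul_norm_sub_sq one_pos,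
    ← ENNReal.ofReal_mul (by positivity)]
  congr 1
  rw [div_one, mul_right_comm, ← Real.rpow_add Real.pi_pos]
  simp [neg_div]

lemma rpow_half_le_exp (d : ℕ) : (2 : ℝ) ^ ((d : ℝ) / 2) ≤ Real.exp d := by
  rw [Real.rpow_def_of_pos two_pos, Real.exp_le_exp]
  have : Real.log 2 ≤ 1 := by linarith [Real.log_two_lt_d9]
  have hd : (0 : ℝ) ≤ d := Nat.cast_nonneg d
  nlinarith

/-- After linearising and exchanging the integrals, the noise term costs at most `‖u‖²/4` because `l
≤ 1/8`, and Young's inequality on the cross term costs another `‖u‖²/4` besides `4l‖z‖²`. Half of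
the Gaussian weight in `u` remains, and its integral contributes `2^{d/2} ≤ e^d`. -/
lemma lintegral_exp_mul_transDensity_le {A : Matrix (Fin D) (Fin d) ℝ} (hA : Aᵀ * A = 1) {l t : ℝ}
    (hl : 0 ≤ l) (hl8 : l ≤ 1 / 8) (ht : 0 < t) (z : E d) :
    ∫⁻ x : E D, ENNReal.ofReal (Real.exp (l * ‖toEuclideanLin Aᵀ x‖ ^ 2)) *
        ENNReal.ofReal (transDensity t x (toEuclideanLin A z)) ≤
      ENNReal.ofReal (Real.exp (d + 4 * l * ‖z‖ ^ 2)) := by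
  set c := Real.pi ^ (-(d : ℝ) / 2) with hc
  have hc0 : 0 ≤ c := by positivity
  have hAm := (LinearMap.continuous_of_finiteDimensional (toEuclideanLin A))
  have hATm := (LinearMap.continuous_of_finiteDimensional (toEuclideanLin Aᵀ))
  calc _ = ∫⁻ x : E D, ∫⁻ u : E d, ENNReal.ofReal (c * Real.exp (-‖u‖ ^ 2 +
          inner ℝ (toEuclideanLin Aᵀ x) ((2 * √l) • u))) *
          ENNReal.ofReal (transDensity t x (toEuclideanLin A z)) := by
        refine lintegral_congr fun x => ?_
        rw [ofReal_exp_mul_norm_sq hl, lintegral_mul_const' _ _ ENNReal.ofReal_ne_top]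
    _ = ∫⁻ u : E d, ∫⁻ x : E D, ENNReal.ofReal (c * Real.exp (-‖u‖ ^ 2 +
          inner ℝ (toEuclideanLin Aᵀ x) ((2 * √l) • u))) *
          ENNReal.ofReal (transDensity t x (toEuclideanLin A z)) := by
        refine lintegral_lintegral_swap (Measurable.aemeasurable ?_)
        refine Measurable.mul (Measurable.ennreal_ofReal ?_) (Measurable.ennreal_ofReal ?_)
        · refine Continuous.measurable ?_
          have := hATm.comp (continuous_fst (X := E D) (Y := E d))
          simp only [Function.comp_def] at this
          fun_prop
        · exact ((continuous_transDensity t).comp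
            (continuous_fst.prodMk continuous_const)).measurable
    _ = ∫⁻ u : E d, ENNReal.ofReal (c * Real.exp (-‖u‖ ^ 2)) *
          ENNReal.ofReal (Real.exp (alpha t * inner ℝ (toEuclideanLin A z)
            (toEuclideanLin A ((2 * √l) • u)) +
            noiseVar t * ‖toEuclideanLin A ((2 * √l) • u)‖ ^ 2 / 2)) := by
        refine lintegral_congr fun u => ?_
        rw [← lintegral_exp_inner_mul_transDensity ht,
          ← lintegral_const_mul' _ _ ENNReal.ofReal_ne_top]
        refine lintegral_congr fun x => ?_
        rw [← ENNReal.ofReal_mul (by positivity), ← ENNReal.ofReal_mul (by positivity),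
          inner_toEuclideanLin, Real.exp_add]
        congr 1
        ring
    _ ≤ ∫⁻ u : E d, ENNReal.ofReal (c * Real.exp (4 * l * ‖z‖ ^ 2)) *
          ENNReal.ofReal (Real.exp (-(1 / 2) * ‖u - 0‖ ^ 2)) := by
        refine lintegral_mono fun u => ?_
        rw [← ENNReal.ofReal_mul (by positivity), ← ENNReal.ofReal_mul (by positivity),
          mul_assoc, mul_assoc, ← Real.exp_add, ← Real.exp_add]
        refine ENNReal.ofReal_le_ofReal (mul_le_mul_of_nonneg_left (Real.exp_le_exp.2 ?_) hc0)
        rw [norm_toEuclideanLin hA, inner_toEuclideanLin, toEuclideanLin_transpose_apply hA,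
          norm_smul, inner_smul_right, sub_zero, Real.norm_of_nonneg (by positivity), mul_pow,
          mul_pow, Real.sq_sqrt hl]
        have hs := Real.sqrt_nonneg l
        have h1 : alpha t * (2 * √l * inner ℝ z u) ≤ 2 * √l * (‖z‖ * ‖u‖) := by
          have hi := real_inner_le_norm z u
          have h0 : alpha t * inner ℝ z u ≤ ‖z‖ * ‖u‖ := by
            refine (mul_le_mul_of_nonneg_left hi (alpha_pos t).le).trans ?_
            exact mul_le_of_le_one_left (by positivity) (alpha_le_one ht.le)
          nlinarith
        have h2 : 2 * √l * (‖z‖ * ‖u‖) ≤ 4 * l * ‖z‖ ^ 2 + ‖u‖ ^ 2 / 4 := by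
          nlinarith [sq_nonneg (2 * √l * ‖z‖ - ‖u‖ / 2), Real.sq_sqrt hl]
        have h3 : noiseVar t * (2 ^ 2 * l * ‖u‖ ^ 2) / 2 ≤ ‖u‖ ^ 2 / 4 := by
          have h4 : noiseVar t * (l * ‖u‖ ^ 2) ≤ 1 * (1 / 8 * ‖u‖ ^ 2) := by
            have := noiseVar_pos ht
            gcongr
            exact noiseVar_le_one t
          linarith
        linarith
    _ ≤ _ := by
        rw [lintegral_const_mul' _ _ ENNReal.ofReal_ne_top,
          lintegral_exp_neg_mul_norm_sub_sq (by norm_num), ← ENNReal.ofReal_mul (by positivity)]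
        refine ENNReal.ofReal_le_ofReal ?_
        have h1 : Real.pi / (1 / 2) = Real.pi * 2 := by ring
        rw [h1, Real.mul_rpow Real.pi_pos.le two_pos.le, Real.exp_add]
        have h2 : c * Real.pi ^ ((d : ℝ) / 2) = 1 := by
          rw [hc, ← Real.rpow_add Real.pi_pos]; simp [neg_div]
        calc _ = (c * Real.pi ^ ((d : ℝ) / 2)) * (2 ^ ((d : ℝ) / 2) *
              Real.exp (4 * l * ‖z‖ ^ 2)) := by ring
          _ ≤ _ := by
            rw [h2, one_mul]
            gcongr
            exact rpow_half_le_exp d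

/-- The latent component of the noised data has Gaussian tails, uniformly in the ambient
dimension. -/
theorem lintegral_exp_marginalLaw_le {A : Matrix (Fin D) (Fin d) ℝ} (hA : Aᵀ * A = 1)
    (P : Measure (E d)) [IsProbabilityMeasure P] {μ k₀ l t : ℝ}
    (hP : ∫⁻ z, ENNReal.ofReal (Real.exp (μ * ‖z‖ ^ 2)) ∂P ≤ ENNReal.ofReal (Real.exp (k₀ * d)))
    (hl : 0 ≤ l) (hl8 : l ≤ 1 / 8) (hlμ : 4 * l ≤ μ) (ht : 0 < t) :
    ∫⁻ x, ENNReal.ofReal (Real.exp (l * ‖toEuclideanLin Aᵀ x‖ ^ 2))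
        ∂(marginalLaw (P.map (toEuclideanLin A)) t) ≤
      ENNReal.ofReal (Real.exp ((k₀ + 1) * d)) := by
  have hm := measurable_toEuclideanLin A
  have : IsProbabilityMeasure (P.map (toEuclideanLin A)) :=
    Measure.isProbabilityMeasure_map hm.aemeasurable
  have hG : Measurable fun x : E D =>
      ENNReal.ofReal (Real.exp (l * ‖toEuclideanLin Aᵀ x‖ ^ 2)) := by
    have := measurable_toEuclideanLin Aᵀ
    fun_prop
  rw [lintegral_marginalLaw _ ht hG, lintegral_map _ hm]
  · calc _ ≤ ∫⁻ z, ENNReal.ofReal (Real.exp d) *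
          ENNReal.ofReal (Real.exp (μ * ‖z‖ ^ 2)) ∂P := by
          refine lintegral_mono fun z => (lintegral_exp_mul_transDensity_le hA hl hl8 ht z).trans ?_
          rw [← ENNReal.ofReal_mul (by positivity), ← Real.exp_add]
          gcongr
      _ ≤ ENNReal.ofReal (Real.exp d) * ENNReal.ofReal (Real.exp (k₀ * d)) := by
          rw [lintegral_const_mul' _ _ ENNReal.ofReal_ne_top]
          gcongr
      _ = _ := by
          rw [← ENNReal.ofReal_mul (by positivity), ← Real.exp_add]
          congr 2
          ring
  · have hm2 : Measurable fun q : E D × E D => ENNReal.ofReal (transDensity t q.1 q.2) :=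
      (continuous_transDensity t).measurable.ennreal_ofReal
    exact ((hG.comp measurable_snd).mul (hm2.comp measurable_swap)).lintegral_prod_right'

end ScoreApprox
end

noncomputable section
namespace ScoreApprox

/-! ### Exponential moments -/

variable {d : ℕ}

/-- The exponential moment of a density with a Gaussian tail. -/
lemma lintegral_exp_latentLaw_le {B C₁ C₂ : ℝ} (hC₁ : 0 < C₁) (hC₂ : 0 < C₂)
    (hd : 1 ≤ d) {p : E d → ℝ} [IsProbabilityMeasure (latentLaw p)] (hp0 : ∀ z, 0 < p z)
    (hp : Measurable p)
    (htail : ∀ z, B ≤ ‖z‖ →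
      p z ≤ (2 * Real.pi) ^ (-(d : ℝ) / 2) * C₁ * Real.exp (-C₂ * ‖z‖ ^ 2 / 2)) :
    ∫⁻ z, ENNReal.ofReal (Real.exp (C₂ / 4 * ‖z‖ ^ 2)) ∂(latentLaw p) ≤
      ENNReal.ofReal (Real.exp
        (Real.log ((Real.exp (C₂ / 4 * B ^ 2) + C₁ + 1) * (1 + 2 / C₂)) * d)) := by
  set a := Real.exp (C₂ / 4 * B ^ 2) with ha
  set q := 1 + 2 / C₂ with hq
  have ha0 : 0 < a := Real.exp_pos _
  have hq1 : 1 ≤ q := by have : 0 < 2 / C₂ := by positivity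
                         linarith
  set K := (2 * Real.pi) ^ (-(d : ℝ) / 2) * C₁ with hK
  have hK0 : 0 ≤ K := by positivity
  have hpt : ∀ z : E d, ENNReal.ofReal (p z) * ENNReal.ofReal (Real.exp (C₂ / 4 * ‖z‖ ^ 2)) ≤
      ENNReal.ofReal a * ENNReal.ofReal (p z) +
        ENNReal.ofReal K * ENNReal.ofReal (Real.exp (-(C₂ / 4) * ‖z - 0‖ ^ 2)) := by
    intro z
    have h0 := (hp0 z).le
    rw [← ENNReal.ofReal_mul h0, ← ENNReal.ofReal_mul ha0.le, ← ENNReal.ofReal_mul hK0,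
      ← ENNReal.ofReal_add (by positivity) (by positivity), sub_zero]
    refine ENNReal.ofReal_le_ofReal ?_
    rcases le_total B ‖z‖ with h | h
    · have h1 := mul_le_mul_of_nonneg_right (htail z h) (Real.exp_pos (C₂ / 4 * ‖z‖ ^ 2)).le
      rw [mul_assoc, ← Real.exp_add] at h1
      have h2 : -C₂ * ‖z‖ ^ 2 / 2 + C₂ / 4 * ‖z‖ ^ 2 = -(C₂ / 4) * ‖z‖ ^ 2 := by ring
      rw [h2] at h1
      have : 0 ≤ a * p z := by positivity
      linarith
    · have h1 : Real.exp (C₂ / 4 * ‖z‖ ^ 2) ≤ a := by rw [ha]; gcongr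
      have h2 := mul_le_mul_of_nonneg_left h1 h0
      have h3 : 0 ≤ K * Real.exp (-(C₂ / 4) * ‖z‖ ^ 2) := by positivity
      linarith
  have htot : ∫⁻ z, ENNReal.ofReal (p z) = 1 := by
    have := measure_univ (μ := latentLaw p)
    rwa [latentLaw, withDensity_apply _ MeasurableSet.univ, Measure.restrict_univ] at this
  rw [latentLaw, lintegral_withDensity_eq_lintegral_mul _ hp.ennreal_ofReal (by fun_prop)]
  refine (lintegral_mono hpt).trans ?_
  rw [lintegral_add_left (by fun_prop), lintegral_const_mul' _ _ ENNReal.ofReal_ne_top,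
    lintegral_const_mul' _ _ ENNReal.ofReal_ne_top, htot, mul_one,
    lintegral_exp_neg_mul_norm_sub_sq (by positivity), ← ENNReal.ofReal_mul hK0,
    ← ENNReal.ofReal_add ha0.le (by positivity)]
  refine ENNReal.ofReal_le_ofReal ?_
  have hbase : 0 < (a + C₁ + 1) * q := by positivity
  rw [mul_comm (Real.log _), ← Real.log_pow, Real.exp_log (by positivity), mul_pow]
  have hgauss : K * (Real.pi / (C₂ / 4)) ^ ((d : ℝ) / 2) ≤ C₁ * q ^ d := by
    have h1 : Real.pi / (C₂ / 4) = 2 * Real.pi * (2 / C₂) := by field_simp; norm_num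
    rw [hK, h1, Real.mul_rpow (x := 2 * Real.pi) (y := 2 / C₂) (by positivity) (by positivity),
      mul_assoc, mul_left_comm,
      ← mul_assoc ((2 * Real.pi) ^ (-(d : ℝ) / 2)), ← Real.rpow_add (by positivity)]
    have h2 : (2 / C₂) ^ ((d : ℝ) / 2) ≤ q ^ d := by
      rw [← Real.rpow_natCast]
      calc _ ≤ q ^ ((d : ℝ) / 2) := by
            refine Real.rpow_le_rpow (by positivity) ?_ (by positivity)
            linarith
        _ ≤ _ := Real.rpow_le_rpow_of_exponent_le hq1 (by
            have : (0 : ℝ) ≤ d := Nat.cast_nonneg d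
            linarith)
    have h3 : -(d : ℝ) / 2 + d / 2 = 0 := by ring
    rw [h3, Real.rpow_zero, one_mul]
    gcongr
  have hqd : 1 ≤ q ^ d := one_le_pow₀ hq1
  -- As `d ≥ 1`, the additive constant may be raised to the power `d`, which brings the bound to the
  -- form `e^{k₀ d}`.
  have hsum : a + C₁ + 1 ≤ (a + C₁ + 1) ^ d := le_self_pow₀ (by linarith) (by omega)
  calc _ ≤ (a + C₁ + 1) * q ^ d := by nlinarith
    _ ≤ _ := by gcongr

variable {P : Measure (E d)} {μ k₀ : ℝ}

lemma integrable_exp_of_lintegral_le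
    (hP : ∫⁻ z, ENNReal.ofReal (Real.exp (μ * ‖z‖ ^ 2)) ∂P ≤ ENNReal.ofReal (Real.exp (k₀ * d))) :
    Integrable (fun z => Real.exp (μ * ‖z‖ ^ 2)) P ∧
      ∫ z, Real.exp (μ * ‖z‖ ^ 2) ∂P ≤ Real.exp (k₀ * d) := by
  have hint : Integrable (fun z => Real.exp (μ * ‖z‖ ^ 2)) P := by
    refine ⟨by fun_prop, ?_⟩
    rw [hasFiniteIntegral_iff_ofReal (.of_forall fun z => (Real.exp_pos _).le)]
    exact hP.trans_lt ENNReal.ofReal_lt_top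
  refine ⟨hint, ?_⟩
  rw [← ofReal_integral_eq_lintegral_ofReal hint (.of_forall fun z => (Real.exp_pos _).le)] at hP
  exact (ENNReal.ofReal_le_ofReal_iff (Real.exp_pos _).le).1 hP

lemma integrable_norm_pow_of_exp [IsFiniteMeasure P] (hμ : 0 < μ)
    (hint : Integrable (fun z => Real.exp (μ * ‖z‖ ^ 2)) P) (k : ℕ) :
    Integrable (fun z => ‖z‖ ^ k) P := by
  refine Integrable.mono' ((integrable_const (1 : ℝ)).add
    (hint.const_mul ((k.factorial : ℝ) / μ ^ k))) (by fun_prop) (.of_forall fun z => ?_)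
  have h1 := Real.pow_div_factorial_le_exp (μ * ‖z‖ ^ 2) (by positivity) k
  have h2 : ‖z‖ ^ k ≤ 1 + (‖z‖ ^ 2) ^ k := by
    rw [← pow_mul, mul_comm, pow_mul]
    nlinarith [sq_nonneg (‖z‖ ^ k - 1)]
  have h3 : (‖z‖ ^ 2) ^ k ≤ k.factorial / μ ^ k * Real.exp (μ * ‖z‖ ^ 2) := by
    rw [mul_pow, div_le_iff₀ (by positivity)] at h1
    rw [div_mul_eq_mul_div, le_div_iff₀ (by positivity)]
    linarith
  simp only [norm_pow, norm_norm, Pi.add_apply]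
  linarith

/-- The posterior mean grows at most linearly, with constants that depend only on the exponential
moment of the prior. -/
theorem norm_posterior_le [IsProbabilityMeasure P] (hd : 1 ≤ d) (hμ : 0 < μ) (hk₀ : 0 ≤ k₀)
    (hP : ∫⁻ z, ENNReal.ofReal (Real.exp (μ * ‖z‖ ^ 2)) ∂P ≤ ENNReal.ofReal (Real.exp (k₀ * d)))
    {t : ℝ} (ht : 0 < t) (x : E d) :
    ‖posterior P t x‖ ≤ 2 * ‖x‖ + (3 * √((k₀ + 1) / μ) + 1 / √μ) * √d := by
  obtain ⟨hint, hle⟩ := integrable_exp_of_lintegral_le hP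
  have hid := integrable_id_of_moments (integrable_norm_pow_of_exp hμ hint)
  have hh := noiseVar_pos ht
  have hm0 : 0 < √μ := Real.sqrt_pos.2 hμ
  have hd1 : (1 : ℝ) ≤ d := by exact_mod_cast hd
  -- Chosen so that `e^{-μρ²}` times the exponential moment is at most `e^{-d} ≤ 1/2`: in effect, at
  -- least half of the prior mass lies in the ball of radius `ρ`.
  set ρ := √((k₀ + 1) / μ) * √d with hρ
  have hρ0 : 0 ≤ ρ := by positivity
  have hρ2 : μ * ρ ^ 2 = (k₀ + 1) * d := by
    rw [hρ, mul_pow, Real.sq_sqrt (by positivity), Real.sq_sqrt (by positivity)]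
    field_simp
  -- the weight whose integral is at most one half
  set e : E d → ℝ := fun a => Real.exp (μ * ‖a‖ ^ 2 - μ * ρ ^ 2) with he
  have hee : ∀ a, e a = Real.exp (-((k₀ + 1) * d)) * Real.exp (μ * ‖a‖ ^ 2) := fun a => by
    rw [he, ← Real.exp_add, hρ2]; ring_nf
  have hei : Integrable e P := by
    have := hint.const_mul (Real.exp (-((k₀ + 1) * d)))
    exact this.congr (.of_forall fun a => (hee a).symm)
  have hehalf : ∫ a, e a ∂P ≤ 1 / 2 := by
    simp only [hee, integral_const_mul]
    calc _ ≤ Real.exp (-((k₀ + 1) * d)) * Real.exp (k₀ * d) := by gcongr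
      _ = Real.exp (-d) := by rw [← Real.exp_add]; ring_nf
      _ ≤ Real.exp (-1) := Real.exp_le_exp.2 (by linarith)
      _ ≤ 1 / 2 := by linarith [Real.exp_neg_one_lt_d9]
  -- The same number `w` bounds the kernel from below when `‖a‖ ≤ ρ` and from above when `α(t)‖a‖ ≥
  -- 2‖x‖ + ρ`. Comparing far points with the ball through `w` cancels all dependence on `h(t)`, so
  -- the bound is uniform as `t → 0`.
  set w := Real.exp (-(‖x‖ + ρ) ^ 2 / (2 * noiseVar t)) with hw
  have hw0 : 0 < w := Real.exp_pos _
  have hmass : w / 2 ≤ mass P t x := by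
    -- Markov's inequality in pointwise form: outside the ball `e a ≥ 1` and the left side is
    -- nonpositive.
    have h1 : ∀ a, w * (1 - e a) ≤ kern t x a := by
      intro a
      rcases le_total ‖a‖ ρ with h | h
      · have hk : w ≤ kern t x a := by
          refine Real.exp_le_exp.2 ?_
          rw [neg_div, neg_div, neg_le_neg_iff]
          have := norm_sub_alpha_smul_le ht.le x a
          gcongr
          linarith
        have : 0 ≤ w * e a := mul_nonneg hw0.le (Real.exp_pos _).le
        linarith
      · have : 1 ≤ e a := by
          refine Real.one_le_exp ?_
          have : μ * ρ ^ 2 ≤ μ * ‖a‖ ^ 2 := by gcongr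
          linarith
        have h2 : w * (1 - e a) ≤ 0 := mul_nonpos_of_nonneg_of_nonpos hw0.le (by linarith)
        exact h2.trans (kern_pos _ _ _).le
    have h2 := integral_mono (((integrable_const (1 : ℝ)).sub hei).const_mul w)
      (integrable_kern P ht x) h1
    simp only [Pi.sub_apply] at h2
    rw [integral_const_mul, integral_sub (integrable_const _) hei] at h2
    simp only [integral_const, probReal_univ, smul_eq_mul, mul_one] at h2
    refine le_trans ?_ h2
    nlinarith
  have hnorm : ∫ a, ‖a‖ ∂P ≤ ρ + 1 / √μ * (1 / 2) := by
    have h1 : ∀ a : E d, ‖a‖ ≤ ρ + 1 / √μ * e a := by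
      intro a
      rcases le_total ‖a‖ ρ with h | h
      · have : 0 ≤ 1 / √μ * e a := mul_nonneg (by positivity) (Real.exp_pos _).le
        linarith
      · have h3 : √μ * (‖a‖ - ρ) ≤ e a := by
          have h4 := Real.add_one_le_exp (μ * ‖a‖ ^ 2 - μ * ρ ^ 2)
          have h5 : (√μ * (‖a‖ - ρ)) ^ 2 ≤ μ * ‖a‖ ^ 2 - μ * ρ ^ 2 := by
            rw [mul_pow, Real.sq_sqrt hμ.le, ← mul_sub]
            gcongr
            nlinarith
          have h6 : √μ * (‖a‖ - ρ) ≤ (√μ * (‖a‖ - ρ)) ^ 2 + 1 := by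
            nlinarith [sq_nonneg (√μ * (‖a‖ - ρ) - 1), sq_nonneg (√μ * (‖a‖ - ρ))]
          exact (h6.trans (by linarith)).trans h4
        have h7 : ‖a‖ - ρ ≤ 1 / √μ * e a := by
          rw [div_mul_eq_mul_div, one_mul, le_div_iff₀ hm0]
          linarith
        linarith
    have h2 := integral_mono hid.norm ((integrable_const ρ).add (hei.const_mul (1 / √μ))) h1
    simp only [Pi.add_apply] at h2
    rw [integral_add (integrable_const _) (hei.const_mul _),
      integral_const_mul (1 / √μ)] at h2
    simp only [integral_const, probReal_univ, smul_eq_mul, one_mul] at h2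
    refine h2.trans ?_
    gcongr
  have hmom : alpha t * ‖moment P t x‖ ≤ (2 * ‖x‖ + ρ) * mass P t x + w * ∫ a, ‖a‖ ∂P := by
    have hα := alpha_pos t
    have h1 : ∀ a, alpha t * ‖kern t x a • a‖ ≤ (2 * ‖x‖ + ρ) * kern t x a + w * ‖a‖ := by
      intro a
      have hk := kern_pos t x a
      rw [norm_smul, Real.norm_of_nonneg hk.le]
      rcases le_total (alpha t * ‖a‖) (2 * ‖x‖ + ρ) with h | h
      · have h2 := mul_le_mul_of_nonneg_right h hk.le
        have : 0 ≤ w * ‖a‖ := by positivity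
        linarith
      · have hkw : kern t x a ≤ w := by
          refine Real.exp_le_exp.2 ?_
          rw [neg_div, neg_div, neg_le_neg_iff]
          have h3 := norm_sub_norm_le (alpha t • a) x
          rw [norm_smul, Real.norm_of_nonneg hα.le, norm_sub_rev] at h3
          gcongr
          linarith
        have h4 : alpha t * (kern t x a * ‖a‖) ≤ 1 * (w * ‖a‖) := by
          gcongr
          exact alpha_le_one ht.le
        have : 0 ≤ (2 * ‖x‖ + ρ) * kern t x a := by positivity
        linarith
    have hks := integrable_kern_smul hid ht x
    calc _ ≤ alpha t * ∫ a, ‖kern t x a • a‖ ∂P := by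
          gcongr
          exact norm_integral_le_integral_norm _
      _ = ∫ a, alpha t * ‖kern t x a • a‖ ∂P := (integral_const_mul _ _).symm
      _ ≤ ∫ a, ((2 * ‖x‖ + ρ) * kern t x a + w * ‖a‖) ∂P :=
          integral_mono (hks.norm.const_mul _)
            (((integrable_kern P ht x).const_mul _).add (hid.norm.const_mul _)) h1
      _ = _ := by
          rw [integral_add ((integrable_kern P ht x).const_mul _) (hid.norm.const_mul _),
            integral_const_mul, integral_const_mul]
          rfl
  have hmp := mass_pos P ht x
  rw [posterior, norm_smul, norm_div, Real.norm_of_nonneg (alpha_pos t).le,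
    Real.norm_of_nonneg hmp.le, div_mul_eq_mul_div, div_le_iff₀ hmp]
  have hI0 : 0 ≤ ∫ a, ‖a‖ ∂P := by positivity
  have h8 : w * ∫ a, ‖a‖ ∂P ≤ 2 * mass P t x * (ρ + 1 / √μ * (1 / 2)) := by
    refine mul_le_mul (by linarith) hnorm hI0 (by positivity)
  have hsd : (1 : ℝ) ≤ √d := Real.one_le_sqrt.2 hd1
  have h9 : 1 / √μ ≤ 1 / √μ * √d := le_mul_of_one_le_right (by positivity) hsd
  have h10 : (3 * √((k₀ + 1) / μ) + 1 / √μ) * √d = 3 * ρ + 1 / √μ * √d := by rw [hρ]; ring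
  rw [h10]
  have h11 : 2 * mass P t x * (ρ + 1 / √μ * (1 / 2)) + (2 * ‖x‖ + ρ) * mass P t x =
      (2 * ‖x‖ + 3 * ρ + 1 / √μ) * mass P t x := by ring
  have h12 : (2 * ‖x‖ + 3 * ρ + 1 / √μ) * mass P t x ≤
      (2 * ‖x‖ + (3 * ρ + 1 / √μ * √d)) * mass P t x := by
    exact mul_le_mul_of_nonneg_right (by linarith) hmp.le
  linarith

end ScoreApprox
end

noncomputable section
namespace ScoreApprox

/-! ### Approximation of Lipschitz functions by the network class -/

variable {d : ℕ}

/-- Truncation to `[-r, r]`. -/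
def clamp (r y : ℝ) : ℝ := max (-r) (min r y)

lemma abs_clamp_le {r : ℝ} (hr : 0 ≤ r) (y : ℝ) : |clamp r y| ≤ r :=
  abs_le.2 ⟨le_max_left _ _, max_le (by linarith) (min_le_left _ _)⟩

lemma clamp_eq_self {r y : ℝ} (h : |y| ≤ r) : clamp r y = y := by
  rw [clamp, min_eq_right (abs_le.1 h).2, max_eq_right (abs_le.1 h).1]

lemma abs_clamp_sub_clamp_le (r y z : ℝ) : |clamp r y - clamp r z| ≤ |y - z| := by
  have h1 := abs_max_sub_max_le_max (-r) (min r y) (-r) (min r z)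
  have h2 := abs_min_sub_min_le_max r y r z
  rw [clamp, clamp]
  simp only [sub_self, abs_zero] at h1 h2
  refine h1.trans (max_le (abs_nonneg _) (h2.trans (max_le (abs_nonneg _) le_rfl)))

/-- Two units per coordinate truncate the input to the cube. The network then depends on `z` only
through its truncation, so the sup and Lipschitz bounds hold on all of `ℝᵈ`. -/
lemma relu_sub_relu_eq_clamp {r : ℝ} (hr : 0 ≤ r) (y : ℝ) :
    max (y + r) 0 - max (y - r) 0 = clamp r y + r := by
  unfold clamp
  rcases le_total r y with h1 | h1 <;> rcases le_total (-r) y with h2 | h2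
  · rw [max_eq_left (by linarith), max_eq_left (by linarith), min_eq_left h1,
      max_eq_right (by linarith)]
    ring
  · rw [max_eq_right (by linarith), max_eq_left (by linarith), min_eq_left h1,
      max_eq_right (by linarith)]
    linarith
  · rw [max_eq_left (by linarith), max_eq_right (by linarith), min_eq_right h1, max_eq_right h2]
    ring
  · rw [max_eq_right (by linarith), max_eq_right (by linarith), min_eq_right h1, max_eq_left h2]
    ring

lemma norm_le_of_abs_le (z : E d) {δ : ℝ} (hδ : 0 ≤ δ) (h : ∀ i, |z i| ≤ δ) : ‖z‖ ≤ √d * δ := by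
  rw [EuclideanSpace.norm_eq]
  refine Real.sqrt_le_iff.2 ⟨by positivity, ?_⟩
  rw [mul_pow, Real.sq_sqrt (Nat.cast_nonneg d)]
  calc ∑ i, ‖z i‖ ^ 2 ≤ ∑ _i : Fin d, δ ^ 2 := by
        refine Finset.sum_le_sum fun i _ => ?_
        rw [Real.norm_eq_abs]
        gcongr
        exact h i
    _ = _ := by simp

lemma norm_le_sum_abs (z : E d) : ‖z‖ ≤ ∑ i, |z i| := by
  rw [EuclideanSpace.norm_eq]
  refine Real.sqrt_le_iff.2 ⟨by positivity, ?_⟩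
  simp only [Real.norm_eq_abs]
  exact Finset.sum_sq_le_sq_sum_of_nonneg fun i _ => abs_nonneg _

lemma sum_abs_le (z : E d) : ∑ i, |z i| ≤ √d * ‖z‖ := by
  rw [EuclideanSpace.norm_eq, ← Real.sqrt_mul (Nat.cast_nonneg d)]
  refine Real.le_sqrt_of_sq_le ?_
  have := sq_sum_le_card_mul_sum_sq (s := Finset.univ) (f := fun i => |z i|)
  simpa using this

/-- Coordinatewise truncation. -/
def clampVec (G : ℝ) (z : E d) : E d := WithLp.toLp 2 fun i => clamp G (z i)

lemma norm_clampVec_sub_le (G : ℝ) (y z : E d) : ‖clampVec G y - clampVec G z‖ ≤ ‖y - z‖ := by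
  rw [EuclideanSpace.norm_eq, EuclideanSpace.norm_eq]
  refine Real.sqrt_le_sqrt (Finset.sum_le_sum fun i _ => ?_)
  simp only [Real.norm_eq_abs, PiLp.sub_apply, clampVec]
  exact pow_le_pow_left₀ (abs_nonneg _) (abs_clamp_sub_clamp_le _ _ _) 2

lemma clampVec_eq_self {G : ℝ} {z : E d} (h : ∀ i, |z i| ≤ G) : clampVec G z = z := by
  ext i
  exact clamp_eq_self (h i)

/-- The point of the cube `[-r, r]^d` with lattice coordinates `v` on a grid of mesh `1 / c`. -/
def spaceNode (r c : ℝ) (v : Option (Fin d) → ℤ) : E d :=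
  WithLp.toLp 2 fun i => clamp r (v (some i) / c - r)

/-- The time in `[t₀, T]` with lattice coordinate `j` on a grid of mesh `1 / c`. -/
def timeNode (t₀ T c : ℝ) (j : ℤ) : ℝ := max t₀ (min T (t₀ + j / c))

lemma timeNode_mem {t₀ T : ℝ} (h : t₀ ≤ T) (c : ℝ) (j : ℤ) :
    timeNode t₀ T c j ∈ Set.Icc t₀ T :=
  ⟨le_max_left _ _, max_le h (min_le_left _ _)⟩

lemma abs_timeNode_sub_le {t₀ T t : ℝ} (ht : t ∈ Set.Icc t₀ T) (c : ℝ) (j : ℤ) :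
    |timeNode t₀ T c j - t| ≤ |j / c - (t - t₀)| := by
  have h1 := abs_max_sub_max_le_max t₀ (min T (t₀ + j / c)) t₀ (min T t)
  have h2 := abs_min_sub_min_le_max T (t₀ + j / c) T t
  rw [min_eq_right ht.2] at h1 h2
  rw [max_eq_right ht.1] at h1
  simp only [sub_self, abs_zero] at h1 h2
  have h3 : t₀ + j / c - t = j / c - (t - t₀) := by ring
  rw [h3] at h2
  exact h1.trans (max_le (abs_nonneg _) (h2.trans (max_le (abs_nonneg _) le_rfl)))

lemma abs_timeNode_sub_timeNode_le (t₀ T c : ℝ) (j k : ℤ) :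
    |timeNode t₀ T c j - timeNode t₀ T c k| ≤ |(j : ℝ) / c - k / c| := by
  have h1 := abs_max_sub_max_le_max t₀ (min T (t₀ + j / c)) t₀ (min T (t₀ + k / c))
  have h2 := abs_min_sub_min_le_max T (t₀ + j / c) T (t₀ + k / c)
  simp only [sub_self, abs_zero, add_sub_add_left_eq_sub] at h1 h2
  exact h1.trans (max_le (abs_nonneg _) (h2.trans (max_le (abs_nonneg _) le_rfl)))

/-- Nodal values of the interpolant of `g` on the lattice. -/
def nodeValue (g : E d → ℝ → E d) (G r b τ Λ t₀ T : ℝ) (v : Option (Fin d) → ℤ) : E d :=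
  clampVec G (g (spaceNode r (Λ * b) v) (timeNode t₀ T (Λ * τ) (v none)))

/-- Lattice coordinates of the point `(z, t)`. -/
def latticeCoord (r b τ Λ t₀ : ℝ) (z : E d) (t : ℝ) : Option (Fin d) → ℝ
  | some i => Λ * (b * (clamp r (z i) + r))
  | none => Λ * (τ * max (t - t₀) 0)

/-- An inequality, to include `τ = 0`: there the left side vanishes and division by zero does no
harm. -/
lemma mul_abs_div_sub_div_le {τ Λ : ℝ} (hτ : 0 ≤ τ) (hΛ : 0 < Λ) (x y : ℝ) :
    τ * |x / (Λ * τ) - y / (Λ * τ)| ≤ 1 / Λ * |x - y| := by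
  rcases hτ.eq_or_lt with rfl | hτ
  · simp; positivity
  · rw [← sub_div, abs_div, abs_of_pos (mul_pos hΛ hτ)]
    apply le_of_eq
    field_simp

section

variable {g : E d → ℝ → E d} {G r b τ Λ t₀ T : ℝ}

lemma abs_clampVec_apply_le (hG : 0 ≤ G) (z : E d) (k : Fin d) : |clampVec G z k| ≤ G :=
  abs_clamp_le hG _

lemma norm_nodeValue_le (hG : 0 ≤ G) (v : Option (Fin d) → ℤ) :
    ‖nodeValue g G r b τ Λ t₀ T v‖ ≤ √d * G :=
  norm_le_of_abs_le _ hG fun i => abs_clampVec_apply_le hG _ i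

lemma abs_spaceNode_le (hr : 0 ≤ r) (c : ℝ) (v : Option (Fin d) → ℤ) (i : Fin d) :
    |spaceNode r c v i| ≤ r :=
  abs_clamp_le hr _

/-- Each axis is scaled by its own Lipschitz constant, so that one lattice step in any direction
changes `g` by at most `1/Λ`. Nodes are truncated to the cube because the time-Lipschitz bound is
available only there. -/
lemma norm_nodeValue_sub_le (hr : 0 ≤ r) (hb : 0 < b) (hτ : 0 ≤ τ) (hΛ : 0 < Λ) (hT : t₀ ≤ T)
    (hgz : ∀ t ∈ Set.Icc t₀ T, ∀ z z', ‖g z t - g z' t‖ ≤ b * ‖z - z'‖)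
    (hgt : ∀ z : E d, (∀ i, |z i| ≤ r) → ∀ t ∈ Set.Icc t₀ T, ∀ t' ∈ Set.Icc t₀ T,
      ‖g z t - g z t'‖ ≤ τ * |t - t'|) (v w : Option (Fin d) → ℤ) :
    ‖nodeValue g G r b τ Λ t₀ T v - nodeValue g G r b τ Λ t₀ T w‖ ≤
      1 / Λ * ∑ i, |(v i : ℝ) - w i| := by
  refine (norm_clampVec_sub_le _ _ _).trans ?_
  set tv := timeNode t₀ T (Λ * τ) (v none)
  set tw := timeNode t₀ T (Λ * τ) (w none)
  set zv := spaceNode r (Λ * b) v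
  set zw := spaceNode r (Λ * b) w
  have h1 := hgz tv (timeNode_mem hT _ _) zv zw
  have h2 := hgt zw (abs_spaceNode_le hr _ _) tv (timeNode_mem hT _ _) tw (timeNode_mem hT _ _)
  have h3 : b * ‖zv - zw‖ ≤ 1 / Λ * ∑ i, |(v (some i) : ℝ) - w (some i)| := by
    calc _ ≤ b * ∑ i, |(zv - zw) i| := by gcongr; exact norm_le_sum_abs _
      _ ≤ b * ∑ i, |(v (some i) : ℝ) - w (some i)| / (Λ * b) := by
          gcongr with i
          refine (abs_clamp_sub_clamp_le _ _ _).trans ?_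
          rw [sub_sub_sub_cancel_right, ← sub_div, abs_div, abs_of_pos (mul_pos hΛ hb)]
      _ = _ := by rw [← Finset.sum_div]; field_simp
  have h4 : τ * |tv - tw| ≤ 1 / Λ * |(v none : ℝ) - w none| :=
    (mul_le_mul_of_nonneg_left (abs_timeNode_sub_timeNode_le _ _ _ _ _) hτ).trans
      (mul_abs_div_sub_div_le hτ hΛ _ _)
  rw [Fintype.sum_option, mul_add]
  have h5 := norm_sub_le_norm_sub_add_norm_sub (g zv tv) (g zw tv) (g zw tw)
  linarith

/-- A node within one lattice step of the point is off by at most `√d/Λ` through space and `1/Λ`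
through time. Truncating values at `G` does not enlarge the error, since `g z t` is itself below the
threshold. -/
lemma norm_nodeValue_sub_apply_le (hb : 0 < b) (hτ : 0 ≤ τ) (hΛ : 0 < Λ)
    (hT : t₀ ≤ T)
    (hgz : ∀ t ∈ Set.Icc t₀ T, ∀ z z', ‖g z t - g z' t‖ ≤ b * ‖z - z'‖)
    (hgt : ∀ z : E d, (∀ i, |z i| ≤ r) → ∀ t ∈ Set.Icc t₀ T, ∀ t' ∈ Set.Icc t₀ T,
      ‖g z t - g z t'‖ ≤ τ * |t - t'|) {z : E d} {t : ℝ} (ht : t ∈ Set.Icc t₀ T)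
    (hz : ∀ i, |z i| ≤ r) (hg : ∀ i, |g z t i| ≤ G) {v : Option (Fin d) → ℤ}
    (hv : ∀ i, |(v i : ℝ) - latticeCoord r b τ Λ t₀ z t i| ≤ 1) :
    ‖nodeValue g G r b τ Λ t₀ T v - g z t‖ ≤ (√d + 1) / Λ := by
  have hs : ‖nodeValue g G r b τ Λ t₀ T v - g z t‖ ≤
      ‖g (spaceNode r (Λ * b) v) (timeNode t₀ T (Λ * τ) (v none)) - g z t‖ := by
    have := norm_clampVec_sub_le G (g (spaceNode r (Λ * b) v)
      (timeNode t₀ T (Λ * τ) (v none))) (g z t)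
    rwa [clampVec_eq_self hg] at this
  refine hs.trans ?_
  set tv := timeNode t₀ T (Λ * τ) (v none)
  set zv := spaceNode r (Λ * b) v
  have h1 := hgz tv (timeNode_mem hT _ _) zv z
  have h2 := hgt z hz tv (timeNode_mem hT _ _) t ht
  have h3 : b * ‖zv - z‖ ≤ √d / Λ := by
    have : ‖zv - z‖ ≤ √d * (1 / (Λ * b)) := by
      refine norm_le_of_abs_le _ (by positivity) fun i => ?_
      have h6 := hv (some i)
      simp only [latticeCoord, clamp_eq_self (hz i)] at h6
      have h7 := abs_clamp_sub_clamp_le r (v (some i) / (Λ * b) - r) (z i)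
      rw [clamp_eq_self (hz i)] at h7
      refine h7.trans ?_
      have h8 : (v (some i) : ℝ) / (Λ * b) - r - z i =
          ((v (some i) : ℝ) - Λ * (b * (z i + r))) / (Λ * b) := by field_simp; ring
      rw [h8, abs_div, abs_of_pos (mul_pos hΛ hb)]
      gcongr
    calc _ ≤ b * (√d * (1 / (Λ * b))) := by gcongr
      _ = _ := by field_simp
  have h4 : τ * |tv - t| ≤ 1 / Λ := by
    have h6 := hv none
    have h9 : (0 : ℝ) ≤ t - t₀ := by linarith [ht.1]
    simp only [latticeCoord, max_eq_left h9] at h6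
    have h10 : τ * |(v none : ℝ) / (Λ * τ) - (t - t₀)| ≤ 1 / Λ := by
      rcases hτ.eq_or_lt with h | h
      · rw [← h, zero_mul]; positivity
      · have h11 := mul_abs_div_sub_div_le hτ hΛ (v none) (Λ * (τ * (t - t₀)))
        have h12 : Λ * (τ * (t - t₀)) / (Λ * τ) = t - t₀ := by field_simp
        rw [h12] at h11
        refine h11.trans ?_
        exact mul_le_of_le_one_right (by positivity) h6
    exact (mul_le_mul_of_nonneg_left (abs_timeNode_sub_le ht _ _) hτ).trans h10
  have h5 := norm_sub_le_norm_sub_add_norm_sub (g zv tv) (g z tv) (g z t)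
  rw [add_div]
  linarith

end

/-- A function that is Lipschitz in space and time is approximated on a cube by a network of the
class, with explicit bounds on the architecture. -/
theorem exists_mem_reluClass {T t₀ b τ r G s κ : ℝ} {m N k : ℕ} (h₀ : 0 < t₀)
    (ht₀ : t₀ ≤ 1) (hT : 1 ≤ T) (hb : 0 < b) (hτ : 0 ≤ τ) (hs : 0 < s) (hG : 0 ≤ G)
    (hr : r = m / (s ^ k * b)) (hN : T * τ * s ^ k ≤ N) (g : E d → ℝ → E d)
    (hgz : ∀ t ∈ Set.Icc t₀ T, ∀ z z', ‖g z t - g z' t‖ ≤ b * ‖z - z'‖)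
    (hgt : ∀ z : E d, (∀ i, |z i| ≤ r) → ∀ t ∈ Set.Icc t₀ T, ∀ t' ∈ Set.Icc t₀ T,
      ‖g z t - g z t'‖ ≤ τ * |t - t'|)
    (hκ : 1 ≤ κ) (hrκ : r ≤ κ) (hbκ : b ≤ κ) (hτκ : τ ≤ κ) (hmκ : 2 * m / s ^ k ≤ κ)
    (hNκ : N / s ^ k ≤ κ) (hsκ : s ≤ κ) (hGκ : G ≤ κ) :
    ∃ f ∈ reluClass d T (k + d + 5)
        (((N + 1) * (2 * m + 1) ^ d * (2 * (d + 3)) + 2 * d + 1 : ℕ) : ℝ)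
        (((k + d + 5) * ((N + 1) * (2 * m + 1) ^ d *
          (2 * (d + 3) * (2 * (d + 3) + d + 2) + d)) : ℕ) : ℝ) (√d * G) κ (b * √d) τ,
      ∀ t ∈ Set.Icc t₀ T, ∀ z : E d, (∀ i, |z i| ≤ r) → (∀ i, |g z t i| ≤ G) →
        ‖f z t - g z t‖ ≤ (√d + 1) / s ^ k := by
  set Λ := s ^ k with hΛdef
  have hΛ : 0 < Λ := by positivity
  have hr0 : 0 ≤ r := by rw [hr]; positivity
  have hT0 : t₀ ≤ T := ht₀.trans hT
  -- With `r = m / (Λ b)`, exactly `2m` steps cover `[-r, r]`; in time `N ≥ TτΛ` steps suffice.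
  let R : Option (Fin d) → ℕ := fun i => i.elim N fun _ => 2 * m
  let V : Type := ∀ i : Option (Fin d), Fin (R i + 1)
  let a : (Option (Fin d) → ℤ) → E d := nodeValue g G r b τ Λ t₀ T
  have haG : ∀ v, ‖a v‖ ≤ √d * G := norm_nodeValue_le hG
  have haL := norm_nodeValue_sub_le (G := G) hr0 hb hτ hΛ hT0 hgz hgt
  have hcard : Fintype.card V = (N + 1) * (2 * m + 1) ^ d := by
    simp [V, Fintype.card_pi, Fintype.prod_option, R]
  have hcι : Fintype.card (Option (Fin d)) = d + 1 := by simp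
  let e : Option (Fin d) → Fin (d + 1) := fun i => i.elim (Fin.last d) Fin.castSucc
  -- The time coordinate needs only `(t - t₀)₊`, so its second unit is zero. The interpolant is
  -- thereby frozen for `t < t₀`, where the class still imposes its bounds.
  let ω : Option (Fin d) × Bool → ℝ := fun q =>
    q.1.elim (if q.2 then 1 else 0) fun _ => 1
  let bias : Option (Fin d) × Bool → ℝ := fun q =>
    q.1.elim (if q.2 then -t₀ else 0) fun _ => if q.2 then r else -r
  let c : Option (Fin d) → ℝ := fun i => i.elim τ fun _ => b
  have hκ0 : 0 ≤ κ := by linarith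
  obtain ⟨Nt, hdep, hwid, hnnz, hwt, heval⟩ := exists_tent_network (V := V)
    (w := (N + 1) * (2 * m + 1) ^ d * (2 * (d + 3)) + 2 * d + 1)
    (Q := (N + 1) * (2 * m + 1) ^ d * (2 * (d + 3) * (2 * (d + 3) + d + 2) + d)) hκ e ω bias c
    -- The lattice points enter divided by `Λ`, before the dilation, so that the biases stay bounded
    -- by `κ`.
    (fun v i => ((v i : ℕ) : ℝ) / Λ) k (fun v j => a (fun i => ((v i : ℕ) : ℤ)) j)
    (by
      rintro ⟨_ | i, _ | _⟩ <;> simp [ω] <;> linarith)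
    (by
      rintro ⟨_ | i, _ | _⟩ <;> simp [bias, abs_of_nonneg hr0, abs_of_pos h₀] <;> linarith)
    (by
      rintro (_ | i)
      · simpa [c, abs_of_nonneg hτ] using hτκ
      · simpa [c, abs_of_pos hb] using hbκ)
    (by
      intro v i
      rw [abs_of_nonneg (by positivity)]
      have hv : ((v i : ℕ) : ℝ) ≤ R i := by exact_mod_cast Nat.lt_succ_iff.1 (v i).2
      refine le_trans (div_le_div_of_nonneg_right hv hΛ.le) ?_
      rcases i with _ | i
      · simpa [R] using hNκ
      · simpa [R] using hmκ)
    hs.le hsκ (fun v j => (abs_clampVec_apply_le hG _ j).trans hGκ)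
    (by rw [hcard, hcι]; apply le_of_eq; ring) (by rw [hcard, hcι]; apply le_of_eq; ring)
  rw [hcι] at hdep hnnz
  let f : E d → ℝ → E d := fun z t =>
    WithLp.toLp 2 (Nt.eval (Fin.snoc (α := fun _ => ℝ) (fun i => z i) t))
  -- Exact equality with the interpolant, for every `z`; the constraints of the class and the error
  -- bound then follow from the averaging form.
  have hf : ∀ z, ∀ t ∈ Set.Icc 0 T, f z t = interp a (latticeCoord r b τ Λ t₀ z t) := by
    intro z t ht
    rw [← sum_hat_smul_eq_interp a R]
    · ext j
      simp only [f, heval, WithLp.ofLp_sum, Finset.sum_apply, PiLp.smul_apply, smul_eq_mul]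
      refine Finset.sum_congr rfl fun v _ => ?_
      rw [mul_comm]
      congr 2
      ext i
      rw [← hΛdef, mul_sub, mul_div_cancel₀ _ hΛ.ne']
      congr 1
      rcases i with _ | i
      · simp [latticeCoord, c, ω, bias, e, ← sub_eq_add_neg]
      · have := relu_sub_relu_eq_clamp hr0 (z i)
        simp only [latticeCoord, c, ω, bias, e, Option.elim_some, one_mul, Fin.snoc_castSucc,
          if_true, Bool.false_eq_true, if_false, ← sub_eq_add_neg, this]
    · rintro (_ | i)
      · simp only [latticeCoord]; positivity
      · have := (abs_le.1 (abs_clamp_le hr0 (z i))).1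
        simp only [latticeCoord]
        have : 0 ≤ clamp r (z i) + r := by linarith
        positivity
    · rintro (_ | i)
      · simp only [latticeCoord, R, Option.elim_none]
        refine le_trans ?_ hN
        have : max (t - t₀) 0 ≤ T := max_le (by linarith [ht.2]) (by linarith)
        calc _ ≤ Λ * (τ * T) := by gcongr
          _ = _ := by ring
      · have := (abs_le.1 (abs_clamp_le hr0 (z i))).2
        simp only [latticeCoord, R, Option.elim_some]
        calc _ ≤ Λ * (b * (r + r)) := by gcongr
          _ = _ := by rw [hr]; push_cast; field_simp; ring
  refine ⟨f, ⟨⟨Nt, fun z t => rfl, ?_, ?_, ?_, hwt⟩, ?_, ?_, ?_⟩, ?_⟩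
  · rw [hdep]; ring
  · exact_mod_cast hwid
  · have h1 : k + (d + 1) + 4 = k + d + 5 := by ring
    rw [h1] at hnnz
    exact_mod_cast hnnz
  · intro z t ht
    rw [hf z t ht]
    exact norm_interp_le haG _
  · intro z₁ z₂ t ht
    rw [hf z₁ t ht, hf z₂ t ht]
    refine (norm_interp_sub_interp_le haG haL _ _).trans ?_
    rw [Fintype.sum_option]
    simp only [latticeCoord, sub_self, abs_zero, zero_add]
    calc _ ≤ 1 / Λ * ∑ i, Λ * (b * |z₁ i - z₂ i|) := by
          gcongr with i
          rw [← mul_sub, ← mul_sub, abs_mul, abs_mul, abs_of_pos hΛ, abs_of_pos hb,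
            add_sub_add_right_eq_sub]
          exact mul_le_mul_of_nonneg_left (mul_le_mul_of_nonneg_left
            (abs_clamp_sub_clamp_le _ _ _) hb.le) hΛ.le
      _ = b * ∑ i, |(z₁ - z₂) i| := by
          rw [← Finset.mul_sum, ← Finset.mul_sum]
          simp only [PiLp.sub_apply]
          field_simp
      _ ≤ b * (√d * ‖z₁ - z₂‖) := by gcongr; exact sum_abs_le _
      _ = _ := by ring
  · intro z t₁ ht₁ t₂ ht₂
    rw [hf z t₁ ht₁, hf z t₂ ht₂]
    refine (norm_interp_sub_interp_le haG haL _ _).trans ?_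
    rw [Fintype.sum_option]
    simp only [latticeCoord, sub_self, abs_zero, Finset.sum_const_zero, add_zero]
    rw [← mul_sub, ← mul_sub, abs_mul, abs_mul, abs_of_pos hΛ, abs_of_nonneg hτ, ← mul_assoc,
      one_div_mul_cancel hΛ.ne', one_mul]
    refine mul_le_mul_of_nonneg_left ?_ hτ
    have h1 := abs_max_sub_max_le_max (t₁ - t₀) 0 (t₂ - t₀) 0
    simpa using h1
  · intro t ht z hz hgG
    rw [hf z t ⟨h₀.le.trans ht.1, ht.2⟩]
    exact norm_interp_sub_le haG fun v hv =>
      norm_nodeValue_sub_apply_le hb hτ hΛ hT0 hgz hgt ht hz hgG hv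

end ScoreApprox
end

noncomputable section
namespace ScoreApprox

/-! ### From uniform errors on a ball to the `L²` error of the score -/

variable {d D : ℕ}

lemma eLpNorm_two_le_of_lintegral_sq_le {α : Type} [MeasurableSpace α] {ν : Measure α} {F : α → ℝ}
    {c : ℝ} (hc : 0 ≤ c) (h : ∫⁻ x, ENNReal.ofReal (F x ^ 2) ∂ν ≤ ENNReal.ofReal (c ^ 2)) :
    eLpNorm F 2 ν ≤ ENNReal.ofReal c := by
  rw [eLpNorm_eq_lintegral_rpow_enorm_toReal (by norm_num) (by norm_num)]
  simp only [ENNReal.toReal_ofNat]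
  have hpt : ∀ x, ‖F x‖ₑ ^ (2 : ℝ) = ENNReal.ofReal (F x ^ 2) := by
    intro x
    rw [Real.enorm_eq_ofReal_abs, ENNReal.ofReal_rpow_of_nonneg (abs_nonneg _) (by norm_num)]
    congr 1
    rw [Real.rpow_ofNat, sq_abs]
  simp only [hpt]
  calc _ ≤ (ENNReal.ofReal (c ^ 2)) ^ (1 / 2 : ℝ) := by gcongr
    _ = ENNReal.ofReal c := by
      rw [ENNReal.ofReal_rpow_of_nonneg (by positivity) (by norm_num), ← Real.sqrt_eq_rpow,
        Real.sqrt_sq hc]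

/-- Inside the ball the uniform error is used. Outside, both functions grow at most quadratically,
and `u ≤ e^u` with `‖z‖ ≥ r₀` dominates the error by `Ψ`, a multiple of `exp(l‖z‖²/2 - l r₀²/4)`.
The square of `Ψ` is integrated by the exponential moment, and `htail` makes its `L²` norm at most
`ε/2`. This fits because `(√d + 1) ε/2 + ε/2 ≤ (√d + 1) ε`. -/
theorem eLpNorm_scoreNet_sub_score_le {A : Matrix (Fin D) (Fin d) ℝ} (hA : Aᵀ * A = 1)
    {P : Measure (E d)} [IsProbabilityMeasure P] {μ k₀ l c₁ r₀ ε t : ℝ} (hd : 1 ≤ d) (hμ : 0 < μ)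
    (hP : ∫⁻ z, ENNReal.ofReal (Real.exp (μ * ‖z‖ ^ 2)) ∂P ≤ ENNReal.ofReal (Real.exp (k₀ * d)))
    (hl : 0 < l) (hl8 : l ≤ 1 / 8) (hlμ : 4 * l ≤ μ) (hc₁ : 0 ≤ c₁) (hr₀ : √d ≤ r₀) (hε : 0 < ε)
    (ht : 0 < t) (hg : ∀ z, ‖posterior P t z‖ ≤ 2 * ‖z‖ + c₁ * √d) {f : E d → ℝ → E d}
    (hf : ∀ z, ‖f z t‖ ≤ √d * (2 * r₀ + c₁ * √d))
    (hin : ∀ z, ‖z‖ ≤ r₀ → ‖f z t - posterior P t z‖ ≤ (√d + 1) * (ε / 2))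
    (htail : (8 * (2 + c₁) / l) ^ 2 * Real.exp ((k₀ + 1) * d - l * r₀ ^ 2 / 2) ≤ (ε / 2) ^ 2) :
    eLpNorm (fun x => scoreNet A f x t - score (P.map (toEuclideanLin A)) t x) 2
      (marginalLaw (P.map (toEuclideanLin A)) t) ≤
      ENNReal.ofReal ((√(d : ℝ) + 1) / noiseVar t * ε) := by
  have hh := noiseVar_pos ht
  have hm := measurable_toEuclideanLin A
  have hmT := measurable_toEuclideanLin Aᵀ
  have : IsProbabilityMeasure (P.map (toEuclideanLin A)) :=
    Measure.isProbabilityMeasure_map hm.aemeasurable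
  have hid := integrable_id_of_moments
    (integrable_norm_pow_of_exp hμ (integrable_exp_of_lintegral_le hP).1)
  have hd1 : (1 : ℝ) ≤ √d := Real.one_le_sqrt.2 (by exact_mod_cast hd)
  set ν := marginalLaw (P.map (toEuclideanLin A)) t with hν
  set c₄ := 8 * (2 + c₁) / l with hc₄
  have hc₄0 : 0 ≤ c₄ := by positivity
  set Ψ : E d → ℝ := fun z => c₄ * Real.exp (l * ‖z‖ ^ 2 / 2 - l * r₀ ^ 2 / 4) with hΨ
  have hΨ0 : ∀ z, 0 ≤ Ψ z := fun z => by positivity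
  have hpt : ∀ z, ‖f z t - posterior P t z‖ ≤ (√d + 1) * (ε / 2) + Ψ z := by
    intro z
    rcases le_or_gt ‖z‖ r₀ with h | h
    · exact (hin z h).trans (le_add_of_nonneg_right (hΨ0 z))
    · refine le_trans ?_ (le_add_of_nonneg_left (by positivity))
      have hz : √d ≤ ‖z‖ := hr₀.trans h.le
      have h1 : 2 * r₀ + c₁ * √d ≤ (2 + c₁) * ‖z‖ := by nlinarith
      have h2 : 2 * ‖z‖ + c₁ * √d ≤ (2 + c₁) * ‖z‖ := by nlinarith
      have h3 : ‖f z t - posterior P t z‖ ≤ 2 * (2 + c₁) * ‖z‖ ^ 2 := by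
        have h4 : √d * (2 * r₀ + c₁ * √d) ≤ ‖z‖ * ((2 + c₁) * ‖z‖) := by
          have h0 : 0 ≤ r₀ := (Real.sqrt_nonneg _).trans hr₀
          gcongr
        have h5 : (2 + c₁) * ‖z‖ ≤ ‖z‖ * ((2 + c₁) * ‖z‖) :=
          le_mul_of_one_le_left (by positivity) (hd1.trans hz)
        have h6 := norm_sub_le (f z t) (posterior P t z)
        have h7 := hf z
        have h8 := hg z
        nlinarith
      have h9 : ‖z‖ ^ 2 ≤ 4 / l * Real.exp (l * ‖z‖ ^ 2 / 4) := by
        have := Real.add_one_le_exp (l * ‖z‖ ^ 2 / 4)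
        rw [div_mul_eq_mul_div, le_div_iff₀ hl]
        linarith
      have h10 : Real.exp (l * ‖z‖ ^ 2 / 4) ≤ Real.exp (l * ‖z‖ ^ 2 / 2 - l * r₀ ^ 2 / 4) := by
        refine Real.exp_le_exp.2 ?_
        have h0 : 0 ≤ r₀ := (Real.sqrt_nonneg _).trans hr₀
        have : l * r₀ ^ 2 ≤ l * ‖z‖ ^ 2 := by gcongr
        linarith
      calc _ ≤ 2 * (2 + c₁) * ‖z‖ ^ 2 := h3
        _ ≤ 2 * (2 + c₁) * (4 / l * Real.exp (l * ‖z‖ ^ 2 / 2 - l * r₀ ^ 2 / 4)) := by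
            gcongr
            exact h9.trans (by gcongr)
        _ = Ψ z := by rw [hΨ, hc₄]; ring
  have hmaj : ∀ x : E D, ‖scoreNet A f x t - score (P.map (toEuclideanLin A)) t x‖ ≤
      1 / noiseVar t * ((√d + 1) * (ε / 2) + Ψ (toEuclideanLin Aᵀ x)) := by
    intro x
    rw [scoreNet_sub_score hA P hid ht, norm_smul, norm_toEuclideanLin hA,
      Real.norm_of_nonneg (by positivity)]
    gcongr
    exact hpt _
  refine (eLpNorm_mono_real hmaj).trans ?_
  have hΨm : Measurable fun x : E D => Ψ (toEuclideanLin Aᵀ x) := by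
    simp only [hΨ]; fun_prop
  have hΨL : eLpNorm (fun x => Ψ (toEuclideanLin Aᵀ x)) 2 ν ≤ ENNReal.ofReal (ε / 2) := by
    refine eLpNorm_two_le_of_lintegral_sq_le (by positivity) ?_
    have hsq : ∀ x : E D, ENNReal.ofReal (Ψ (toEuclideanLin Aᵀ x) ^ 2) =
        ENNReal.ofReal (c₄ ^ 2 * Real.exp (-(l * r₀ ^ 2 / 2))) *
          ENNReal.ofReal (Real.exp (l * ‖toEuclideanLin Aᵀ x‖ ^ 2)) := by
      intro x
      rw [← ENNReal.ofReal_mul (by positivity), mul_assoc, ← Real.exp_add, hΨ, mul_pow,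
        ← Real.exp_nat_mul]
      congr 3
      push_cast
      ring
    simp only [hsq]
    rw [lintegral_const_mul' _ _ ENNReal.ofReal_ne_top]
    calc _ ≤ ENNReal.ofReal (c₄ ^ 2 * Real.exp (-(l * r₀ ^ 2 / 2))) *
          ENNReal.ofReal (Real.exp ((k₀ + 1) * d)) := by
          gcongr
          exact lintegral_exp_marginalLaw_le hA P hP hl.le hl8 hlμ ht
      _ = ENNReal.ofReal (c₄ ^ 2 * Real.exp ((k₀ + 1) * d - l * r₀ ^ 2 / 2)) := by
          rw [← ENNReal.ofReal_mul (by positivity), mul_assoc, ← Real.exp_add]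
          congr 3
          ring
      _ ≤ _ := ENNReal.ofReal_le_ofReal htail
  have hν1 : ν Set.univ = 1 := marginalLaw_univ _ ht
  have hsum : eLpNorm (fun x => (√d + 1) * (ε / 2) + Ψ (toEuclideanLin Aᵀ x)) 2 ν ≤
      ENNReal.ofReal ((√d + 1) * (ε / 2)) + ENNReal.ofReal (ε / 2) := by
    refine (eLpNorm_add_le aestronglyMeasurable_const hΨm.aestronglyMeasurable
      (by norm_num)).trans (add_le_add ?_ hΨL)
    have hν0 : ν ≠ 0 := fun h => by simp [h] at hν1
    rw [eLpNorm_const _ (by norm_num) hν0, hν1, ENNReal.one_rpow, mul_one,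
      Real.enorm_of_nonneg (by positivity)]
  have hsmul : (fun x : E D => 1 / noiseVar t * ((√d + 1) * (ε / 2) + Ψ (toEuclideanLin Aᵀ x))) =
      (1 / noiseVar t) • fun x => (√d + 1) * (ε / 2) + Ψ (toEuclideanLin Aᵀ x) := rfl
  rw [hsmul, eLpNorm_const_smul, Real.enorm_of_nonneg (by positivity)]
  calc _ ≤ ENNReal.ofReal (1 / noiseVar t) *
        (ENNReal.ofReal ((√d + 1) * (ε / 2)) + ENNReal.ofReal (ε / 2)) := by gcongr
    _ = ENNReal.ofReal (1 / noiseVar t * ((√d + 1) * (ε / 2) + ε / 2)) := by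
        rw [← ENNReal.ofReal_add (by positivity) (by positivity),
          ← ENNReal.ofReal_mul (by positivity)]
    _ ≤ _ := by
        refine ENNReal.ofReal_le_ofReal ?_
        have : (√d + 1) * (ε / 2) + ε / 2 ≤ (√d + 1) * ε := by nlinarith
        calc _ ≤ 1 / noiseVar t * ((√d + 1) * ε) := by gcongr
          _ = _ := by ring

/-! ### Regularity of the posterior mean from that of the on-support score -/

section

variable {A : Matrix (Fin D) (Fin d) ℝ} {p : E d → ℝ} [IsProbabilityMeasure (latentLaw p)]

lemma noiseVar_smul_onSupportScore (hid : Integrable (fun z => z) (latentLaw p)) {t : ℝ}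
    (ht : 0 < t) (z : E d) :
    noiseVar t • onSupportScore A p z t = toEuclideanLin A (posterior (latentLaw p) t z - z) := by
  rw [onSupportScore, score_eq _ hid ht, map_smul, smul_smul,
    mul_one_div_cancel (noiseVar_pos ht).ne', one_smul]

/-- Tweedie's formula gives `A (g - z) = h(t) s_∥`, with `A` an isometry and `h(t) ≤ 1`; the
identity part contributes the `1` in `1 + β`. -/
lemma norm_posterior_sub_le (hA : Aᵀ * A = 1) (hid : Integrable (fun z => z) (latentLaw p))
    {t β : ℝ} (ht : 0 < t) {z₁ z₂ : E d}
    (h : ‖onSupportScore A p z₁ t - onSupportScore A p z₂ t‖ ≤ β * ‖z₁ - z₂‖) :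
    ‖posterior (latentLaw p) t z₁ - posterior (latentLaw p) t z₂‖ ≤ (1 + β) * ‖z₁ - z₂‖ := by
  have hh := noiseVar_pos ht
  have h1 : toEuclideanLin A ((posterior (latentLaw p) t z₁ - posterior (latentLaw p) t z₂) -
      (z₁ - z₂)) = noiseVar t • (onSupportScore A p z₁ t - onSupportScore A p z₂ t) := by
    rw [smul_sub, noiseVar_smul_onSupportScore hid ht, noiseVar_smul_onSupportScore hid ht,
      ← map_sub]
    congr 1
    abel
  have h2 := norm_toEuclideanLin hA ((posterior (latentLaw p) t z₁ -
    posterior (latentLaw p) t z₂) - (z₁ - z₂))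
  rw [h1, norm_smul, Real.norm_of_nonneg hh.le] at h2
  have h3 : noiseVar t * ‖onSupportScore A p z₁ t - onSupportScore A p z₂ t‖ ≤
      1 * (β * ‖z₁ - z₂‖) := mul_le_mul (noiseVar_le_one t) h (norm_nonneg _) zero_le_one
  have h4 := norm_le_norm_add_norm_sub' (posterior (latentLaw p) t z₁ -
    posterior (latentLaw p) t z₂) (z₁ - z₂)
  linarith

lemma timeLip_nonneg (A : Matrix (Fin D) (Fin d) ℝ) (p : E d → ℝ) (t₀ T R : ℝ) :
    0 ≤ timeLip A p t₀ T R := by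
  refine Real.sSup_nonneg ?_
  rintro r ⟨t, _, z, _, rfl⟩
  exact norm_nonneg _

/-- The mean value inequality: `A` is an isometry and `z` does not depend on time, so the derivative
in the definition of `timeLip` has the norm of that of the posterior mean. -/
theorem norm_posterior_sub_time_le (hA : Aᵀ * A = 1)
    (hP : ∀ k : ℕ, Integrable (fun z => ‖z‖ ^ k) (latentLaw p)) {t₀ T R : ℝ} (h₀ : 0 < t₀)
    (hR : 0 ≤ R) {z : E d} (hz : ∀ i, |z i| ≤ R) {t t' : ℝ} (ht : t ∈ Set.Icc t₀ T)
    (ht' : t' ∈ Set.Icc t₀ T) :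
    ‖posterior (latentLaw p) t z - posterior (latentLaw p) t' z‖ ≤
      timeLip A p t₀ T R * |t - t'| := by
  have hid := integrable_id_of_moments hP
  obtain ⟨C, hC⟩ := exists_norm_deriv_posterior_le hP (√d * R) h₀
  have hcube : ∀ w : E d, (∀ i, |w i| ≤ R) → ‖w‖ ≤ √d * R := fun w => norm_le_of_abs_le w hR
  have hderiv : ∀ s ∈ Set.Icc t₀ T, ∀ w : E d, (∀ i, |w i| ≤ R) →
      ‖deriv (fun u => noiseVar u • onSupportScore A p w u) s‖ =
        ‖deriv (fun u => posterior (latentLaw p) u w) s‖ := by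
    intro s hs w hw
    have hs0 : 0 < s := h₀.trans_le hs.1
    have hdiff := (hC s hs.1 w (hcube w hw)).1
    have heq : (fun u => noiseVar u • onSupportScore A p w u) =ᶠ[nhds s]
        fun u => (toEuclideanLin A).toContinuousLinearMap (posterior (latentLaw p) u w - w) := by
      filter_upwards [lt_mem_nhds hs0] with u hu
      exact noiseVar_smul_onSupportScore hid hu w
    rw [heq.deriv_eq]
    have hd := ((toEuclideanLin A).toContinuousLinearMap).hasFDerivAt.comp_hasDerivAt s
      (hdiff.hasDerivAt.sub_const w)
    rw [show deriv (fun u => (toEuclideanLin A).toContinuousLinearMap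
      (posterior (latentLaw p) u w - w)) s = _ from hd.deriv]
    exact norm_toEuclideanLin hA _
  -- Needed for the supremum to be an upper bound at all: `sSup` of an unbounded set of reals is
  -- `0`.
  have hbdd : BddAbove {r : ℝ | ∃ t ∈ Set.Icc t₀ T, ∃ z : E d, (∀ i, |z i| ≤ R) ∧
      r = ‖deriv (fun s => noiseVar s • onSupportScore A p z s) t‖} := by
    refine ⟨C, ?_⟩
    rintro r ⟨s, hs, w, hw, rfl⟩
    rw [hderiv s hs w hw]
    exact (hC s hs.1 w (hcube w hw)).2
  have := Convex.norm_image_sub_le_of_norm_deriv_le (𝕜 := ℝ)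
    (f := fun u => posterior (latentLaw p) u z) (s := Set.Icc t₀ T) (C := timeLip A p t₀ T R)
    (fun s hs => (hC s hs.1 z (hcube z hz)).1)
    (fun s hs => by
      rw [← hderiv s hs z hz]
      exact le_csSup hbdd ⟨s, hs, z, hz, rfl⟩) (convex_Icc t₀ T) ht' ht
  rwa [Real.norm_eq_abs] at this

end

end ScoreApprox
end

noncomputable section
namespace ScoreApprox

/-! ### Sizes -/

variable {d : ℕ}

/-- The base tends to zero, so it is eventually at most `1/2` and `d · 2^{-d} ≤ 1`; the finitely
many other dimensions are summed. This is what absorbs the dimensional factors `C^d` into a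
constant. -/
lemma exists_forall_mul_pow_le (C : ℝ) (hC : 0 ≤ C) :
    ∃ c : ℝ, 0 < c ∧ ∀ d : ℕ, (d : ℝ) * (C / √(Real.log (2 * d))) ^ d ≤ c := by
  have hlim : Filter.Tendsto (fun d : ℕ => C / √(Real.log (2 * d))) Filter.atTop (nhds 0) := by
    refine Filter.Tendsto.const_div_atTop ?_ C
    refine Real.tendsto_sqrt_atTop.comp (Real.tendsto_log_atTop.comp ?_)
    exact tendsto_natCast_atTop_atTop.const_mul_atTop two_pos
  obtain ⟨n₀, hn₀⟩ := Filter.eventually_atTop.1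
    (hlim.eventually (ge_mem_nhds (by norm_num : (0 : ℝ) < 1 / 2)))
  have hnn : ∀ d : ℕ, 0 ≤ (d : ℝ) * (C / √(Real.log (2 * d))) ^ d := fun d => by positivity
  refine ⟨1 + ∑ d ∈ Finset.range n₀, (d : ℝ) * (C / √(Real.log (2 * d))) ^ d,
    add_pos_of_pos_of_nonneg one_pos (Finset.sum_nonneg fun d _ => hnn d), fun d => ?_⟩
  rcases lt_or_ge d n₀ with h | h
  · have := Finset.single_le_sum (f := fun d : ℕ => (d : ℝ) * (C / √(Real.log (2 * d))) ^ d)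
      (fun d _ => hnn d) (Finset.mem_range.2 h)
    linarith
  · have h1 : (C / √(Real.log (2 * d))) ^ d ≤ (1 / 2) ^ d :=
      pow_le_pow_left₀ (by positivity) (hn₀ d h) d
    have h2 : (d : ℝ) ≤ 2 ^ d := by exact_mod_cast (Nat.lt_two_pow_self).le
    have h3 : (d : ℝ) * (C / √(Real.log (2 * d))) ^ d ≤ 2 ^ d * (1 / 2) ^ d := by gcongr
    rw [← mul_pow] at h3
    norm_num at h3
    have := Finset.sum_nonneg fun d (_ : d ∈ Finset.range n₀) => hnn d
    linarith

lemma widthRate_eq (hd : 1 ≤ d) {β T t₀ τ ε : ℝ} (hl : 0 ≤ logFactor d t₀ ε) :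
    widthRate d β T t₀ τ ε = (1 + β) ^ d * max (T * τ) ε *
      (d * √(d * logFactor d t₀ ε) ^ d) * (ε ^ (d + 1))⁻¹ := by
  have hd0 : (0 : ℝ) < d := by exact_mod_cast hd
  have h1 : (d : ℝ) ^ ((d : ℝ) / 2 + 1) * logFactor d t₀ ε ^ ((d : ℝ) / 2) =
      d * √(d * logFactor d t₀ ε) ^ d := by
    rw [Real.rpow_add hd0, Real.rpow_one, Real.sqrt_eq_rpow, ← Real.rpow_mul_natCast (by positivity),
      one_div_mul_eq_div, Real.mul_rpow hd0.le hl]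
    ring
  rw [← h1, widthRate]
  ring

lemma log_le_logFactor (hd : 1 ≤ d) {t₀ ε : ℝ} (h₀ : 0 < t₀) (ht₀ : t₀ ≤ 1) (hε : 0 < ε)
    (hε2 : ε ≤ 1 / 2) :
    Real.log (2 * d) ≤ logFactor d t₀ ε ∧ Real.log (1 / ε) ≤ logFactor d t₀ ε := by
  have hd1 : (1 : ℝ) ≤ d := by exact_mod_cast hd
  have hpos : 0 < t₀ * ε := by positivity
  have hle : t₀ * ε ≤ ε := mul_le_of_le_one_left hε.le ht₀
  constructor
  · refine Real.log_le_log (by positivity) ?_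
    rw [le_div_iff₀ hpos]
    nlinarith
  · refine Real.log_le_log (by positivity) ?_
    rw [div_le_div_iff₀ hε hpos]
    nlinarith

/-- The dimension and the logarithm of the accuracy are dominated by the logarithmic factor. -/
lemma add_log_le (hd : 1 ≤ d) {t₀ ε : ℝ} (h₀ : 0 < t₀) (ht₀ : t₀ ≤ 1) (hε : 0 < ε)
    (hε2 : ε ≤ 1 / 2) :
    d + Real.log (1 / ε) ≤ 3 * (d * logFactor d t₀ ε) / Real.log (2 * d) := by
  obtain ⟨h1, h2⟩ := log_le_logFactor hd h₀ ht₀ hε hε2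
  have hd1 : (1 : ℝ) ≤ d := by exact_mod_cast hd
  have hlog : 0 < Real.log (2 * d) := Real.log_pos (by linarith)
  have hlogd : Real.log (2 * d) ≤ 2 * d := (Real.log_le_self (by positivity))
  set ℓ := logFactor d t₀ ε
  have hℓ : 0 < ℓ := hlog.trans_le h1
  rw [le_div_iff₀ hlog]
  -- The logarithm `log(2d)` is used twice: against `log(1/ε) ≤ ℓ` it is bounded by `2d`, against
  -- `d` it is bounded by `ℓ`. The latter holds because `t₀ ε ≤ 1/2`.
  have h3 : Real.log (1 / ε) * Real.log (2 * d) ≤ ℓ * (2 * d) := by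
    have : 0 ≤ Real.log (1 / ε) := Real.log_nonneg (by rw [le_div_iff₀ hε]; linarith)
    gcongr
  have h4 : (d : ℝ) * Real.log (2 * d) ≤ d * ℓ := by gcongr
  linarith

/-- The depth must equal the prescribed number exactly, so all layers beyond the `d + 5` fixed ones
carry the dilation. There are `k ≥ log(2/ε)` of them, so the factor `s = (2/ε)^{1/k}` is at most
`e`. -/
lemma exists_pow_eq_two_div {ε : ℝ} (hε : 0 < ε) (hε2 : ε ≤ 1 / 2) (hd : 1 ≤ d) :
    ∃ (s : ℝ) (k : ℕ), 0 < s ∧ s ≤ 3 ∧ s ^ k = 2 / ε ∧ k + d + 5 = ⌈10 * depthRate d ε⌉₊ := by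
  have hd1 : (1 : ℝ) ≤ d := by exact_mod_cast hd
  have hL : 0 ≤ Real.log (1 / ε) := Real.log_nonneg (by rw [le_div_iff₀ hε]; linarith)
  set n := ⌈10 * depthRate d ε⌉₊ with hn
  have hceil : 10 * (Real.log (1 / ε) + d) ≤ n := Nat.le_ceil _
  have hle : d + 5 ≤ n := by
    have : ((d + 5 : ℕ) : ℝ) ≤ n := by push_cast; linarith
    exact_mod_cast this
  obtain ⟨k, hk⟩ := Nat.exists_eq_add_of_le hle
  have hlog : Real.log (2 / ε) = Real.log 2 + Real.log (1 / ε) := by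
    rw [← Real.log_mul two_ne_zero (by positivity)]
    congr 1
    ring
  have hk1 : Real.log (2 / ε) ≤ k := by
    have : (n : ℝ) = d + 5 + k := by rw [hk]; push_cast; ring
    have := Real.log_two_lt_d9
    rw [hlog]
    linarith
  have hpos : 0 < Real.log (2 / ε) := by
    have := Real.log_two_gt_d9
    rw [hlog]
    linarith
  have hk0 : (0 : ℝ) < k := hpos.trans_le hk1
  refine ⟨Real.exp (Real.log (2 / ε) / k), k, Real.exp_pos _, ?_, ?_, by omega⟩
  · calc _ ≤ Real.exp 1 := Real.exp_le_exp.2 ((div_le_one hk0).2 hk1)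
      _ ≤ 3 := by linarith [Real.exp_one_lt_d9]
  · rw [← Real.exp_nat_mul, mul_div_cancel₀ _ hk0.ne', Real.exp_log (by positivity)]

lemma reluClass_mono {T M M' J J' K K' κ γ γ' γt γt' : ℝ} {L : ℕ} (hM : M ≤ M')
    (hJ : J ≤ J') (hK : K ≤ K') (hγ : γ ≤ γ') (hγt : γt ≤ γt') :
    reluClass d T L M J K κ γ γt ⊆ reluClass d T L M' J' K' κ γ' γt' := by
  rintro f ⟨⟨N, h1, h2, h3, h4, h5⟩, h6, h7, h8⟩
  refine ⟨⟨N, h1, h2, h3.trans hM, h4.trans hJ, h5⟩, fun z t ht => (h6 z t ht).trans hK,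
    fun z₁ z₂ t ht => (h7 z₁ z₂ t ht).trans (by gcongr),
    fun z t₁ ht₁ t₂ ht₂ => (h8 z t₁ ht₁ t₂ ht₂).trans (by gcongr)⟩

/-- The number of lattice points is at most of the order of the width. -/
lemma card_lattice_mul_sq_le (hd : 1 ≤ d) {β T t₀ τ ε r₀ S c : ℝ} (hβ : 0 ≤ β) (h₀ : 0 < t₀)
    (ht₀ : t₀ ≤ 1) (hT : 0 ≤ T) (hτ : 0 ≤ τ) (hε : 0 < ε) (hε2 : ε ≤ 1 / 2) (hr₀ : 1 ≤ r₀)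
    (hr₀S : r₀ ≤ S * (√(d * logFactor d t₀ ε) / √(Real.log (2 * d))))
    (hc : (d : ℝ) * (7 * S / √(Real.log (2 * d))) ^ d ≤ c) :
    (((⌈T * τ * (2 / ε)⌉₊ + 1) * (2 * ⌈r₀ * (2 / ε) * (1 + β)⌉₊ + 1) ^ d : ℕ) : ℝ) * d ^ 2 ≤
      4 * c * widthRate d β T t₀ τ ε := by
  obtain ⟨hℓ1, hℓ2⟩ := log_le_logFactor hd h₀ ht₀ hε hε2
  have hd1 : (1 : ℝ) ≤ d := by exact_mod_cast hd
  have hlog : 0 < Real.log (2 * d) := Real.log_pos (by linarith)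
  rw [widthRate_eq hd (hlog.le.trans hℓ1)]
  set Y := √(d * logFactor d t₀ ε) with hY
  have hY0 : 0 ≤ Y := Real.sqrt_nonneg _
  -- With `q = r₀(1+β)/ε ≥ 1`: `2⌈2q⌉ + 1 ≤ 4q + 3 ≤ 7q`.
  have hm : (2 * (⌈r₀ * (2 / ε) * (1 + β)⌉₊ : ℝ) + 1) ≤ 7 * r₀ * (1 + β) / ε := by
    have h1 := (Nat.ceil_lt_add_one (by positivity : 0 ≤ r₀ * (2 / ε) * (1 + β))).le
    have h2 : 1 ≤ r₀ * (1 + β) / ε := by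
      rw [le_div_iff₀ hε]
      nlinarith
    have h3 : r₀ * (2 / ε) * (1 + β) = 2 * (r₀ * (1 + β) / ε) := by ring
    have h4 : 7 * r₀ * (1 + β) / ε = 7 * (r₀ * (1 + β) / ε) := by ring
    rw [h3] at h1
    rw [h4]
    rw [h3]
    linarith
  -- The rounding is absorbed because `max(Tτ, ε)/ε ≥ 1`; this is the role of `ε` in the maximum.
  have hN : (⌈T * τ * (2 / ε)⌉₊ : ℝ) + 1 ≤ 4 * (max (T * τ) ε / ε) := by
    have h1 := (Nat.ceil_lt_add_one (by positivity : 0 ≤ T * τ * (2 / ε))).le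
    have h2 : T * τ / ε ≤ max (T * τ) ε / ε := by gcongr; exact le_max_left _ _
    have h3 : 1 ≤ max (T * τ) ε / ε := by rw [le_div_iff₀ hε, one_mul]; exact le_max_right _ _
    have h4 : T * τ * (2 / ε) = 2 * (T * τ / ε) := by ring
    rw [h4] at h1 ⊢
    linarith
  -- One factor of `d²` is absorbed here by the decay of `(7S/√log(2d))^d`; the other is the `d`
  -- present in the width rate.
  have hr : (7 * r₀) ^ d * d ≤ c * Y ^ d := by
    have h1 : 7 * r₀ ≤ 7 * S / √(Real.log (2 * d)) * Y := by
      calc _ ≤ 7 * (S * (Y / √(Real.log (2 * d)))) := by gcongr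
        _ = _ := by ring
    calc _ ≤ (7 * S / √(Real.log (2 * d)) * Y) ^ d * d := by gcongr
      _ = (d * (7 * S / √(Real.log (2 * d))) ^ d) * Y ^ d := by rw [mul_pow]; ring
      _ ≤ _ := by gcongr
  push_cast
  have hmax : 0 ≤ max (T * τ) ε := hε.le.trans (le_max_right _ _)
  calc _ ≤ 4 * (max (T * τ) ε / ε) * (7 * r₀ * (1 + β) / ε) ^ d * (d : ℝ) ^ 2 := by gcongr
    _ = 4 * (max (T * τ) ε / ε) * ((1 + β) / ε) ^ d * d * ((7 * r₀) ^ d * d) := by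
        have : 7 * r₀ * (1 + β) / ε = 7 * r₀ * ((1 + β) / ε) := by ring
        rw [this, mul_pow]
        ring
    _ ≤ 4 * (max (T * τ) ε / ε) * ((1 + β) / ε) ^ d * d * (c * Y ^ d) := by
        have : 0 ≤ (1 + β) / ε := by positivity
        gcongr
    _ = _ := by
        rw [div_pow, pow_succ]
        field_simp

/-- The radius outside of which the tail is negligible. -/
lemma tail_le (hd : 1 ≤ d) {ε l k₀ c₄ : ℝ} (hε : 0 < ε) (hε2 : ε ≤ 1 / 2) (hl : 0 < l)
    (hk₀ : 0 ≤ k₀) (hc₄ : 1 ≤ c₄) :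
    c₄ ^ 2 * Real.exp ((k₀ + 1) * d - l * √(2 / l * (k₀ + 3 + 2 * Real.log (2 * c₄)) *
      (d + Real.log (1 / ε))) ^ 2 / 2) ≤ (ε / 2) ^ 2 := by
  have hd1 : (1 : ℝ) ≤ d := by exact_mod_cast hd
  have hL : 0 ≤ Real.log (1 / ε) := Real.log_nonneg (by rw [le_div_iff₀ hε]; linarith)
  have hlc : 0 ≤ Real.log (2 * c₄) := Real.log_nonneg (by linarith)
  rw [Real.sq_sqrt (by positivity)]
  have h1 : l * (2 / l * (k₀ + 3 + 2 * Real.log (2 * c₄)) * (d + Real.log (1 / ε))) / 2 =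
      (k₀ + 3 + 2 * Real.log (2 * c₄)) * (d + Real.log (1 / ε)) := by field_simp
  rw [h1]
  have h2 : (k₀ + 1) * d - (k₀ + 3 + 2 * Real.log (2 * c₄)) * (d + Real.log (1 / ε)) ≤
      -(2 * Real.log (2 * c₄)) - 2 * Real.log (1 / ε) := by
    have h3 : 0 ≤ Real.log (2 * c₄) * (d - 1) := mul_nonneg hlc (by linarith)
    have h4 : 0 ≤ (k₀ + 1 + 2 * Real.log (2 * c₄)) * Real.log (1 / ε) := by positivity
    nlinarith
  have h5 : Real.exp (-(2 * Real.log (2 * c₄)) - 2 * Real.log (1 / ε)) =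
      (ε / (2 * c₄)) ^ 2 := by
    have : -(2 * Real.log (2 * c₄)) - 2 * Real.log (1 / ε) =
        (2 : ℕ) * Real.log (ε / (2 * c₄)) := by
      rw [Real.log_div hε.ne' (by positivity), one_div, Real.log_inv]
      push_cast
      ring
    rw [this, Real.exp_nat_mul, Real.exp_log (by positivity)]
  calc _ ≤ c₄ ^ 2 * (ε / (2 * c₄)) ^ 2 := by
        rw [← h5]
        gcongr
    _ = _ := by field_simp

end ScoreApprox
end

/-! ### Assembling the approximation theorem with explicit constants -/

noncomputable section
namespace ScoreApprox

variable {d D : ℕ}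

lemma card_mul_add_le_card_mul_sq {X : ℕ} (hX : 1 ≤ X) (hd : 1 ≤ d) :
    X * (2 * (d + 3)) + 2 * d + 1 ≤ 11 * (X * d ^ 2) := by
  have h1 : d ≤ d ^ 2 := Nat.le_self_pow two_ne_zero d
  have h2 : 1 * d ^ 2 ≤ X * d ^ 2 := Nat.mul_le_mul_right _ hX
  have h3 : X * d ≤ X * d ^ 2 := Nat.mul_le_mul_left _ h1
  have h4 : X * 1 ≤ X * d ^ 2 := Nat.mul_le_mul_left _ (hd.trans h1)
  linarith

lemma weight_count_le (hd : 1 ≤ d) :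
    2 * (d + 3) * (2 * (d + 3) + d + 2) + d ≤ 89 * d ^ 2 := by
  have h1 : d ≤ d ^ 2 := Nat.le_self_pow two_ne_zero d
  nlinarith
lemma sqrt_mul_sqrt_mul_le {ℓ : ℝ} (hd : 1 ≤ d) (hℓ : 1 / 2 ≤ ℓ) :
    √(d : ℝ) * √(d * ℓ) ≤ 2 * d ^ 2 * ℓ := by
  have hd1 : (1 : ℝ) ≤ d := by exact_mod_cast hd
  rw [← Real.sqrt_mul (by positivity)]
  refine Real.sqrt_le_iff.2 ⟨by positivity, ?_⟩
  have h1 : (d : ℝ) * d * ℓ ≤ d * d * (4 * ℓ ^ 2) := by gcongr; nlinarith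
  have h2 : (1 : ℝ) ≤ d * d := one_le_mul_of_one_le_of_one_le hd1 hd1
  calc _ = (d : ℝ) * d * ℓ := by ring
    _ ≤ 1 * (d * d * (4 * ℓ ^ 2)) := by rwa [one_mul]
    _ ≤ (d * d : ℝ) * (d * d * (4 * ℓ ^ 2)) := by gcongr
    _ = _ := by ring

set_option maxHeartbeats 2000000 in
/-- Score approximation with all constants explicit in terms of the exponential moment. -/
theorem exists_score_network {μ k₀ l c₁ c₂ S c : ℝ} (hμ : 0 < μ) (hk₀ : 0 ≤ k₀) (hl : 0 < l)
    (hl8 : l ≤ 1 / 8) (hlμ : 4 * l ≤ μ) (hc₁ : c₁ = 3 * √((k₀ + 1) / μ) + 1 / √μ)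
    (hc₂ : c₂ = 2 / l * (k₀ + 3 + 2 * Real.log (2 * (8 * (2 + c₁) / l)))) (hS : S = √(3 * c₂))
    (hc : ∀ d : ℕ, (d : ℝ) * (7 * S / √(Real.log (2 * d))) ^ d ≤ c)
    (hd : 1 ≤ d) {T t₀ ε β : ℝ} {A : Matrix (Fin D) (Fin d) ℝ} {p : E d → ℝ}
    (h₀ : 0 < t₀) (ht₀ : t₀ ≤ 1) (hT : 1 ≤ T) (hε : 0 < ε) (hε2 : ε ≤ 1 / 2) (hA : Aᵀ * A = 1)
    [IsProbabilityMeasure (latentLaw p)]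
    (hP : ∫⁻ z, ENNReal.ofReal (Real.exp (μ * ‖z‖ ^ 2)) ∂(latentLaw p) ≤
      ENNReal.ofReal (Real.exp (k₀ * d)))
    (hLip : ∀ t ∈ Set.Ioc 0 T, ∀ z₁ z₂ : E d,
      ‖onSupportScore A p z₁ t - onSupportScore A p z₂ t‖ ≤ β * ‖z₁ - z₂‖)
    {τ : ℝ} (hτ : τ = timeLip A p t₀ T (4 * S * √(d * logFactor d t₀ ε))) :
    ∃ f ∈ reluClass d T ⌈10 * depthRate d ε⌉₊ (44 * c * widthRate d β T t₀ τ ε)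
        (4000 * c * (widthRate d β T t₀ τ ε * depthRate d ε))
        (2 * (2 + c₁) * S * rangeRate d t₀ ε) ((3 + c₁) * S * weightRate d β T t₀ τ ε)
        (10 * d * (1 + β)) (10 * τ),
      ∀ t ∈ Set.Icc t₀ T,
        eLpNorm (fun x => scoreNet A f x t - score (dataLaw A p) t x) 2
          (marginalLaw (dataLaw A p) t) ≤ ENNReal.ofReal ((√(d : ℝ) + 1) / noiseVar t * ε) := by
  have hd1 : (1 : ℝ) ≤ d := by exact_mod_cast hd
  have hsd : 1 ≤ √(d : ℝ) := Real.one_le_sqrt.2 hd1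
  have hmom := integrable_norm_pow_of_exp hμ (integrable_exp_of_lintegral_le hP).1
  have hid := integrable_id_of_moments hmom
  -- Nonnegativity of `β` follows from the Lipschitz bound tested on a unit vector, which exists as
  -- `d ≥ 1`.
  have hβ : 0 ≤ β := by
    have h1 := hLip T ⟨by linarith, le_rfl⟩ (EuclideanSpace.single ⟨0, hd⟩ 1) 0
    simp only [sub_zero, PiLp.norm_single, norm_one, mul_one] at h1
    exact (norm_nonneg _).trans h1
  have hτ0 : 0 ≤ τ := hτ ▸ timeLip_nonneg _ _ _ _ _
  -- the logarithmic factor and the basic scale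
  obtain ⟨hℓ1, hℓ2⟩ := log_le_logFactor hd h₀ ht₀ hε hε2
  have hlog2 : Real.log 2 ≤ Real.log (2 * d) := Real.log_le_log two_pos (by linarith)
  have hlog2' := Real.log_two_gt_d9
  have hadd := add_log_le hd h₀ ht₀ hε hε2
  set ℓ := logFactor d t₀ ε with hℓ
  have hℓ12 : 1 / 2 ≤ ℓ := by linarith
  set Y := √(d * ℓ) with hY
  have hLε : 0 ≤ Real.log (1 / ε) := Real.log_nonneg (by rw [le_div_iff₀ hε]; linarith)
  have hY12 : 1 / 2 ≤ Y := Real.le_sqrt_of_sq_le (by nlinarith)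
  have hlogpos : 0 < Real.log (2 * d) := by linarith
  -- constants
  have hc₁0 : 0 ≤ c₁ := by rw [hc₁]; positivity
  have hc₄ : 1 ≤ 8 * (2 + c₁) / l := by rw [le_div_iff₀ hl]; linarith
  have hlc : 0 ≤ Real.log (2 * (8 * (2 + c₁) / l)) := Real.log_nonneg (by linarith)
  have hc₂48 : 48 ≤ c₂ := by
    have h1 : 16 ≤ 2 / l := by rw [le_div_iff₀ hl]; linarith
    rw [hc₂]
    nlinarith
  have hS1 : 1 ≤ S := by rw [hS]; exact Real.one_le_sqrt.2 (by linarith)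
  -- radius of the ball
  set r₀ := √(c₂ * (d + Real.log (1 / ε))) with hr₀
  have hr₀d : √d ≤ r₀ := by
    refine Real.sqrt_le_sqrt ?_
    nlinarith
  have hr₀1 : 1 ≤ r₀ := hsd.trans hr₀d
  -- The gain of `√log(2d)` over the scale `√(dℓ)`, on which the count of lattice points relies.
  have hr₀S : r₀ ≤ S * (Y / √(Real.log (2 * d))) := by
    rw [hS, hY, ← Real.sqrt_div' _ hlogpos.le, ← Real.sqrt_mul (by linarith)]
    refine Real.sqrt_le_sqrt ?_
    calc _ ≤ c₂ * (3 * (d * ℓ) / Real.log (2 * d)) := by gcongr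
      _ = _ := by ring
  have hr₀Y : r₀ ≤ 2 * S * Y := by
    have h1 : 1 / 2 ≤ √(Real.log (2 * d)) := Real.le_sqrt_of_sq_le (by linarith)
    refine hr₀S.trans ?_
    rw [mul_comm 2 S, mul_assoc]
    refine mul_le_mul_of_nonneg_left ?_ (by linarith)
    rw [div_le_iff₀ (by linarith)]
    nlinarith
  have hS0 : 0 < S := by linarith
  have hY0 : 0 < Y := by linarith
  set W := weightRate d β T t₀ τ ε with hW
  have hWY : 2 * (1 + β) * Y ≤ W := le_max_left _ _
  have hWτ : T * τ ≤ W := le_max_right _ _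
  have hYβ : Y ≤ (1 + β) * Y := le_mul_of_one_le_left hY0.le (by linarith)
  have hW1 : 1 ≤ W := by linarith
  have hcW : ∀ x, x ≤ 3 * S * W → x ≤ (3 + c₁) * S * W := fun x hx => hx.trans (by
    have : 0 ≤ c₁ * S * W := by positivity
    nlinarith)
  have hSW : W ≤ S * W := le_mul_of_one_le_left (by linarith) hS1
  have hSY : S * ((1 + β) * Y) ≤ S * (W / 2) := mul_le_mul_of_nonneg_left (by linarith) hS0.le
  have hSY' : S * Y ≤ S * ((1 + β) * Y) := mul_le_mul_of_nonneg_left hYβ hS0.le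
  -- the lattice
  obtain ⟨s, k, hs0, hs3, hsk, hkd⟩ := exists_pow_eq_two_div hε hε2 hd
  set m := ⌈r₀ * (2 / ε) * (1 + β)⌉₊ with hm
  set N := ⌈T * τ * (2 / ε)⌉₊ with hN
  -- Rounding `r₀` up to a whole number of steps gives `r₀ ≤ r ≤ 2r₀ ≤ 4S√(dℓ)`; the last bound
  -- places the grid inside the cube over which `τ` is a supremum.
  set r : ℝ := m / (s ^ k * (1 + β)) with hr
  have hm1 : r₀ * (2 / ε) * (1 + β) ≤ m := Nat.le_ceil _
  have hm2 : (m : ℝ) ≤ r₀ * (2 / ε) * (1 + β) + 1 := (Nat.ceil_lt_add_one (by positivity)).le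
  have hN1 : T * τ * (2 / ε) ≤ N := Nat.le_ceil _
  have hN2 : (N : ℝ) ≤ T * τ * (2 / ε) + 1 := (Nat.ceil_lt_add_one (by positivity)).le
  have hε2' : 1 ≤ 2 / ε := by rw [le_div_iff₀ hε]; linarith
  have hr₀r : r₀ ≤ r := by
    rw [hr, hsk, le_div_iff₀ (by positivity)]
    linarith
  have hr2 : r ≤ 2 * r₀ := by
    rw [hr, hsk, div_le_iff₀ (by positivity)]
    have h1 : 1 ≤ r₀ * (2 / ε) * (1 + β) :=
      one_le_mul_of_one_le_of_one_le (one_le_mul_of_one_le_of_one_le hr₀1 hε2') (by linarith)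
    linarith
  have hrR : r ≤ 4 * S * Y := by linarith
  have hmε : 2 * m / s ^ k ≤ 3 * S * W := by
    rw [hsk, div_le_iff₀ (by positivity)]
    have h1 : 1 ≤ r₀ * (1 + β) := one_le_mul_of_one_le_of_one_le hr₀1 (by linarith)
    have h2 : r₀ * (1 + β) ≤ 2 * S * Y * (1 + β) := by gcongr
    have h3 : 3 * (r₀ * (1 + β)) ≤ 3 * S * W := by linarith
    have h4 : 2 * (m : ℝ) ≤ (3 * (r₀ * (1 + β))) * (2 / ε) := by
      have h5 : 2 ≤ (r₀ * (1 + β)) * (2 / ε) := by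
        have : 4 ≤ 2 / ε := by rw [le_div_iff₀ hε]; linarith
        nlinarith
      linarith
    exact h4.trans (by gcongr)
  have hNε : N / s ^ k ≤ 3 * S * W := by
    rw [hsk, div_le_iff₀ (by positivity)]
    have h1 : (N : ℝ) ≤ (T * τ + 1) * (2 / ε) := by linarith
    exact h1.trans (by gcongr; linarith)
  -- The growth bound for the posterior mean on the ball of radius `r₀`, so that truncating nodal
  -- values at `G` is harmless there.
  set G := 2 * r₀ + c₁ * √d with hG
  have hG0 : 0 ≤ G := by positivity
  have hGr : G ≤ (2 + c₁) * r₀ := by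
    have := mul_le_mul_of_nonneg_left hr₀d hc₁0
    linarith
  have hGY : G ≤ (2 + c₁) * (2 * S * Y) := hGr.trans (by gcongr)
  have hpost : ∀ t, 0 < t → ∀ z, ‖posterior (latentLaw p) t z‖ ≤ 2 * ‖z‖ + c₁ * √d :=
    fun t ht z => hc₁ ▸ norm_posterior_le hd hμ hk₀ hP ht z
  obtain ⟨f, hf, happrox⟩ := exists_mem_reluClass (κ := (3 + c₁) * S * W) (N := N) h₀ ht₀ hT
    (by linarith : 0 < 1 + β) hτ0 hs0 hG0 hr (by rw [hsk]; exact hN1)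
    (fun z t => posterior (latentLaw p) t z)
    (fun t ht z z' => norm_posterior_sub_le hA hid (h₀.trans_le ht.1)
      (hLip t ⟨h₀.trans_le ht.1, ht.2⟩ z z'))
    (fun z hz t ht t' ht' => hτ ▸ norm_posterior_sub_time_le hA hmom h₀ (by positivity)
      (fun i => (hz i).trans hrR) ht ht')
    (hcW _ (by linarith)) (hcW _ (by linarith)) (hcW _ (by nlinarith))
    (hcW _ (by nlinarith)) (hcW _ hmε) (hcW _ hNε) (hcW _ (by linarith))
    (by
      have h1 : (2 + c₁) * (2 * S * Y) ≤ (2 + c₁) * (S * W) := by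
        gcongr ?_ * ?_
        linarith
      have h2 : 0 ≤ S * W := by positivity
      linarith)
  rw [hkd] at hf
  have hcard := card_lattice_mul_sq_le hd hβ h₀ ht₀ (zero_le_one.trans hT) hτ0 hε hε2 hr₀1 hr₀S (hc d)
  rw [← hm, ← hN] at hcard
  set X : ℕ := (N + 1) * (2 * m + 1) ^ d with hX
  have hX1 : 1 ≤ X := Nat.succ_le_of_lt (by positivity)
  refine ⟨f, reluClass_mono ?_ ?_ ?_ ?_ ?_ hf, fun t ht => ?_⟩
  · have h1 := card_mul_add_le_card_mul_sq hX1 hd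
    have h2 : ((X * (2 * (d + 3)) + 2 * d + 1 : ℕ) : ℝ) ≤ 11 * (X * (d : ℝ) ^ 2) := by
      exact_mod_cast h1
    linarith
  · have h1 : X * (2 * (d + 3) * (2 * (d + 3) + d + 2) + d) ≤ 89 * (X * d ^ 2) := by
      calc _ ≤ X * (89 * d ^ 2) := Nat.mul_le_mul_left _ (weight_count_le hd)
        _ = _ := by ring
    have h2 : ((X * (2 * (d + 3) * (2 * (d + 3) + d + 2) + d) : ℕ) : ℝ) ≤
        89 * (X * (d : ℝ) ^ 2) := by exact_mod_cast h1
    have hdr : 1 ≤ depthRate d ε := by unfold depthRate; linarith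
    have h3 : (⌈10 * depthRate d ε⌉₊ : ℝ) ≤ 11 * depthRate d ε := by
      have := (Nat.ceil_lt_add_one (by linarith : 0 ≤ 10 * depthRate d ε)).le
      linarith
    rw [Nat.cast_mul]
    calc _ ≤ (11 * depthRate d ε) * (89 * (4 * c * widthRate d β T t₀ τ ε)) := by
          refine mul_le_mul h3 (h2.trans (by linarith)) (by positivity) (by positivity)
      _ ≤ _ := by
          have h4 : 0 ≤ c * widthRate d β T t₀ τ ε := by
            have : (0 : ℝ) ≤ X * (d : ℝ) ^ 2 := by positivity
            linarith
          nlinarith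
  · have h1 : √d * Y ≤ 2 * d ^ 2 * ℓ := sqrt_mul_sqrt_mul_le hd hℓ12
    calc √d * G ≤ √d * ((2 + c₁) * (2 * S * Y)) := by gcongr
      _ = 2 * (2 + c₁) * S * (√d * Y) := by ring
      _ ≤ _ := by
          unfold rangeRate
          gcongr
  · have h1 : √(d : ℝ) ≤ d := Real.sqrt_le_self_iff.2 (Or.inr hd1)
    have : (1 + β) * √d ≤ (1 + β) * d := by gcongr
    have h2 : 0 ≤ (1 + β) * d := by positivity
    linarith
  · linarith
  · have ht0 : 0 < t := h₀.trans_le ht.1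
    refine eLpNorm_scoreNet_sub_score_le hA hd hμ hP hl hl8 hlμ hc₁0 hr₀d hε ht0 (hpost t ht0)
      (fun z => hf.2.1 z t ⟨ht0.le, ht.2⟩) (fun z hz => ?_)
      (by rw [hr₀, hc₂]; exact tail_le hd hε hε2 hl hk₀ hc₄)
    have h1 := happrox t ht z
      (fun i => ((PiLp.norm_apply_le z i).trans hz).trans hr₀r)
      (fun i => ((PiLp.norm_apply_le _ i).trans (hpost t ht0 z)).trans (by rw [hG]; gcongr))
    rw [hsk] at h1
    refine h1.trans (le_of_eq ?_)
    field_simp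

end ScoreApprox
end

/-! ### Choice of the constants -/

open ScoreApprox in
theorem theorem1 (B C₁ C₂ : ℝ) (hB : 0 < B) (hC₁ : 0 < C₁) (hC₂ : 0 < C₂) :
    ∃ cR cL cM cJ cK cκ : ℝ,
      0 < cR ∧ 0 < cL ∧ 0 < cM ∧ 0 < cJ ∧ 0 < cK ∧ 0 < cκ ∧
      ∀ (d D : ℕ) (T t₀ ε β : ℝ) (A : Matrix (Fin D) (Fin d) ℝ) (p : E d → ℝ),
        1 ≤ d → 0 < t₀ → t₀ ≤ 1 → 1 ≤ T → 0 < ε → ε ≤ 1 / 2 →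
        -- the data are `x = A z`, where `z` has the density `p`
        A.transpose * A = 1 →
        MeasureTheory.IsProbabilityMeasure (latentLaw p) →
        -- regularity and tail of the latent density
        (∀ z, 0 < p z) → ContDiff ℝ 2 p →
        (∀ z, B ≤ ‖z‖ →
          p z ≤ (2 * Real.pi) ^ (-(d : ℝ) / 2) * C₁ * Real.exp (-C₂ * ‖z‖ ^ 2 / 2)) →
        -- the on-support score is `β`-Lipschitz
        (∀ t ∈ Set.Ioc 0 T, ∀ z₁ z₂ : E d,
          ‖onSupportScore A p z₁ t - onSupportScore A p z₂ t‖ ≤ β * ‖z₁ - z₂‖) →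
        ∀ (τ : ℝ) (L : ℕ) (M J K κ γ γt : ℝ),
          τ = timeLip A p t₀ T (cR * √(d * logFactor d t₀ ε)) →
          L = ⌈cL * depthRate d ε⌉₊ →
          M = cM * widthRate d β T t₀ τ ε →
          J = cJ * (widthRate d β T t₀ τ ε * depthRate d ε) →
          K = cK * rangeRate d t₀ ε →
          κ = cκ * weightRate d β T t₀ τ ε →
          γ = 10 * d * (1 + β) →
          γt = 10 * τ →
          ∃ f ∈ reluClass d T L M J K κ γ γt,
            scoreNet A f ∈ scoreNetClass d D T L M J K κ γ γt ∧
            ∀ t ∈ Set.Icc t₀ T,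
              MeasureTheory.eLpNorm (fun x => scoreNet A f x t - score (dataLaw A p) t x) 2
                  (marginalLaw (dataLaw A p) t)
                ≤ ENNReal.ofReal ((√(d : ℝ) + 1) / noiseVar t * ε) := by
  -- Half of the decay rate `C₂/2` of the latent density, leaving a Gaussian factor to integrate.
  set μ := C₂ / 4 with hμ
  have hμ0 : 0 < μ := by positivity
  set K₀ := (Real.exp (C₂ / 4 * B ^ 2) + C₁ + 1) * (1 + 2 / C₂) with hK₀
  have hK₀1 : 1 ≤ K₀ := by
    have h1 := Real.exp_pos (C₂ / 4 * B ^ 2)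
    have h2 : 0 < 2 / C₂ := by positivity
    nlinarith
  set k₀ := Real.log K₀ with hk₀
  have hk₀0 : 0 ≤ k₀ := Real.log_nonneg hK₀1
  -- The exponent that survives the noising: `1/8` serves the Gaussian noise, `4l ≤ μ` the latent
  -- variable.
  set l := min (μ / 4) (1 / 8) with hl
  have hl0 : 0 < l := lt_min (by positivity) (by norm_num)
  have hlμ : 4 * l ≤ μ := by
    have := min_le_left (μ / 4) (1 / 8)
    linarith
  set c₁ := 3 * √((k₀ + 1) / μ) + 1 / √μ with hc₁
  set c₂ := 2 / l * (k₀ + 3 + 2 * Real.log (2 * (8 * (2 + c₁) / l))) with hc₂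
  set S := √(3 * c₂) with hS
  have hc₁0 : 0 ≤ c₁ := by positivity
  have hS0 : 0 < S := by
    have h1 : 1 ≤ 8 * (2 + c₁) / l := by
      have : l ≤ 1 / 8 := min_le_right _ _
      rw [le_div_iff₀ hl0]
      linarith
    have : 0 ≤ Real.log (2 * (8 * (2 + c₁) / l)) := Real.log_nonneg (by linarith)
    exact Real.sqrt_pos.2 (by positivity)
  obtain ⟨c, hc0, hc⟩ := exists_forall_mul_pow_le (7 * S) (by positivity)
  refine ⟨4 * S, 10, 44 * c, 4000 * c, 2 * (2 + c₁) * S, (3 + c₁) * S, by positivity, by norm_num,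
    by positivity, by positivity, by positivity, by positivity, ?_⟩
  intro d D T t₀ ε β A p hd h₀ ht₀ hT hε hε2 hA hprob hp hsmooth htail hLip τ L M J K κ γ γt
    hτ hL hM hJ hK hκ hγ hγt
  obtain ⟨f, hf, herr⟩ := exists_score_network hμ0 hk₀0 hl0 (min_le_right _ _) hlμ hc₁ hc₂ hS hc hd
    h₀ ht₀ hT hε hε2 hA
    (lintegral_exp_latentLaw_le hC₁ hC₂ hd hp hsmooth.continuous.measurable htail) hLip hτ
  rw [← hL, ← hM, ← hJ, ← hK, ← hκ, ← hγ, ← hγt] at hf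
  exact ⟨f, hf, ⟨A, hA, f, hf, rfl⟩, herr⟩
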